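/- **Setting.** A *process type* is a Petri net with arc weights at most $1$, exactly one initial token, and transitions partitioned into observable and internal ones, each transition $t$ having exactly one predecessor ${}^\bullet t$ and one successor $t^\bullet$. Let $\mathbb{P}$ be a finite set of process types with pairwise disjoint sets of places and transitions, $Q_{\mathbb{P}}$ the set of all their places and $T^{obs}_{\mathbb{P}}$ the set of all their observable transitions. Port labels $\pi$ each have a process type $\mathrm{ptype}(\pi)\in\mathbb{P}$. Graphs are finite, with edges labeled by pairs in $T^{obs}_{\mathbb{P}}\times T^{obs}_{\mathbb{P}}$ and vertices labeled by sets of process types and ports. The *VR-operations* are: the single vertex labeled $\{\pi,\mathrm{ptype}(\pi)\}$; disjoint union; addition of a $\delta$-edge from every $\pi_1$-port to every $\pi_2$-port ($\pi_1\ne\pi_2$); redefinition of ports by a type-preserving finite partial function (ports on which it is undefined are erased). The *HR-operations* are: the single vertex; the single $\delta$-edge from a $\pi_1$-port to a $\pi_2$-port ($\pi_1\neq\pi_2$, each end also labeled with its process type); composition, i.e. disjoint union followed by joining every vertex of the first graph with every vertex of the second one carrying the same port; port redefinition by injective type-preserving finite partial functions. A VR- (resp. HR-) *grammar* $\Gamma$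 is a finite set of rules $X\to t$, where $t$ is a term over these operations and nonterminals, and axioms $\to X$; its language $\mathcal{L}(\Gamma)$ is the set of values of the ground terms derivable from an axiom. A *system* over $\mathbb{P}$ is a loop-free graph without ports each of whose vertices $v$ is labeled with exactly one process type $p_v\in\mathbb{P}$, and whose edges $v\xrightarrow{(t,t')}v'$ satisfy: $t$ and $t'$ are observable transitions of $p_v$ and $p_{v'}$. Its *behavior* is the Petri net with places $(q,v)$, $q$ a place of $p_v$, whose transitions are the pairs $(t,v)$ with $t$ an internal transition of $p_v$, moving a token from $({}^\bullet t,v)$ to $(t^\bullet,v)$, and the edges $v\xrightarrow{(t,t')}v'$, moving tokens from $({}^\bullet t,v),({}^\bullet t',v')$ to $(t^\bullet,v),(t'^\bullet,v')$ simultaneously; initially $(q,v)$ is marked iff $q$ is initially marked in $p_v$. Given a partial labeling $\mathsf{L}:Q_{\mathbb{P}}\rightharpoonup\mathbb{X}$ of places by variables and a formula $\alpha$ of first-order arithmetic (natural constants, $+$, $\cdot$, $=$, $\le$, quantifiers over $\mathbb{N}$), $\mathsf{PRP}(\Gamma,\alpha,\mathsf{L},\mathbb{P})$ is defined for grammars $\Gamma$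 all of whose graphs are systems over $\mathbb{P}$, and holds iff some $S\in\mathcal{L}(\Gamma)$ has a behavior with a reachable marking in which $\alpha$ is true when each free variable $x$ is interpreted as the total number of tokens in the places $(q,v)$ with $\mathsf{L}(q)=x$. The set $\mathbb{P}^{\triangleright}$ consists of: - for each $p\in\mathbb{P}$ its *half process*, with the places of $p$ and a new place $h_t$ for each observable transition $t$ of $p$, the internal transitions and initial marking of $p$, and, instead of each observable $t$, two observable transitions $\mathrm{try}_t:{}^\bullet t\to h_t$ and $\mathrm{commit}_t:h_t\to t^\bullet$; - for each $t\in T^{obs}_{\mathbb{P}}$ a *routing process* $\epsilon_t$ with places $\mathsf{idle}_t$ (initially marked), $\mathsf{active}_t,\mathsf{wait}_t,\mathsf{reply}_t$ and observable transitions $\mathsf{recv}:\mathsf{idle}_t\to\mathsf{active}_t$, $\mathsf{fwd}:\mathsf{active}_t\to\mathsf{wait}_t$, $\mathsf{ack}:\mathsf{wait}_t\to\mathsf{reply}_t$, $\mathsf{reset}:\mathsf{reply}_t\to\mathsf{idle}_t$, $t:\mathsf{active}_t\to\mathsf{reply}_t$. The labeling $\mathsf{L}^{\triangleright}$ equals $\mathsf{L}$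 on $Q_{\mathbb{P}}$, $\mathsf{L}^{\triangleright}(\mathsf{active}_t)=\mathsf{L}({}^\bullet t)$, $\mathsf{L}^{\triangleright}(\mathsf{reply}_t)=\mathsf{L}(t^\bullet)$ for $t\in T^{obs}_{\mathbb{P}}$, and is undefined elsewhere. **Theorem.** $\mathbb{P}^{\triangleright}$ is a finite set of process types, computable from $\mathbb{P}$, and $\mathsf{L}^{\triangleright}$ is computable from $\mathbb{P}$ and $\mathsf{L}$. There is a computable function that maps every finite set $\mathbb{P}$ of process types and every VR-grammar $\Gamma$ to an HR-grammar $\Gamma'$ such that, if $\Gamma$ is a VR-grammar over $\mathbb{P}$ all of whose graphs are systems over $\mathbb{P}$, then $\Gamma'$ is an HR-grammar over $\mathbb{P}^{\triangleright}$ all of whose graphs are systems over $\mathbb{P}^{\triangleright}$, and for every partial place labeling $\mathsf{L}:Q_{\mathbb{P}}\rightharpoonup\mathbb{X}$ and every arithmetic formula $\alpha$, $$\mathsf{PRP}(\Gamma,\alpha,\mathsf{L},\mathbb{P})\iff\mathsf{PRP}(\Gamma',\alpha,\mathsf{L}^{\triangleright},\mathbb{P}^{\triangleright}).$$ In particular,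 the parametric reachability problem for VR systems effectively reduces to that for HR systems. -/

import Mathlib

/-! ### Process types

Process types, transitions, ports and nonterminals are finite objects named by natural numbers, so
that it makes sense to compute with them. A finite set of process types is a list; everything that
belongs to the `i`-th process type is tagged with `i`, which makes the sets of places, transitions
and ports of different process types disjoint. -/

/-- A process type: a Petri net with arcs of weight one, exactly one initial token, and exactly one
predecessor and one successor for each transition. The places are `0, …, numPlaces - 1`; a
transition is given by the pair (predecessor, successor), and named by its position in the list of
observable, respectively internal, transitions; `start` is the initially marked place. -/
structure ProcType where
  numPlaces : ℕ
  obs : List (ℕ × ℕ)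
  internal : List (ℕ × ℕ)
  start : ℕ

/-- The components of a process type, as a tuple. -/
def ProcType.equivTuple : ProcType ≃ ℕ × List (ℕ × ℕ) × List (ℕ × ℕ) × ℕ where
  toFun p := (p.numPlaces, p.obs, p.internal, p.start)
  invFun x := ⟨x.1, x.2.1, x.2.2.1, x.2.2.2⟩
  left_inv _ := rfl
  right_inv _ := rfl

instance : Primcodable ProcType := Primcodable.ofEquiv _ ProcType.equivTuple

/-- All places mentioned are places of the process type (in particular there is one). -/
def ProcType.WF (p : ProcType) : Prop :=
  p.start < p.numPlaces ∧
  (∀ a ∈ p.obs, a.1 < p.numPlaces ∧ a.2 < p.numPlaces) ∧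
  (∀ a ∈ p.internal, a.1 < p.numPlaces ∧ a.2 < p.numPlaces)

/-- `(i, q)` is place `q` of the `i`-th process type. -/
abbrev Place := ℕ × ℕ

/-- `(i, j)` is transition `j` of the `i`-th process type. -/
abbrev PTrans := ℕ × ℕ

/-- `(i, n)` is the port label with name `n` and process type `i`. -/
abbrev Port := ℕ × ℕ

/-- Edge labels are pairs of (observable) transitions. -/
abbrev EdgeLabel := PTrans × PTrans

/-- The set of places of the process types `P`. -/
def IsPlace (P : List ProcType) (q : Place) : Prop :=
  ∃ p, P[q.1]? = some p ∧ q.2 < p.numPlaces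

/-- The set of observable transitions of the process types `P`. -/
def IsObs (P : List ProcType) (t : PTrans) : Prop :=
  ∃ p, P[t.1]? = some p ∧ t.2 < p.obs.length

/-- The set of internal transitions of the process types `P`. -/
def IsInternal (P : List ProcType) (t : PTrans) : Prop :=
  ∃ p, P[t.1]? = some p ∧ t.2 < p.internal.length

/-- The predecessor of an observable transition. -/
def obsPre (P : List ProcType) (t : PTrans) : Option Place :=
  P[t.1]?.bind fun p => p.obs[t.2]?.map fun a => (t.1, a.1)

/-- The successor of an observable transition. -/
def obsPost (P : List ProcType) (t : PTrans) : Option Place :=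
  P[t.1]?.bind fun p => p.obs[t.2]?.map fun a => (t.1, a.2)

/-- The predecessor of an internal transition. -/
def internalPre (P : List ProcType) (t : PTrans) : Option Place :=
  P[t.1]?.bind fun p => p.internal[t.2]?.map fun a => (t.1, a.1)

/-- The successor of an internal transition. -/
def internalPost (P : List ProcType) (t : PTrans) : Option Place :=
  P[t.1]?.bind fun p => p.internal[t.2]?.map fun a => (t.1, a.2)

/-- The initially marked place of the `i`-th process type. -/
def startPlace (P : List ProcType) (i : ℕ) : Option Place :=
  P[i]?.map fun p => (i, p.start)

theorem finite_isPlace (P : List ProcType) : {q | IsPlace P q}.Finite := by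
  have h : {q | IsPlace P q} ⊆
      ⋃ i ∈ Set.Iio P.length, (fun n => (i, n)) '' Set.Iio ((P[i]?.map ProcType.numPlaces).getD 0) := by
    rintro ⟨i, n⟩ ⟨p, hp, hn⟩
    obtain ⟨hi, -⟩ := List.getElem?_eq_some_iff.1 hp
    simp only [Set.mem_iUnion]
    refine ⟨i, hi, n, ?_, rfl⟩
    simp only at hp
    simpa [hp] using hn
  exact ((Set.finite_Iio _).biUnion fun i _ => (Set.finite_Iio _).image _).subset h

theorem finite_isInternal (P : List ProcType) : {t | IsInternal P t}.Finite := by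
  have h : {t | IsInternal P t} ⊆
      ⋃ i ∈ Set.Iio P.length,
        (fun n => (i, n)) '' Set.Iio ((P[i]?.map fun p => p.internal.length).getD 0) := by
    rintro ⟨i, n⟩ ⟨p, hp, hn⟩
    obtain ⟨hi, -⟩ := List.getElem?_eq_some_iff.1 hp
    simp only [Set.mem_iUnion]
    refine ⟨i, hi, n, ?_, rfl⟩
    simp only at hp
    simpa [hp] using hn
  exact ((Set.finite_Iio _).biUnion fun i _ => (Set.finite_Iio _).image _).subset h

/-! ### Graphs and their operations -/

/-- Vertex labels: process types and port labels. -/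
inductive Label where
  | proc (i : ℕ)
  | port (π : Port)

/-- Finite directed graphs with labeled edges and sets of labels on the vertices. (That there are
no self-loops is part of `IsSystem`.) -/
structure LGraph where
  V : Type
  finV : Finite V
  edges : Set (V × EdgeLabel × V)
  finE : edges.Finite
  lab : V → Set Label

namespace LGraph

/-- The graph without vertices. -/
def empty : LGraph where
  V := Empty
  finV := inferInstance
  edges := ∅
  finE := Set.finite_empty
  lab := Empty.elim

/-- A single vertex, labeled with the port `π` and its process type. -/
def vertex (π : Port) : LGraph where
  V := Unit
  finV := inferInstance
  edges := ∅
  finE := Set.finite_empty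
  lab _ := {Label.port π, Label.proc π.1}

/-- A single `δ`-edge from a `π₁`-port (`false`) to a `π₂`-port (`true`). -/
def edge (δ : EdgeLabel) (π₁ π₂ : Port) : LGraph where
  V := Bool
  finV := inferInstance
  edges := {(false, δ, true)}
  finE := Set.finite_singleton _
  lab b := if b then {Label.port π₂, Label.proc π₂.1} else {Label.port π₁, Label.proc π₁.1}

/-- Disjoint union. -/
def union (G H : LGraph) : LGraph where
  V := G.V ⊕ H.V
  finV := by have := G.finV; have := H.finV; infer_instance
  edges := (fun e => (Sum.inl e.1, e.2.1, Sum.inl e.2.2)) '' G.edges ∪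
    (fun e => (Sum.inr e.1, e.2.1, Sum.inr e.2.2)) '' H.edges
  finE := (G.finE.image _).union (H.finE.image _)
  lab := Sum.elim G.lab H.lab

/-- Edge creation: add a `δ`-edge from each `π₁`-port to each `π₂`-port. -/
def addEdge (δ : EdgeLabel) (π₁ π₂ : Port) (G : LGraph) : LGraph where
  V := G.V
  finV := G.finV
  edges := G.edges ∪
    {e | Label.port π₁ ∈ G.lab e.1 ∧ e.2.1 = δ ∧ Label.port π₂ ∈ G.lab e.2.2}
  finE := by
    have := G.finV
    refine G.finE.union ((Set.finite_range
      (fun x : G.V × G.V => (x.1, δ, x.2))).subset ?_)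
    rintro ⟨v, d, w⟩ ⟨-, h, -⟩
    exact ⟨(v, w), by simp only at h; simp [h]⟩
  lab := G.lab

/-- Port (source) redefinition by the finite partial function with graph `α`; ports on which `α` is
undefined are erased. -/
def rename (α : List (Port × Port)) (G : LGraph) : LGraph where
  V := G.V
  finV := G.finV
  edges := G.edges
  finE := G.finE
  lab v := {l | ∃ π π', Label.port π ∈ G.lab v ∧ (π, π') ∈ α ∧ l = Label.port π'} ∪
    {l | ∃ i, l = Label.proc i ∧ l ∈ G.lab v}

/-- A vertex of `G` and a vertex of `H` that carry a common port, to be joined. -/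
def Joined (G H : LGraph) (a b : G.V ⊕ H.V) : Prop :=
  ∃ v w π, a = Sum.inl v ∧ b = Sum.inr w ∧ Label.port π ∈ G.lab v ∧ Label.port π ∈ H.lab w

/-- Composition: the disjoint union in which all pairs of vertices of `G` and `H` that carry a
common port are joined; the label of a vertex is the union of the labels of the joined vertices. -/
def comp (G H : LGraph) : LGraph where
  V := Quot (Joined G H)
  finV := by
    have := (union G H).finV
    exact Finite.of_surjective (α := (union G H).V) (Quot.mk (Joined G H)) Quot.mk_surjective
  edges := (fun e => (Quot.mk _ e.1, e.2.1, Quot.mk _ e.2.2)) '' (union G H).edges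
  finE := (union G H).finE.image _
  lab x := {l | ∃ a : G.V ⊕ H.V, Quot.mk _ a = x ∧ l ∈ (union G H).lab a}

end LGraph

/-! ### Terms and grammars -/

/-- Terms over constants `A`, unary function symbols `B` and one binary function symbol, with
nonterminals (variables) named by natural numbers. -/
inductive Term (A B : Type) where
  | var (X : ℕ) : Term A B
  | const (a : A) : Term A B
  | un (b : B) (t : Term A B) : Term A B
  | bin (t₁ t₂ : Term A B) : Term A B

namespace Term

variable {A B : Type}

/-- A term is ground if no variable occurs in it. -/
def Ground : Term A B → Prop
  | var _ => False
  | const _ => True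
  | un _ t => t.Ground
  | bin t₁ t₂ => t₁.Ground ∧ t₂.Ground

/-- All constants of a term satisfy `p` and all its unary function symbols satisfy `q`. -/
def AllOps (p : A → Prop) (q : B → Prop) : Term A B → Prop
  | var _ => True
  | const a => p a
  | un b t => q b ∧ t.AllOps p q
  | bin t₁ t₂ => t₁.AllOps p q ∧ t₂.AllOps p q

/-- Terms written in prefix notation, as words over variables, constants, unary symbols and the
binary symbol. -/
def code : Term A B → List (ℕ ⊕ A ⊕ B ⊕ Unit)
  | var X => [Sum.inl X]
  | const a => [Sum.inr (Sum.inl a)]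
  | un b t => Sum.inr (Sum.inr (Sum.inl b)) :: t.code
  | bin t₁ t₂ => Sum.inr (Sum.inr (Sum.inr ())) :: (t₁.code ++ t₂.code)

theorem code_append_inj (s t : Term A B) (k l : List (ℕ ⊕ A ⊕ B ⊕ Unit))
    (h : s.code ++ k = t.code ++ l) : s = t ∧ k = l := by
  induction s generalizing t k l with
  | var X => cases t <;> simp_all [code]
  | const a => cases t <;> simp_all [code]
  | un b s ih =>
    cases t with
    | un b' t =>
      simp only [code, List.cons_append, List.cons.injEq, Sum.inr.injEq, Sum.inl.injEq] at h
      obtain ⟨h₁, h₂⟩ := ih _ _ _ h.2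
      exact ⟨by rw [h.1, h₁], h₂⟩
    | _ => simp [code] at h
  | bin s₁ s₂ ih₁ ih₂ =>
    cases t with
    | bin t₁ t₂ =>
      simp only [code, List.cons_append, List.cons.injEq, List.append_assoc, true_and] at h
      obtain ⟨h₁, h₂⟩ := ih₁ _ _ _ h
      obtain ⟨h₃, h₄⟩ := ih₂ _ _ _ h₂
      exact ⟨by rw [h₁, h₃], h₄⟩
    | _ => simp [code] at h

theorem code_injective : Function.Injective (code : Term A B → _) := fun s t h =>
  (code_append_inj s t [] [] (by rw [h])).1

end Term

/-- A grammar: the nonterminals `X` with an axiom `→ X`, and the rules `X → t`. -/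
structure Grammar (A B : Type) where
  axs : List ℕ
  rules : List (ℕ × Term A B)

namespace Grammar

variable {A B : Type}

/-- The grammar as a finite word-like object, with the terms in prefix notation. -/
def code (Γ : Grammar A B) : List ℕ × List (ℕ × List (ℕ ⊕ A ⊕ B ⊕ Unit)) :=
  (Γ.axs, Γ.rules.map fun r => (r.1, r.2.code))

theorem code_injective : Function.Injective (code : Grammar A B → _) := by
  rintro ⟨a, r⟩ ⟨a', r'⟩ h
  simp only [code, Prod.mk.injEq] at h
  obtain ⟨rfl, h⟩ := h
  have hinj : Function.Injective fun x : ℕ × Term A B => (x.1, x.2.code) := by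
    rintro ⟨x, s⟩ ⟨y, t⟩ hxy
    simp only [Prod.mk.injEq] at hxy
    rw [hxy.1, Term.code_injective hxy.2]
  rw [List.map_injective_iff.2 hinj h]

/-- A step replaces one occurrence of a nonterminal by the right-hand side of one of its rules. -/
inductive Step (Γ : Grammar A B) : Term A B → Term A B → Prop
  | root {X : ℕ} {t : Term A B} : (X, t) ∈ Γ.rules → Step Γ (Term.var X) t
  | un {b : B} {s t : Term A B} : Step Γ s t → Step Γ (Term.un b s) (Term.un b t)
  | left {s t u : Term A B} : Step Γ s t → Step Γ (Term.bin s u) (Term.bin t u)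
  | right {s t u : Term A B} : Step Γ s t → Step Γ (Term.bin u s) (Term.bin u t)

end Grammar

/-- A graph algebra: an interpretation of the function symbols. -/
structure GraphAlgebra (A B : Type) where
  const : A → LGraph
  un : B → LGraph → LGraph
  bin : LGraph → LGraph → LGraph

/-- The value of a ground term (variables, which do not occur in ground terms, get a dummy
value). -/
def GraphAlgebra.val {A B : Type} (Ω : GraphAlgebra A B) : Term A B → LGraph
  | Term.var _ => LGraph.empty
  | Term.const a => Ω.const a
  | Term.un b t => Ω.un b (Ω.val t)
  | Term.bin t₁ t₂ => Ω.bin (Ω.val t₁) (Ω.val t₂)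

/-- The language of a grammar: the values of the ground terms derived from an axiom (one
representative for each of the denoted graphs, which are only considered up to isomorphism). -/
def GraphAlgebra.language {A B : Type} (Ω : GraphAlgebra A B) (Γ : Grammar A B) : Set LGraph :=
  {G | ∃ X ∈ Γ.axs, ∃ θ, Relation.ReflTransGen Γ.Step (Term.var X) θ ∧ θ.Ground ∧ G = Ω.val θ}

/-! ### The algebras VR and HR -/

/-- Unary VR function symbols: edge creation and port redefinition. -/
inductive VRUnary where
  | addEdge (δ : EdgeLabel) (π₁ π₂ : Port)
  | rename (α : List (Port × Port))

/-- HR constants: single-vertex and single-edge graphs. -/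
inductive HRConst where
  | vertex (π : Port)
  | edge (δ : EdgeLabel) (π₁ π₂ : Port)

def VRUnary.equivSum : VRUnary ≃ (EdgeLabel × Port × Port) ⊕ List (Port × Port) where
  toFun
    | addEdge δ π₁ π₂ => Sum.inl (δ, π₁, π₂)
    | rename α => Sum.inr α
  invFun
    | Sum.inl x => addEdge x.1 x.2.1 x.2.2
    | Sum.inr α => rename α
  left_inv x := by cases x <;> rfl
  right_inv x := by cases x <;> rfl

def HRConst.equivSum : HRConst ≃ Port ⊕ (EdgeLabel × Port × Port) where
  toFun
    | vertex π => Sum.inl π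
    | edge δ π₁ π₂ => Sum.inr (δ, π₁, π₂)
  invFun
    | Sum.inl π => vertex π
    | Sum.inr x => edge x.1 x.2.1 x.2.2
  left_inv x := by cases x <;> rfl
  right_inv x := by cases x <;> rfl

instance : Primcodable VRUnary := Primcodable.ofEquiv _ VRUnary.equivSum

instance : Primcodable HRConst := Primcodable.ofEquiv _ HRConst.equivSum

/-- The constants of VR are the single-vertex graphs; the unary symbols of HR are the source
redefinitions. -/
abbrev VRGrammar := Grammar Port VRUnary

abbrev HRGrammar := Grammar HRConst (List (Port × Port))

/-- The algebra VR. -/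
def algVR : GraphAlgebra Port VRUnary where
  const := LGraph.vertex
  un
    | VRUnary.addEdge δ π₁ π₂ => LGraph.addEdge δ π₁ π₂
    | VRUnary.rename α => LGraph.rename α
  bin := LGraph.union

/-- The algebra HR. -/
def algHR : GraphAlgebra HRConst (List (Port × Port)) where
  const
    | HRConst.vertex π => LGraph.vertex π
    | HRConst.edge δ π₁ π₂ => LGraph.edge δ π₁ π₂
  un := LGraph.rename
  bin := LGraph.comp

/-- `π` is a port label over the process types `P`. -/
def IsPort (P : List ProcType) (π : Port) : Prop := π.1 < P.length

/-- `δ`, `π₁`, `π₂` are admissible parameters of edge creation and of single-edge graphs. -/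
def EdgeOK (P : List ProcType) (δ : EdgeLabel) (π₁ π₂ : Port) : Prop :=
  IsObs P δ.1 ∧ IsObs P δ.2 ∧ IsPort P π₁ ∧ IsPort P π₂ ∧ π₁ ≠ π₂

/-- `α` is the graph of a type-preserving partial function on port labels. -/
def RenamingOK (P : List ProcType) (α : List (Port × Port)) : Prop :=
  (∀ π π', (π, π') ∈ α → IsPort P π ∧ π.1 = π'.1) ∧
  (∀ π π₁ π₂, (π, π₁) ∈ α → (π, π₂) ∈ α → π₁ = π₂)

def VRUnary.OK (P : List ProcType) : VRUnary → Prop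
  | addEdge δ π₁ π₂ => EdgeOK P δ π₁ π₂
  | rename α => RenamingOK P α

def HRConst.OK (P : List ProcType) : HRConst → Prop
  | vertex π => IsPort P π
  | edge δ π₁ π₂ => EdgeOK P δ π₁ π₂

/-- In HR, source redefinitions are moreover injective. -/
def InjRenamingOK (P : List ProcType) (α : List (Port × Port)) : Prop :=
  RenamingOK P α ∧ ∀ π₁ π₂ π, (π₁, π) ∈ α → (π₂, π) ∈ α → π₁ = π₂

/-- All function symbols of the grammar are VR operations over `P`. -/
def VRGrammar.WF (P : List ProcType) (Γ : VRGrammar) : Prop :=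
  ∀ r ∈ Γ.rules, r.2.AllOps (IsPort P) (VRUnary.OK P)

/-- All function symbols of the grammar are HR operations over `P`. -/
def HRGrammar.WF (P : List ProcType) (Γ : HRGrammar) : Prop :=
  ∀ r ∈ Γ.rules, r.2.AllOps (HRConst.OK P) (InjRenamingOK P)

/-! ### Systems and their behavior -/

/-- Systems (without ports) over the process types `P`: each vertex has exactly one process type,
which belongs to `P`, and no port; there are no self-loops; each edge is labeled with observable
transitions of the process types of its ends. -/
def IsSystem (P : List ProcType) (G : LGraph) : Prop :=
  (∀ v, ∃ i < P.length, G.lab v = {Label.proc i}) ∧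
  ∀ v δ w, (v, δ, w) ∈ G.edges → v ≠ w ∧
    IsObs P δ.1 ∧ Label.proc δ.1.1 ∈ G.lab v ∧ IsObs P δ.2 ∧ Label.proc δ.2.1 ∈ G.lab w

/-- Petri nets; `inW q t` and `outW t q` are the weights of `(q, t)` and `(t, q)`. -/
structure PetriNet where
  Place : Type
  Trans : Type
  finPlace : Finite Place
  finTrans : Finite Trans
  inW : Place → Trans → ℕ
  outW : Trans → Place → ℕ
  m₀ : Place → ℕ

namespace PetriNet

/-- Firing transition `t` in the marking `m` leads to the marking `m'`. -/
def Fire (N : PetriNet) (m : N.Place → ℕ) (t : N.Trans) (m' : N.Place → ℕ) : Prop :=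
  (∀ q, N.inW q t ≤ m q) ∧ ∀ q, m' q = m q - N.inW q t + N.outW t q

/-- `m` is reached from the initial marking by a finite firing sequence. -/
def Reachable (N : PetriNet) (m : N.Place → ℕ) : Prop :=
  Relation.ReflTransGen (fun m m' => ∃ t, N.Fire m t m') N.m₀ m

end PetriNet

open Classical in
/-- The behavior of a system: places `(q, v)` for `q` a place of the process type of `v`;
transitions are the edges, which synchronize the two transitions of their label, and the pairs
`(t, v)` for `t` an internal transition of the process type of `v`. -/
noncomputable def behavior (P : List ProcType) (G : LGraph) : PetriNet where
  Place := {x : Place × G.V // IsPlace P x.1 ∧ Label.proc x.1.1 ∈ G.lab x.2}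
  Trans := G.edges ⊕ {x : PTrans × G.V // IsInternal P x.1 ∧ Label.proc x.1.1 ∈ G.lab x.2}
  finPlace := by
    have := G.finV
    exact (((finite_isPlace P).prod (Set.finite_univ (α := G.V))).subset
      fun x hx => ⟨hx.1, trivial⟩ :
      {x : Place × G.V | IsPlace P x.1 ∧ Label.proc x.1.1 ∈ G.lab x.2}.Finite)
  finTrans := by
    have := G.finV
    have := G.finE.to_subtype
    have : Finite {x : PTrans × G.V // IsInternal P x.1 ∧ Label.proc x.1.1 ∈ G.lab x.2} :=
      (((finite_isInternal P).prod (Set.finite_univ (α := G.V))).subset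
      fun x hx => ⟨hx.1, trivial⟩ :
      {x : PTrans × G.V | IsInternal P x.1 ∧ Label.proc x.1.1 ∈ G.lab x.2}.Finite)
    infer_instance
  inW
    | ⟨(q, u), _⟩, Sum.inl ⟨(v, (t, t'), w), _⟩ =>
      if (u = v ∧ obsPre P t = some q) ∨ (u = w ∧ obsPre P t' = some q) then 1 else 0
    | ⟨(q, u), _⟩, Sum.inr ⟨(t, v), _⟩ =>
      if u = v ∧ internalPre P t = some q then 1 else 0
  outW
    | Sum.inl ⟨(v, (t, t'), w), _⟩, ⟨(q, u), _⟩ =>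
      if (u = v ∧ obsPost P t = some q) ∨ (u = w ∧ obsPost P t' = some q) then 1 else 0
    | Sum.inr ⟨(t, v), _⟩, ⟨(q, u), _⟩ =>
      if u = v ∧ internalPost P t = some q then 1 else 0
  m₀
    | ⟨(q, _), _⟩ => if startPlace P q.1 = some q then 1 else 0

/-! ### Arithmetic formulas and the parametric reachability problem -/

inductive ArithFunc : ℕ → Type
  | const (n : ℕ) : ArithFunc 0
  | add : ArithFunc 2
  | mul : ArithFunc 2

inductive ArithRel : ℕ → Type
  | le : ArithRel 2

/-- The language of first-order arithmetic (equality is built in). -/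
def arith : FirstOrder.Language := ⟨ArithFunc, ArithRel⟩

instance : arith.Structure ℕ where
  funMap {_} f := match f with
    | ArithFunc.const n => fun _ => n
    | ArithFunc.add => fun x => x 0 + x 1
    | ArithFunc.mul => fun x => x 0 * x 1
  RelMap {_} r := match r with
    | ArithRel.le => fun x => x 0 ≤ x 1

/-- Arithmetic formulas, with free variables named by natural numbers. -/
abbrev ArithFormula := arith.Formula ℕ

/-- `(N, l) ⊨ α`: some reachable marking satisfies `α`, when each variable `x` is interpreted as
the number of tokens in the places labeled `x`. -/
def PetriNet.Sat (N : PetriNet) (l : N.Place → Option ℕ) (α : ArithFormula) : Prop :=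
  ∃ m, N.Reachable m ∧ α.Realize fun x => ∑ᶠ (q : N.Place) (_ : l q = some x), m q

/-- `Γ` describes a parametric VR system over `P`: every graph in its language is a system. -/
def IsVRSystem (P : List ProcType) (Γ : VRGrammar) : Prop :=
  VRGrammar.WF P Γ ∧ ∀ G ∈ algVR.language Γ, IsSystem P G

/-- `Γ` describes a parametric HR system over `P`: every graph in its language is a system. -/
def IsHRSystem (P : List ProcType) (Γ : HRGrammar) : Prop :=
  HRGrammar.WF P Γ ∧ ∀ G ∈ algHR.language Γ, IsSystem P G

/-- The parametric reachability problem for the grammar `Γ`, the formula `α`, the place labeling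
`L` (a partial function, of which only the values on the places of `P` matter) and the process
types `P`: some system in the language of `Γ` reaches a marking that satisfies `α`. -/
def PRP {A B : Type} (Ω : GraphAlgebra A B) (Γ : Grammar A B) (α : ArithFormula)
    (L : Place → Option ℕ) (P : List ProcType) : Prop :=
  ∃ G ∈ Ω.language Γ, (behavior P G).Sat (fun x => L x.1.1) α

/-! ### The process types and the place labeling of the translation -/

/-- The half process of `p`: the places of `p`, and a new place `numPlaces + j` for the `j`-th
observable transition `t`; each observable transition `t : q → q'` is split into the observable
transitions `try t`, from `q` to the new place, and `commit t`, from the new place to `q'`. -/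
def ProcType.half (p : ProcType) : ProcType where
  numPlaces := p.numPlaces + p.obs.length
  obs := p.obs.zipIdx.flatMap fun x =>
    [(x.1.1, p.numPlaces + x.2), (p.numPlaces + x.2, x.1.2)]
  internal := p.internal
  start := p.start

/-- The places of a routing process. -/
def idlePlace : ℕ := 0
def activePlace : ℕ := 1
def waitPlace : ℕ := 2
def replyPlace : ℕ := 3

/-- The routing process `ε_t`. Its observable transitions are, in this order, `recv`, `fwd`, `ack`,
`reset` and `t`. -/
def router : ProcType where
  numPlaces := 4
  obs := [(idlePlace, activePlace), (activePlace, waitPlace), (waitPlace, replyPlace),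
    (replyPlace, idlePlace), (activePlace, replyPlace)]
  internal := []
  start := idlePlace

/-- The list of the observable transitions of the process types `P`. -/
def obsList (P : List ProcType) : List PTrans :=
  P.zipIdx.flatMap fun x => (List.range x.1.obs.length).map fun j => (x.2, j)

/-- The process types of the translation: the half processes (the half process of `P[i]` has index
`i`), followed by one routing process `ε_t` for each observable transition `t` (the one of the
`k`-th observable transition has index `P.length + k`). -/
def expandTypes (P : List ProcType) : List ProcType :=
  P.map ProcType.half ++ (obsList P).map fun _ => router

/-- The place labeling of the translation: it agrees with `L` on the places of `P`, maps the place
`active` of `ε_t` to the `L`-label of the predecessor of `t` and the place `reply` of `ε_t` to the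
`L`-label of the successor of `t`, and is undefined elsewhere. -/
def expandLabeling (P : List ProcType) (L : Place → Option ℕ) (q : Place) : Option ℕ :=
  if q.1 < P.length then
    P[q.1]?.bind fun p => if q.2 < p.numPlaces then L q else none
  else
    (obsList P)[q.1 - P.length]?.bind fun t =>
      if q.2 = activePlace then (obsPre P t).bind L
      else if q.2 = replyPlace then (obsPost P t).bind L
      else none

/-! ### The translation of terms and grammars -/

/-! A VR-operation may draw edges between all vertices of two port classes, whereas an HR-term can
only reach vertices that are named individually by ports. The translation therefore lets a router
stand for a class: for a port `π` and an observable transition `t` of its type, one router with the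
port `routerPort P 0 π t` collects the requests for `t` of all vertices with port `π`. Disjoint
union becomes composition, which merges the collecting routers of the two sides. A unary operation
adds a floor: the collecting routers are moved to layer `1`, each is linked to a fresh collecting
router for the new port of its class (several classes may get the same one, an erased class gets
none), an edge creation adds a single edge between two layer-`1` routers, and the ports of layer `1`
are then forgotten. Edge creation needs the new floor as well: a router with synchronization edges
must never be merged again, since vertices that join the class later would inherit its edges.

The invariant is `PortNetwork`. Every router has at most one successor, and a router with a port has
neither a successor nor a synchronization edge. A path of routers for `t` leads from each half
process towards the collecting router of its class. Two paths, from `x` for `t` and from `y` for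
`t'`, reach the two ends of a synchronization edge for `(t, t')` only if `G` has the edge from `x`
to `y` with this label, and every well-typed edge of `G` is realized by two disjoint paths.
`nonempty_portNetwork_vertex`, `nonempty_portNetwork_union` and `nonempty_portNetwork_layer`
preserve the invariant, on the basis of the description of glued graphs in `exists_isGlue`;
`nonempty_portNetwork_val` is the resulting induction on terms.

A network simulates `G` as follows. To execute `t`, a half process moves to `h_t` and activates its
first router; the request climbs, leaving waiting routers behind; two active routers synchronize;
the reply descends and frees the routers, and the half process commits. `Represents` records the
path that each vertex occupies. At any moment a single vertex of `H` shows the place of `x`: its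
half process when no request is under way, otherwise the head of its path, where active counts as
the predecessor of `t` and reply as its successor. Hence the label counts of `G` and `H` agree in
every represented state (`Represents.ncard_eq`). A step of `H` either only moves a request or is a
step of `G` (`Represents.step_sound`); a step of `G` is a complete round of the protocol
(`Represents.step_complete`). A shared router may block requests, which is harmless for
reachability. Both directions meet in `Network.sat_iff_sat`.

On grammars, the derivations of the translation are the translated derivations, followed by the
erasure of all ports (`mem_language_translateGrammar`). In prefix notation the translation replaces
letters by words (`code_translate`), so that it is primitive recursive. -/

/-- The index of the routing process `ε_t`. -/
def routerIndex (P : List ProcType) (t : PTrans) : ℕ := P.length + (obsList P).idxOf t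

/-- `ProcType.half` lists the two halves of the `j`-th observable transition side by side, hence at
the positions `2j` and `2j + 1`. -/
def tryT (t : PTrans) : PTrans := (t.1, 2 * t.2)
def commitT (t : PTrans) : PTrans := (t.1, 2 * t.2 + 1)
-- The second components, here and in the next four definitions, are positions in `router.obs`.
def recvT (P : List ProcType) (t : PTrans) : PTrans := (routerIndex P t, 0)
def fwdT (P : List ProcType) (t : PTrans) : PTrans := (routerIndex P t, 1)
def ackT (P : List ProcType) (t : PTrans) : PTrans := (routerIndex P t, 2)
def resetT (P : List ProcType) (t : PTrans) : PTrans := (routerIndex P t, 3)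
def syncT (P : List ProcType) (t : PTrans) : PTrans := (routerIndex P t, 4)

/-- The port of the router for the transition `t` of the vertices with port `π`; the upper layer
of routers has `b = 0`, the lower one `b = 1`. -/
def routerPort (P : List ProcType) (b : ℕ) (π : Port) (t : PTrans) : Port :=
  (routerIndex P t, 2 * π.2 + b)

/-- The name `0` is arbitrary: the port serves only to attach the routers to a new half process and
is erased right afterwards. -/
def halfPort (π : Port) : Port := (π.1, 0)

/-- The observable transitions of the `i`-th process type. -/
def obsOf (P : List ProcType) (i : ℕ) : List PTrans := (obsList P).filter fun t => t.1 = i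

/-- The renaming of router ports from layer `0` to layer `b`. -/
def layerRenaming (P : List ProcType) (Q : List Port) (b : ℕ) : List (Port × Port) :=
  Q.flatMap fun π => (obsOf P π.1).map fun t => (routerPort P 0 π t, routerPort P b π t)

/-- An edge label with the ports of the two ends. -/
abbrev PortEdge := EdgeLabel × Port × Port

/-- The edges between a half process with port `π` and its routers. -/
def attachEdges (P : List ProcType) (π : Port) : List PortEdge :=
  (obsOf P π.1).flatMap fun t =>
    [((tryT t, recvT P t), halfPort π, routerPort P 0 π t),
     ((commitT t, resetT P t), halfPort π, routerPort P 0 π t)]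

/-- The edges from the lower to the upper layer of routers, following the port redefinition `α`. -/
def forwardEdges (P : List ProcType) (α : List (Port × Port)) : List PortEdge :=
  α.flatMap fun r => (obsOf P r.1.1).flatMap fun t =>
    [((fwdT P t, recvT P t), routerPort P 1 r.1 t, routerPort P 0 r.2 t),
     ((ackT P t, resetT P t), routerPort P 1 r.1 t, routerPort P 0 r.2 t)]

/-- The edge between the lower routers that simulates the `δ`-edges from `π₁` to `π₂`. -/
def syncEdges (P : List ProcType) (δ : EdgeLabel) (π₁ π₂ : Port) : List PortEdge :=
  -- A rule may contain a label that does not fit its ports, provided that it never creates an edge.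
  -- As `routerPort` does not record the type of `π`, an edge for such a label would be attached to
  -- the router of another class.
  if δ.1.1 = π₁.1 ∧ δ.2.1 = π₂.1 then
    [((syncT P δ.1, syncT P δ.2), routerPort P 1 π₁ δ.1, routerPort P 1 π₂ δ.2)]
  else []

/-- The edges added for a unary VR operation. -/
def layerEdges (P : List ProcType) (Q : List Port) : VRUnary → List PortEdge
  -- Edge creation keeps all ports, so forwarding follows the identity on `Q`; the synchronization
  -- edge stays below the new floor.
  | VRUnary.addEdge δ π₁ π₂ => syncEdges P δ π₁ π₂ ++ forwardEdges P (Q.map fun π => (π, π))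
  | VRUnary.rename α => forwardEdges P α

abbrev HRTerm := Term HRConst (List (Port × Port))
abbrev VRTerm := Term Port VRUnary

/-- Composition with single-edge graphs. -/
def glue (es : List PortEdge) (t : HRTerm) : HRTerm :=
  es.foldr (fun e t => Term.bin (Term.const (HRConst.edge e.1 e.2.1 e.2.2)) t) t

/-- The translation of VR terms whose ports are in `Q`. -/
def translateTerm (P : List ProcType) (Q : List Port) : VRTerm → HRTerm
  | Term.var X => Term.var (X + 1)
  -- `layerRenaming P Q 0` is the identity on the router ports of layer `0` over `Q` and undefined
  -- elsewhere: it erases the half port here and layer `1` in the next case.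
  | Term.const π => Term.un (layerRenaming P Q 0)
      (glue (attachEdges P π) (Term.const (HRConst.vertex (halfPort π))))
  | Term.un b t => Term.un (layerRenaming P Q 0)
      (glue (layerEdges P Q b) (Term.un (layerRenaming P Q 1) (translateTerm P Q t)))
  | Term.bin t₁ t₂ => Term.bin (translateTerm P Q t₁) (translateTerm P Q t₂)

/-- The letters of the prefix notation of VR and HR terms. -/
abbrev VRLetter := ℕ ⊕ Port ⊕ VRUnary ⊕ Unit
abbrev HRLetter := ℕ ⊕ HRConst ⊕ List (Port × Port) ⊕ Unit

/-- The ports which the operation named by a letter can produce. -/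
def letterPorts : VRLetter → List Port
  | Sum.inr (Sum.inl π) => [π]
  | Sum.inr (Sum.inr (Sum.inl (VRUnary.rename α))) => α.map Prod.snd
  | _ => []

/-- The ports produced by the operations in the rules of a grammar. -/
def rulePorts (rs : List (ℕ × List VRLetter)) : List Port :=
  rs.flatMap fun r => r.2.flatMap letterPorts

/-- The translation of grammars; the nonterminal `0` is new. -/
def translateGrammar (P : List ProcType) (Γ : VRGrammar) : HRGrammar where
  axs := [0]
  -- The empty redefinition erases the ports of the collecting routers, as systems have no ports.
  rules := (Γ.axs.map fun X => (0, Term.un [] (Term.var (X + 1)))) ++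
    Γ.rules.map fun r => (r.1 + 1, translateTerm P (rulePorts Γ.code.2) r.2)

def glueCode (es : List PortEdge) : List HRLetter :=
  es.flatMap fun e => [Sum.inr (Sum.inr (Sum.inr ())),
    Sum.inr (Sum.inl (HRConst.edge e.1 e.2.1 e.2.2))]

def translateLetter (P : List ProcType) (Q : List Port) : VRLetter → List HRLetter
  | Sum.inl X => [Sum.inl (X + 1)]
  | Sum.inr (Sum.inl π) => Sum.inr (Sum.inr (Sum.inl (layerRenaming P Q 0))) ::
      (glueCode (attachEdges P π) ++ [Sum.inr (Sum.inl (HRConst.vertex (halfPort π)))])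
  | Sum.inr (Sum.inr (Sum.inl b)) => Sum.inr (Sum.inr (Sum.inl (layerRenaming P Q 0))) ::
      (glueCode (layerEdges P Q b) ++ [Sum.inr (Sum.inr (Sum.inl (layerRenaming P Q 1)))])
  | Sum.inr (Sum.inr (Sum.inr u)) => [Sum.inr (Sum.inr (Sum.inr u))]

theorem code_glue (es : List PortEdge) (t : HRTerm) : (glue es t).code = glueCode es ++ t.code := by
  induction es with
  | nil => simp [glue, glueCode]
  | cons e es ih =>
    have h : glue (e :: es) t = Term.bin (Term.const (HRConst.edge e.1 e.2.1 e.2.2)) (glue es t) :=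
      rfl
    rw [h, Term.code, ih, Term.code]
    simp [glueCode]

/-- Everything that is put around the translation of a subterm stands in front of its code. Thus the
translation is a substitution of words for letters, and its computability requires no recursion on
terms. -/
theorem code_translate (P : List ProcType) (Q : List Port) (t : VRTerm) :
    (translateTerm P Q t).code = t.code.flatMap (translateLetter P Q) := by
  induction t with
  | var X => simp [translateTerm, Term.code, translateLetter]
  | const π => simp [translateTerm, Term.code, translateLetter, code_glue]
  | un b t ih => simp [translateTerm, Term.code, translateLetter, code_glue, ih]
  | bin t₁ t₂ ih₁ ih₂ => simp [translateTerm, Term.code, translateLetter, ih₁, ih₂]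

/-- The translation of grammars on codes. -/
def translateCode (x : List ProcType × List ℕ × List (ℕ × List VRLetter)) :
    List ℕ × List (ℕ × List HRLetter) :=
  ([0], (x.2.1.map fun X => (0, [Sum.inr (Sum.inr (Sum.inl [])), Sum.inl (X + 1)])) ++
    x.2.2.map fun r => (r.1 + 1, r.2.flatMap (translateLetter x.1 (rulePorts x.2.2))))

theorem translateCode_code (P : List ProcType) (Γ : VRGrammar) :
    translateCode (P, Γ.code) = (translateGrammar P Γ).code := by
  simp [translateCode, translateGrammar, Grammar.code, code_translate, Term.code,
    Function.comp_def]

/-! ### Computability -/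

section Computability

open Primrec

theorem primrec_procType_tuple : Primrec ProcType.equivTuple := Primrec.of_equiv

theorem primrec_numPlaces : Primrec ProcType.numPlaces := fst.comp primrec_procType_tuple

theorem primrec_obs : Primrec ProcType.obs := fst.comp (snd.comp primrec_procType_tuple)

theorem primrec_internal : Primrec ProcType.internal :=
  fst.comp (snd.comp (snd.comp primrec_procType_tuple))

theorem primrec_start : Primrec ProcType.start :=
  snd.comp (snd.comp (snd.comp primrec_procType_tuple))

theorem primrec_procType_mk {α : Type} [Primcodable α] {n s : α → ℕ} {o i : α → List (ℕ × ℕ)}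
    (hn : Primrec n) (ho : Primrec o) (hi : Primrec i) (hs : Primrec s) :
    Primrec fun a => (⟨n a, o a, i a, s a⟩ : ProcType) :=
  (Primrec.of_equiv_symm (e := ProcType.equivTuple)).comp
    (hn.pair (ho.pair (hi.pair hs)))

/-- This form of `zipIdx` is composed of operations that are known to be primitive recursive. -/
theorem List.zipIdx_eq_filterMap {α : Type*} (l : List α) :
    l.zipIdx = (List.range l.length).filterMap fun i => l[i]?.map fun a => (a, i) := by
  induction l using List.reverseRecOn with
  | nil => rfl
  | append_singleton l a ih =>
    rw [List.zipIdx_append, ih, List.length_append, List.length_singleton, List.range_succ,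
      List.filterMap_append]
    congr 1
    · refine List.filterMap_congr fun i hi => ?_
      rw [List.getElem?_append_left (List.mem_range.1 hi)]
    · simp

/-- Lawful `BEq` instances coincide, so the instance can be left arbitrary. -/
theorem primrec_list_lookup {α β : Type} [Primcodable α] [Primcodable β] [DecidableEq α]
    [i : BEq α] [h : LawfulBEq α] : Primrec₂ (List.lookup : α → List (α × β) → Option β) := by
  obtain rfl : i = instBEqOfDecidableEq := lawful_beq_subsingleton _ _
  exact listLookup

theorem primrec_list_idxOf {α : Type} [Primcodable α] [DecidableEq α] [i : BEq α]
    [h : LawfulBEq α] : Primrec₂ (List.idxOf : α → List α → ℕ) := by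
  obtain rfl : i = instBEqOfDecidableEq := lawful_beq_subsingleton _ _
  exact list_idxOf

theorem primrec_zipIdx {α : Type} [Primcodable α] : Primrec fun l : List α => l.zipIdx := by
  refine Primrec.of_eq ?_ fun l => (List.zipIdx_eq_filterMap l).symm
  refine listFilterMap (list_range.comp list_length) ?_
  refine option_map (list_getElem?.comp fst snd) ?_
  exact Primrec₂.pair.comp snd (snd.comp fst)

theorem primrec_pair_list {α β : Type} [Primcodable α] [Primcodable β] {f g : α → β}
    (hf : Primrec f) (hg : Primrec g) : Primrec fun a => [f a, g a] :=
  list_cons.comp hf (list_cons.comp hg (Primrec.const []))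

theorem primrec_singleton {α β : Type} [Primcodable α] [Primcodable β] {f : α → β}
    (hf : Primrec f) : Primrec fun a => [f a] :=
  list_cons.comp hf (Primrec.const [])

theorem primrec_half : Primrec ProcType.half := by
  refine primrec_procType_mk ?_ ?_ primrec_internal primrec_start
  · exact nat_add.comp primrec_numPlaces (list_length.comp primrec_obs)
  · refine list_flatMap (primrec_zipIdx.comp primrec_obs) ?_
    have h : Primrec fun x : ProcType × (ℕ × ℕ) × ℕ => x.1.numPlaces + x.2.2 :=
      nat_add.comp (primrec_numPlaces.comp fst) (snd.comp snd)
    exact primrec_pair_list ((fst.comp (fst.comp snd)).pair h) (h.pair (snd.comp (fst.comp snd)))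

theorem primrec_obsList : Primrec obsList := by
  refine list_flatMap primrec_zipIdx ?_
  refine list_map (list_range.comp (list_length.comp (primrec_obs.comp (fst.comp snd)))) ?_
  exact (snd.comp (snd.comp fst)).pair snd

theorem primrec_expandTypes : Primrec expandTypes :=
  list_append.comp (list_map .id (primrec_half.comp snd))
    (list_map primrec_obsList (Primrec.const router))

theorem primrec_routerIndex : Primrec₂ routerIndex :=
  nat_add.comp (list_length.comp fst) (primrec_list_idxOf.comp snd (primrec_obsList.comp fst))

theorem primrec_obsOf : Primrec₂ obsOf := by
  refine Primrec.of_eq (f := fun x : List ProcType × ℕ =>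
    (obsList x.1).filterMap fun t => if t.1 = x.2 then some t else none) ?_ ?_
  · refine listFilterMap (primrec_obsList.comp fst) ?_
    exact Primrec.ite (Primrec.eq.comp (fst.comp snd) (snd.comp fst))
      (option_some.comp snd) (Primrec.const none)
  · rintro ⟨P, i⟩
    simp only [obsOf]
    rw [← List.filterMap_eq_filter]
    congr 1
    funext t
    simp [Option.guard]

theorem primrec_routerPort {α : Type} [Primcodable α] {P : α → List ProcType} {π : α → Port}
    {t : α → PTrans} {b : α → ℕ} (hP : Primrec P) (hb : Primrec b) (hπ : Primrec π) (ht : Primrec t) :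
    Primrec fun a => routerPort (P a) (b a) (π a) (t a) :=
  (primrec_routerIndex.comp hP ht).pair
    (nat_add.comp (nat_mul.comp (Primrec.const 2) (snd.comp hπ)) hb)

theorem primrec_layerRenaming (b : ℕ) :
    Primrec₂ fun (P : List ProcType) (Q : List Port) => layerRenaming P Q b := by
  refine list_flatMap snd ?_
  refine list_map (primrec_obsOf.comp (fst.comp fst) (fst.comp snd)) ?_
  have h (b : ℕ) := primrec_routerPort (fst.comp (fst.comp fst)) (Primrec.const b) (snd.comp fst)
    (snd (α := ((List ProcType × List Port) × Port)) (β := PTrans))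
  exact (h 0).pair (h b)

theorem primrec_attachEdges : Primrec₂ attachEdges := by
  refine list_flatMap (primrec_obsOf.comp fst (fst.comp snd)) ?_
  have ht := snd (α := List ProcType × Port) (β := PTrans)
  have hP := (fst (α := List ProcType) (β := Port)).comp (fst (β := PTrans))
  have hπ := (snd (α := List ProcType) (β := Port)).comp (fst (β := PTrans))
  have hr := primrec_routerIndex.comp hP ht
  have h2 := nat_mul.comp (Primrec.const 2) (snd.comp ht)
  have he := ((fst.comp hπ).pair (Primrec.const 0)).pair
    (primrec_routerPort hP (Primrec.const 0) hπ ht)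
  exact primrec_pair_list
    ((((fst.comp ht).pair h2).pair (hr.pair (Primrec.const 0))).pair he)
    ((((fst.comp ht).pair (succ.comp h2)).pair (hr.pair (Primrec.const 3))).pair he)

theorem primrec_forwardEdges : Primrec₂ forwardEdges := by
  refine list_flatMap snd ?_
  refine list_flatMap (primrec_obsOf.comp (fst.comp fst) (fst.comp (fst.comp snd))) ?_
  have ht := snd (α := (List ProcType × List (Port × Port)) × (Port × Port)) (β := PTrans)
  have hP := (fst (α := List ProcType) (β := List (Port × Port))).comp
    ((fst (β := Port × Port)).comp (fst (β := PTrans)))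
  have hr := (snd (α := List ProcType × List (Port × Port)) (β := Port × Port)).comp
    (fst (β := PTrans))
  have hi := primrec_routerIndex.comp hP ht
  have he := (primrec_routerPort hP (Primrec.const 1) (fst.comp hr) ht).pair
    (primrec_routerPort hP (Primrec.const 0) (snd.comp hr) ht)
  exact primrec_pair_list
    (((hi.pair (Primrec.const 1)).pair (hi.pair (Primrec.const 0))).pair he)
    (((hi.pair (Primrec.const 2)).pair (hi.pair (Primrec.const 3))).pair he)

theorem primrec_syncEdges : Primrec fun x : List ProcType × EdgeLabel × Port × Port =>
    syncEdges x.1 x.2.1 x.2.2.1 x.2.2.2 := by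
  have hP := fst (α := List ProcType) (β := EdgeLabel × Port × Port)
  have hx := snd (α := List ProcType) (β := EdgeLabel × Port × Port)
  have ht := fst.comp (fst.comp hx)
  have ht' := snd.comp (fst.comp hx)
  have hπ := fst.comp (snd.comp hx)
  have hπ' := snd.comp (snd.comp hx)
  refine Primrec.ite ((Primrec.eq.comp (fst.comp ht) (fst.comp hπ)).and
    (Primrec.eq.comp (fst.comp ht') (fst.comp hπ'))) ?_ (Primrec.const [])
  refine primrec_singleton (Primrec.pair ?_ (Primrec.pair ?_ ?_))
  · exact ((primrec_routerIndex.comp hP ht).pair (Primrec.const 4)).pair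
      ((primrec_routerIndex.comp hP ht').pair (Primrec.const 4))
  · exact primrec_routerPort hP (Primrec.const 1) hπ ht
  · exact primrec_routerPort hP (Primrec.const 1) hπ' ht'

theorem primrec_layerEdges : Primrec fun x : (List ProcType × List Port) × VRUnary =>
    layerEdges x.1.1 x.1.2 x.2 := by
  have he : Primrec VRUnary.equivSum := Primrec.of_equiv
  refine Primrec.of_eq (f := fun x : (List ProcType × List Port) × VRUnary =>
    Sum.casesOn (motive := fun _ => List PortEdge) (VRUnary.equivSum x.2)
      (fun y => syncEdges x.1.1 y.1 y.2.1 y.2.2 ++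
        forwardEdges x.1.1 (x.1.2.map fun π => (π, π)))
      (fun α => forwardEdges x.1.1 α)) ?_ ?_
  · refine sumCasesOn (he.comp snd) ?_ ?_
    · refine list_append.comp (primrec_syncEdges.comp ((fst.comp (fst.comp fst)).pair snd)) ?_
      refine primrec_forwardEdges.comp (fst.comp (fst.comp fst)) ?_
      exact list_map (snd.comp (fst.comp fst)) (snd.pair snd)
    · exact primrec_forwardEdges.comp (fst.comp (fst.comp fst)) snd
  · rintro ⟨x, b⟩
    cases b <;> rfl

theorem primrec_glueCode : Primrec glueCode := by
  refine list_flatMap .id ?_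
  refine primrec_pair_list (Primrec.const _) ?_
  have h : Primrec HRConst.equivSum.symm := Primrec.of_equiv_symm
  exact sumInr.comp (sumInl.comp (h.comp (sumInr.comp snd)))

theorem primrec_letterPorts : Primrec letterPorts := by
  have he : Primrec VRUnary.equivSum := Primrec.of_equiv
  refine Primrec.of_eq (f := fun x : VRLetter =>
    Sum.casesOn (motive := fun _ => List Port) x (fun _ => []) (fun y =>
      Sum.casesOn (motive := fun _ => List Port) y (fun π => [π]) (fun z =>
        Sum.casesOn (motive := fun _ => List Port) z (fun b =>
          Sum.casesOn (motive := fun _ => List Port) (VRUnary.equivSum b) (fun _ => [])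
            (fun α => α.map Prod.snd)) (fun _ => [])))) ?_ ?_
  · refine sumCasesOn .id (Primrec.const []) ?_
    refine sumCasesOn snd (primrec_singleton snd) ?_
    refine sumCasesOn snd ?_ (Primrec.const [])
    refine sumCasesOn (he.comp snd) (Primrec.const []) ?_
    exact list_map snd (snd.comp snd)
  · rintro (X | π | (_ | _) | u) <;> rfl

theorem primrec_rulePorts : Primrec rulePorts :=
  list_flatMap .id (list_flatMap (snd.comp snd) (primrec_letterPorts.comp snd))

theorem primrec_renamingLetter (b : ℕ) : Primrec fun x : List ProcType × List Port =>
    (Sum.inr (Sum.inr (Sum.inl (layerRenaming x.1 x.2 b))) : HRLetter) :=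
  sumInr.comp (sumInr.comp (sumInl.comp (primrec_layerRenaming b)))

theorem primrec_vertexLetter : Primrec fun π : Port =>
    (Sum.inr (Sum.inl (HRConst.vertex (halfPort π))) : HRLetter) := by
  have h : Primrec HRConst.equivSum.symm := Primrec.of_equiv_symm
  have hp : Primrec halfPort := fst.pair (Primrec.const 0)
  exact sumInr.comp (sumInl.comp (h.comp (sumInl.comp hp)))

theorem primrec_translateLetter_port : Primrec fun x : (List ProcType × List Port) × Port =>
    translateLetter x.1.1 x.1.2 (Sum.inr (Sum.inl x.2)) := by
  refine list_cons.comp ((primrec_renamingLetter 0).comp fst) ?_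
  exact list_append.comp (primrec_glueCode.comp (primrec_attachEdges.comp (fst.comp fst) snd))
    (primrec_singleton (primrec_vertexLetter.comp snd))

theorem primrec_translateLetter_unary :
    Primrec fun x : (List ProcType × List Port) × VRUnary =>
      translateLetter x.1.1 x.1.2 (Sum.inr (Sum.inr (Sum.inl x.2))) := by
  refine list_cons.comp ((primrec_renamingLetter 0).comp fst) ?_
  exact list_append.comp (primrec_glueCode.comp primrec_layerEdges)
    (primrec_singleton ((primrec_renamingLetter 1).comp fst))

/-- Case distinction in the presence of a parameter; it separates the kinds of letters. -/
theorem primrec_of_sum {α β γ σ : Type} [Primcodable α] [Primcodable β] [Primcodable γ]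
    [Primcodable σ] {f : α × (β ⊕ γ) → σ} (hl : Primrec fun x : α × β => f (x.1, Sum.inl x.2))
    (hr : Primrec fun x : α × γ => f (x.1, Sum.inr x.2)) : Primrec f := by
  refine Primrec.of_eq (f := fun x : α × (β ⊕ γ) => Sum.casesOn (motive := fun _ => σ) x.2
    (fun b => f (x.1, Sum.inl b)) (fun c => f (x.1, Sum.inr c))) ?_ ?_
  · exact sumCasesOn snd (hl.comp ((fst.comp fst).pair snd)) (hr.comp ((fst.comp fst).pair snd))
  · rintro ⟨a, b | c⟩ <;> rfl

theorem primrec_translateLetter : Primrec fun x : (List ProcType × List Port) × VRLetter =>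
    translateLetter x.1.1 x.1.2 x.2 :=
  primrec_of_sum (primrec_singleton (sumInl.comp (succ.comp snd)))
    (primrec_of_sum primrec_translateLetter_port
      (primrec_of_sum primrec_translateLetter_unary
        (primrec_singleton (sumInr.comp (sumInr.comp (sumInr.comp snd))))))

theorem primrec_translateCode : Primrec translateCode := by
  refine (Primrec.const [0]).pair (list_append.comp (list_map (fst.comp snd) ?_)
    (list_map (snd.comp snd) ?_))
  · exact (Primrec.const 0).pair
      (primrec_pair_list (Primrec.const _) (sumInl.comp (succ.comp snd)))
  · refine (succ.comp (fst.comp snd)).pair ?_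
    refine list_flatMap (snd.comp snd) ?_
    refine primrec_translateLetter.comp (Primrec.pair (Primrec.pair ?_ ?_) snd)
    · exact fst.comp (fst.comp fst)
    · exact primrec_rulePorts.comp (snd.comp (snd.comp (fst.comp fst)))

theorem primrec_obsPre : Primrec₂ obsPre := by
  refine option_bind (list_getElem?.comp fst (fst.comp snd)) ?_
  refine option_map (list_getElem?.comp (primrec_obs.comp snd) (snd.comp (snd.comp fst))) ?_
  exact (fst.comp (snd.comp (fst.comp fst))).pair (fst.comp snd)

theorem primrec_obsPost : Primrec₂ obsPost := by
  refine option_bind (list_getElem?.comp fst (fst.comp snd)) ?_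
  refine option_map (list_getElem?.comp (primrec_obs.comp snd) (snd.comp (snd.comp fst))) ?_
  exact (fst.comp (snd.comp (fst.comp fst))).pair (snd.comp snd)

/-- A finite partial labeling is given by an association list, which makes it an input of a
computation. -/
theorem primrec_expandLabeling : Primrec fun x : List ProcType × List (Place × ℕ) × Place =>
    expandLabeling x.1 (fun q => x.2.1.lookup q) x.2.2 := by
  have hP := fst (α := List ProcType) (β := List (Place × ℕ) × Place)
  have hl := (fst (α := List (Place × ℕ)) (β := Place)).comp (snd (α := List ProcType))
  have hq := (snd (α := List (Place × ℕ)) (β := Place)).comp (snd (α := List ProcType))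
  refine Primrec.ite (nat_lt.comp (fst.comp hq) (list_length.comp hP)) ?_ ?_
  · refine option_bind (list_getElem?.comp hP (fst.comp hq)) ?_
    exact Primrec.ite (nat_lt.comp (snd.comp (hq.comp fst)) (primrec_numPlaces.comp snd))
      (primrec_list_lookup.comp (hq.comp fst) (hl.comp fst)) (Primrec.const none)
  · refine option_bind (list_getElem?.comp (primrec_obsList.comp hP)
      (nat_sub.comp (fst.comp hq) (list_length.comp hP))) ?_
    refine Primrec.ite (Primrec.eq.comp (snd.comp (hq.comp fst)) (Primrec.const activePlace)) ?_
      (Primrec.ite (Primrec.eq.comp (snd.comp (hq.comp fst)) (Primrec.const replyPlace)) ?_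
        (Primrec.const none))
    · exact option_bind (primrec_obsPre.comp (hP.comp fst) snd)
        (primrec_list_lookup.comp snd (hl.comp (fst.comp fst)))
    · exact option_bind (primrec_obsPost.comp (hP.comp fst) snd)
        (primrec_list_lookup.comp snd (hl.comp (fst.comp fst)))

end Computability

/-! ### The language of the translated grammar -/

/-- Each occurrence of a nonterminal is kept exactly once, and the glued edges are constants. So the
positions at which a rule applies are the same in a term and in its translation. -/
theorem step_translateTerm {P : List ProcType} {Γ : VRGrammar} {Q : List Port}
    {Γ' : HRGrammar}
    (hΓ : ∀ X s, (X + 1, s) ∈ Γ'.rules ↔ ∃ t, (X, t) ∈ Γ.rules ∧ s = translateTerm P Q t) :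
    ∀ (t : VRTerm) (u : HRTerm), Γ'.Step (translateTerm P Q t) u ↔
      ∃ t', Γ.Step t t' ∧ u = translateTerm P Q t' := by
  have hglue (es : List PortEdge) : ∀ (s u : HRTerm), Γ'.Step (glue es s) u ↔
      ∃ s', Γ'.Step s s' ∧ u = glue es s' := by
    induction es with
    | nil => simp [glue]
    | cons e es ih =>
      intro s u
      change Γ'.Step (Term.bin _ (glue es s)) u ↔ ∃ s', Γ'.Step s s' ∧ u = Term.bin _ (glue es s')
      constructor
      · intro h
        cases h with
        | left h => cases h
        | right h =>
          obtain ⟨s', hh, rfl⟩ := (ih _ _).1 h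
          exact ⟨s', hh, rfl⟩
      · rintro ⟨s', h, rfl⟩
        exact .right ((ih _ _).2 ⟨s', h, rfl⟩)
  intro t
  induction t with
  | var X =>
    intro u
    constructor
    · intro h
      cases h with
      | root h =>
        obtain ⟨t, hh, rfl⟩ := (hΓ _ _).1 h
        exact ⟨t, .root hh, rfl⟩
    · rintro ⟨t, h, rfl⟩
      cases h with
      | root h => exact .root ((hΓ _ _).2 ⟨_, h, rfl⟩)
  | const π =>
    intro u
    constructor
    · intro h
      cases h with
      | un h =>
        obtain ⟨s', h, -⟩ := (hglue _ _ _).1 h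
        cases h
    · rintro ⟨t, h, rfl⟩
      cases h
  | un b t ih =>
    intro u
    constructor
    · intro h
      cases h with
      | un h =>
        obtain ⟨s', hh, rfl⟩ := (hglue _ _ _).1 h
        clear h
        cases hh with
        | un h =>
          obtain ⟨t', hh, rfl⟩ := (ih _).1 h
          exact ⟨_, .un hh, rfl⟩
    · rintro ⟨t', h, rfl⟩
      cases h with
      | un h => exact Grammar.Step.un ((hglue _ _ _).2 ⟨_, .un ((ih _).2 ⟨_, h, rfl⟩), rfl⟩)
  | bin t₁ t₂ ih₁ ih₂ =>
    intro u
    constructor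
    · intro h
      cases h with
      | left h =>
        obtain ⟨t', hh, rfl⟩ := (ih₁ _).1 h
        exact ⟨_, .left hh, rfl⟩
      | right h =>
        obtain ⟨t', hh, rfl⟩ := (ih₂ _).1 h
        exact ⟨_, .right hh, rfl⟩
    · rintro ⟨t', h, rfl⟩
      cases h with
      | left h => exact .left ((ih₁ _).2 ⟨_, h, rfl⟩)
      | right h => exact .right ((ih₂ _).2 ⟨_, h, rfl⟩)

theorem derives_translateTerm {P : List ProcType} {Γ : VRGrammar} {Q : List Port}
    {Γ' : HRGrammar}
    (hΓ : ∀ X s, (X + 1, s) ∈ Γ'.rules ↔ ∃ t, (X, t) ∈ Γ.rules ∧ s = translateTerm P Q t)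
    (t : VRTerm) (u : HRTerm) : Relation.ReflTransGen Γ'.Step (translateTerm P Q t) u ↔
      ∃ t', Relation.ReflTransGen Γ.Step t t' ∧ u = translateTerm P Q t' := by
  constructor
  · intro h
    induction h with
    | refl => exact ⟨t, .refl, rfl⟩
    | tail _ h ih =>
      obtain ⟨t', h', rfl⟩ := ih
      obtain ⟨t'', h'', rfl⟩ := (step_translateTerm hΓ _ _).1 h
      exact ⟨t'', h'.tail h'', rfl⟩
  · rintro ⟨t', h, rfl⟩
    induction h with
    | refl => exact .refl
    | tail _ h ih => exact ih.tail ((step_translateTerm hΓ _ _).2 ⟨_, h, rfl⟩)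

theorem ground_glue (es : List PortEdge) (s : HRTerm) : (glue es s).Ground ↔ s.Ground := by
  induction es with
  | nil => rfl
  | cons e es ih => exact (and_iff_right trivial).trans ih

theorem ground_translateTerm (P : List ProcType) (Q : List Port) (t : VRTerm) :
    (translateTerm P Q t).Ground ↔ t.Ground := by
  induction t with
  | var X => rfl
  | const π => exact ground_glue _ _
  | un b t ih => exact (ground_glue _ _).trans ih
  | bin t₁ t₂ ih₁ ih₂ => exact and_congr ih₁ ih₂

/-- The first step from the new nonterminal `0` introduces the port-erasing symbol `Term.un []`; all
later steps take place below it and are translated steps of `Γ`. -/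
theorem mem_language_translateGrammar (P : List ProcType) (Γ : VRGrammar) (H : LGraph) :
    H ∈ algHR.language (translateGrammar P Γ) ↔ ∃ X ∈ Γ.axs, ∃ θ : VRTerm,
      Relation.ReflTransGen Γ.Step (Term.var X) θ ∧ θ.Ground ∧
      H = LGraph.rename [] (algHR.val (translateTerm P (rulePorts Γ.code.2) θ)) := by
  set Q := rulePorts Γ.code.2 with hQ
  have hΓ : ∀ X s, (X + 1, s) ∈ (translateGrammar P Γ).rules ↔
      ∃ t, (X, t) ∈ Γ.rules ∧ s = translateTerm P Q t := by
    intro X s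
    simp only [translateGrammar, List.mem_append, List.mem_map, Prod.mk.injEq]
    constructor
    · rintro (⟨_, _, h, _⟩ | ⟨r, hr, h, rfl⟩)
      · omega
      · obtain rfl : r.1 = X := by omega
        exact ⟨r.2, hr, rfl⟩
    · rintro ⟨t, ht, rfl⟩
      exact Or.inr ⟨_, ht, rfl, rfl⟩
  have h0 : ∀ s, (0, s) ∈ (translateGrammar P Γ).rules ↔
      ∃ X ∈ Γ.axs, s = Term.un [] (Term.var (X + 1)) := by
    intro s
    simp only [translateGrammar, List.mem_append, List.mem_map, Prod.mk.injEq]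
    constructor
    · rintro (⟨X, hX, _, rfl⟩ | ⟨r, hr, h, rfl⟩)
      · exact ⟨X, hX, rfl⟩
      · omega
    · rintro ⟨X, hX, rfl⟩
      exact Or.inl ⟨X, hX, trivial, rfl⟩
  have hun : ∀ s u, Relation.ReflTransGen (translateGrammar P Γ).Step (Term.un [] s) u ↔
      ∃ s', Relation.ReflTransGen (translateGrammar P Γ).Step s s' ∧ u = Term.un [] s' := by
    intro s u
    constructor
    · intro h
      induction h with
      | refl => exact ⟨s, .refl, rfl⟩
      | tail _ h ih =>
        obtain ⟨s', h', rfl⟩ := ih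
        cases h with
        | un h => exact ⟨_, h'.tail h, rfl⟩
    · rintro ⟨s', h, rfl⟩
      induction h with
      | refl => exact .refl
      | tail _ h ih => exact ih.tail (.un h)
  constructor
  · rintro ⟨X, hX, θ', h, hg, rfl⟩
    obtain rfl : X = 0 := List.mem_singleton.1 hX
    rcases h.cases_head with rfl | ⟨s, hs, h⟩
    · exact hg.elim
    · cases hs with
      | root hs =>
        obtain ⟨X, hX, rfl⟩ := (h0 _).1 hs
        obtain ⟨s', h', rfl⟩ := (hun _ _).1 h
        obtain ⟨θ, h'', rfl⟩ := (derives_translateTerm hΓ (Term.var X) s').1 h'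
        exact ⟨X, hX, θ, h'', (ground_translateTerm _ _ _).1 hg, rfl⟩
  · rintro ⟨X, hX, θ, h, hg, rfl⟩
    refine ⟨0, List.mem_singleton.2 rfl, Term.un [] (translateTerm P Q θ), ?_,
      (ground_translateTerm _ _ _).2 hg, rfl⟩
    refine .head (.root ((h0 _).2 ⟨X, hX, rfl⟩)) ((hun _ _).2 ⟨_, ?_, rfl⟩)
    exact (derives_translateTerm hΓ (Term.var X) _).2 ⟨θ, h, rfl⟩

/-! ### States of a system -/

/-- One step of the behavior, on the level of the current places of the vertices. -/
inductive StateStep (P : List ProcType) (G : LGraph) (s : G.V → Place) : (G.V → Place) → Prop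
  | internal {s' : G.V → Place} (v : G.V) (t : PTrans) (q : Place) : IsInternal P t →
      Label.proc t.1 ∈ G.lab v → internalPre P t = some (s v) → internalPost P t = some q →
      s' v = q → (∀ u, u ≠ v → s' u = s u) → StateStep P G s s'
  | edge {s' : G.V → Place} (v w : G.V) (δ : EdgeLabel) (q q' : Place) : (v, δ, w) ∈ G.edges →
      obsPre P δ.1 = some (s v) → obsPre P δ.2 = some (s w) →
      obsPost P δ.1 = some q → obsPost P δ.2 = some q' →
      s' v = q → s' w = q' → (∀ u, u ≠ v → u ≠ w → s' u = s u) → StateStep P G s s'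

/-- The vertex `v` may be in the place `s v`. -/
def ValidState (P : List ProcType) (G : LGraph) (s : G.V → Place) : Prop :=
  ∀ v, IsPlace P (s v) ∧ Label.proc (s v).1 ∈ G.lab v

def InitState (P : List ProcType) (G : LGraph) (s : G.V → Place) : Prop :=
  ∀ v, startPlace P (s v).1 = some (s v) ∧ Label.proc (s v).1 ∈ G.lab v

open Classical in
/-- The marking with one token in the current place of each vertex. -/
noncomputable def stateMarking (P : List ProcType) (G : LGraph) (s : G.V → Place) :
    (behavior P G).Place → ℕ :=
  fun x => if s x.1.2 = x.1.1 then 1 else 0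

theorem isPlace_of_obsPre {P : List ProcType} (hP : ∀ p ∈ P, p.WF) {t : PTrans} {q : Place}
    (h : obsPre P t = some q) : IsPlace P q ∧ q.1 = t.1 := by
  simp only [obsPre, Option.bind_eq_some_iff, Option.map_eq_some_iff] at h
  obtain ⟨p, hp, a, ha, rfl⟩ := h
  exact ⟨⟨p, hp, ((hP p (List.mem_of_getElem? hp)).2.1 a (List.mem_of_getElem? ha)).1⟩, rfl⟩

theorem isPlace_of_obsPost {P : List ProcType} (hP : ∀ p ∈ P, p.WF) {t : PTrans} {q : Place}
    (h : obsPost P t = some q) : IsPlace P q ∧ q.1 = t.1 := by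
  simp only [obsPost, Option.bind_eq_some_iff, Option.map_eq_some_iff] at h
  obtain ⟨p, hp, a, ha, rfl⟩ := h
  exact ⟨⟨p, hp, ((hP p (List.mem_of_getElem? hp)).2.1 a (List.mem_of_getElem? ha)).2⟩, rfl⟩

theorem isPlace_of_internalPre {P : List ProcType} (hP : ∀ p ∈ P, p.WF) {t : PTrans} {q : Place}
    (h : internalPre P t = some q) : IsPlace P q ∧ q.1 = t.1 := by
  simp only [internalPre, Option.bind_eq_some_iff, Option.map_eq_some_iff] at h
  obtain ⟨p, hp, a, ha, rfl⟩ := h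
  exact ⟨⟨p, hp, ((hP p (List.mem_of_getElem? hp)).2.2 a (List.mem_of_getElem? ha)).1⟩, rfl⟩

theorem isPlace_of_internalPost {P : List ProcType} (hP : ∀ p ∈ P, p.WF) {t : PTrans} {q : Place}
    (h : internalPost P t = some q) : IsPlace P q ∧ q.1 = t.1 := by
  simp only [internalPost, Option.bind_eq_some_iff, Option.map_eq_some_iff] at h
  obtain ⟨p, hp, a, ha, rfl⟩ := h
  exact ⟨⟨p, hp, ((hP p (List.mem_of_getElem? hp)).2.2 a (List.mem_of_getElem? ha)).2⟩, rfl⟩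

theorem exists_obsPre_obsPost {P : List ProcType} {t : PTrans} (h : IsObs P t) :
    ∃ q q', obsPre P t = some q ∧ obsPost P t = some q' := by
  obtain ⟨p, hp, ht⟩ := h
  simp [obsPre, obsPost, hp, ht]

theorem exists_internalPre_internalPost {P : List ProcType} {t : PTrans} (h : IsInternal P t) :
    ∃ q q', internalPre P t = some q ∧ internalPost P t = some q' := by
  obtain ⟨p, hp, ht⟩ := h
  simp [internalPre, internalPost, hp, ht]

theorem StateStep.validState {P : List ProcType} (hP : ∀ p ∈ P, p.WF) {G : LGraph}
    (hG : IsSystem P G) {s s' : G.V → Place} (h : StateStep P G s s') (hs : ValidState P G s) :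
    ValidState P G s' := by
  intro u
  cases h with
  | internal v t q ht hv _ hq h₁ h₂ =>
    by_cases hu : u = v
    · subst hu
      have := isPlace_of_internalPost hP hq
      rw [h₁, this.2]
      exact ⟨this.1, hv⟩
    · rw [h₂ u hu]; exact hs u
  | edge v w δ q q' he _ _ hq hq' h₁ h₂ h₃ =>
    obtain ⟨-, -, hv, -, hw⟩ := hG.2 _ _ _ he
    by_cases hu : u = v
    · subst hu
      have := isPlace_of_obsPost hP hq
      rw [h₁, this.2]
      exact ⟨this.1, hv⟩
    · by_cases hu' : u = w
      · subst hu'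
        have := isPlace_of_obsPost hP hq'
        rw [h₂, this.2]
        exact ⟨this.1, hw⟩
      · rw [h₃ u hu hu']; exact hs u

/-- The weights of `behavior` treat the two ends of an edge by a disjunction. This is the correct
sum because the ends are different vertices in a system. -/
theorem StateStep.exists_fire {P : List ProcType} {G : LGraph}
    (hG : IsSystem P G) {s s' : G.V → Place} (h : StateStep P G s s') :
    ∃ t, (behavior P G).Fire (stateMarking P G s) t (stateMarking P G s') := by
  cases h with
  | internal v t q ht hv hpre hpost h₁ h₂ =>
    refine ⟨Sum.inr ⟨(t, v), ht, hv⟩, ?_, ?_⟩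
    · rintro ⟨⟨p, u⟩, hu⟩
      simp only [behavior, stateMarking]
      grind
    · rintro ⟨⟨p, u⟩, hu⟩
      simp only [behavior, stateMarking]
      grind
  | edge v w δ q q' he hpre hpre' hpost hpost' h₁ h₂ h₃ =>
    have hvw := (hG.2 _ _ _ he).1
    refine ⟨Sum.inl ⟨(v, δ, w), he⟩, ?_, ?_⟩
    · rintro ⟨⟨p, u⟩, hu⟩
      simp only [behavior, stateMarking]
      grind
    · rintro ⟨⟨p, u⟩, hu⟩
      simp only [behavior, stateMarking]
      by_cases h1 : u = v
      · subst h1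
        simp only [hpre, hpost, hvw]
        grind
      · by_cases h2 : u = w
        · subst h2
          simp only [hpre', hpost', h1]
          grind
        · simp [h1, h2, h₃ u h1 h2]

/-- Enabledness, tested on the predecessor places, forces the tokens of the vertices involved to be
there. -/
theorem exists_stateStep_of_fire {P : List ProcType} (hP : ∀ p ∈ P, p.WF) {G : LGraph}
    (hG : IsSystem P G) {s : G.V → Place} {t : (behavior P G).Trans}
    {m : (behavior P G).Place → ℕ} (h : (behavior P G).Fire (stateMarking P G s) t m) :
    ∃ s', StateStep P G s s' ∧ m = stateMarking P G s' := by
  classical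
  -- Firing is deterministic, so it suffices to fire `t` into the marking of the updated state.
  have huniq {m'} (h' : (behavior P G).Fire (stateMarking P G s) t m') : m = m' := by
    funext x
    rw [h.2, h'.2]
  rcases t with ⟨⟨v, δ, w⟩, he⟩ | ⟨⟨t, v⟩, ht, hv⟩
  · obtain ⟨hvw, ho, hv, ho', hw⟩ := hG.2 _ _ _ he
    obtain ⟨p, q, hp, hq⟩ := exists_obsPre_obsPost ho
    obtain ⟨p', q', hp', hq'⟩ := exists_obsPre_obsPost ho'
    have e₁ : s v = p := by
      have h1 := isPlace_of_obsPre hP hp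
      have h2 := h.1 ⟨(p, v), h1.1, by simpa only [h1.2] using hv⟩
      simp only [behavior, stateMarking] at h2
      grind
    have e₂ : s w = p' := by
      have h1 := isPlace_of_obsPre hP hp'
      have h2 := h.1 ⟨(p', w), h1.1, by simpa only [h1.2] using hw⟩
      simp only [behavior, stateMarking] at h2
      grind
    have hst : StateStep P G s (Function.update (Function.update s v q) w q') := by
      refine .edge v w δ q q' he (by rw [hp, e₁]) (by rw [hp', e₂]) hq hq' ?_ ?_ ?_
      · rw [Function.update_of_ne hvw, Function.update_self]
      · rw [Function.update_self]
      · intro u h1 h2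
        rw [Function.update_of_ne h2, Function.update_of_ne h1]
    refine ⟨_, hst, huniq ?_⟩
    obtain ⟨h1, h2⟩ := h
    refine ⟨h1, ?_⟩
    rintro ⟨⟨r, u⟩, hu⟩
    simp only [behavior, stateMarking]
    grind
  · obtain ⟨p, q, hp, hq⟩ := exists_internalPre_internalPost ht
    have e₁ : s v = p := by
      have h1 := isPlace_of_internalPre hP hp
      have h2 := h.1 ⟨(p, v), h1.1, by simpa only [h1.2] using hv⟩
      simp only [behavior, stateMarking] at h2
      grind
    have hst : StateStep P G s (Function.update s v q) := by
      refine .internal v t q ht hv (by rw [hp, e₁]) hq ?_ ?_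
      · rw [Function.update_self]
      · intro u h1
        rw [Function.update_of_ne h1]
    refine ⟨_, hst, huniq ?_⟩
    refine ⟨h.1, ?_⟩
    rintro ⟨⟨r, u⟩, hu⟩
    simp only [behavior, stateMarking]
    grind

/-- The marked places are the pairs `(s v, v)`, one for each vertex. -/
theorem finsum_stateMarking (P : List ProcType) (G : LGraph) {s : G.V → Place}
    (hs : ValidState P G s) (L : Place → Option ℕ) (x : ℕ) :
    ∑ᶠ (q : (behavior P G).Place) (_ : L q.1.1 = some x), stateMarking P G s q =
      {v | L (s v) = some x}.ncard := by
  classical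
  let f : G.V → (behavior P G).Place := fun v => ⟨(s v, v), hs v⟩
  have hf : Function.Injective f := fun v w h => (Prod.ext_iff.1 (Subtype.ext_iff.1 h)).2
  have h : ∀ q : (behavior P G).Place, (∑ᶠ (_ : L q.1.1 = some x), stateMarking P G s q) =
      ∑ᶠ (_ : q ∈ f '' {v | L (s v) = some x}), 1 := by
    rintro ⟨⟨q, u⟩, hu⟩
    simp only [finsum_eq_if, stateMarking]
    rw [← ite_and]
    congr 1
    apply propext
    constructor
    · rintro ⟨h1, rfl⟩
      exact ⟨u, h1, rfl⟩
    · rintro ⟨v, h1, h2⟩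
      obtain ⟨rfl, rfl⟩ := Prod.mk.inj (Subtype.mk.inj h2)
      exact ⟨h1, rfl⟩
  simp only [h]
  rw [finsum_one, Set.ncard_image_of_injective _ hf]

theorem exists_initState {P : List ProcType} {G : LGraph} (hG : IsSystem P G) :
    ∃ s, InitState P G s := by
  choose i hi hl using hG.1
  refine ⟨fun v => (i v, (P[i v]'(hi v)).start), fun v => ⟨?_, ?_⟩⟩
  · simp [startPlace, hi v]
  · simp [hl v]

theorem InitState.validState {P : List ProcType} (hP : ∀ p ∈ P, p.WF) {G : LGraph}
    {s : G.V → Place} (hs : InitState P G s) : ValidState P G s := by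
  intro v
  obtain ⟨h1, h2⟩ := hs v
  refine ⟨?_, h2⟩
  simp only [startPlace, Option.map_eq_some_iff] at h1
  obtain ⟨p, hp, h⟩ := h1
  exact ⟨p, hp, by rw [← h]; exact (hP p (List.mem_of_getElem? hp)).1⟩

theorem stateMarking_init {P : List ProcType} {G : LGraph} (hG : IsSystem P G)
    {s : G.V → Place} (hs : InitState P G s) : stateMarking P G s = (behavior P G).m₀ := by
  funext x
  obtain ⟨⟨q, u⟩, hq, hu⟩ := x
  simp only [behavior, stateMarking]
  obtain ⟨h1, h2⟩ := hs u
  obtain ⟨i, hi, hl⟩ := hG.1 u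
  rw [hl] at h2 hu
  simp only [Set.mem_singleton_iff, Label.proc.injEq] at h2 hu
  have h3 : (s u).1 = q.1 := h2.trans hu.symm
  rw [h3] at h1
  rw [h1]
  simp

theorem reachable_iff {P : List ProcType} (hP : ∀ p ∈ P, p.WF) {G : LGraph} (hG : IsSystem P G)
    {s₀ : G.V → Place} (hs₀ : InitState P G s₀) (m : (behavior P G).Place → ℕ) :
    (behavior P G).Reachable m ↔
      ∃ s, Relation.ReflTransGen (StateStep P G) s₀ s ∧ m = stateMarking P G s := by
  unfold PetriNet.Reachable
  rw [← stateMarking_init hG hs₀]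
  constructor
  · intro h
    induction h with
    | refl => exact ⟨s₀, .refl, rfl⟩
    | tail _ h ih =>
      obtain ⟨s, hs, rfl⟩ := ih
      obtain ⟨t, h⟩ := h
      obtain ⟨s', hs', rfl⟩ := exists_stateStep_of_fire hP hG h
      exact ⟨s', hs.tail hs', rfl⟩
  · rintro ⟨s, h, rfl⟩
    induction h with
    | refl => exact .refl
    | tail _ h ih => exact ih.tail (h.exists_fire hG)

theorem reachable_validState {P : List ProcType} (hP : ∀ p ∈ P, p.WF) {G : LGraph}
    (hG : IsSystem P G) {s s' : G.V → Place} (hs : ValidState P G s)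
    (h : Relation.ReflTransGen (StateStep P G) s s') : ValidState P G s' := by
  induction h with
  | refl => exact hs
  | tail _ h ih => exact h.validState hP hG ih

/-- From here on nets and markings are replaced by states and by the number of vertices whose
current place has a given label. -/
theorem sat_iff {P : List ProcType} (hP : ∀ p ∈ P, p.WF) {G : LGraph} (hG : IsSystem P G)
    {s₀ : G.V → Place} (hs₀ : InitState P G s₀) (L : Place → Option ℕ) (α : ArithFormula) :
    (behavior P G).Sat (fun x => L x.1.1) α ↔
      ∃ s, Relation.ReflTransGen (StateStep P G) s₀ s ∧
        α.Realize fun x => {v | L (s v) = some x}.ncard := by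
  have h (s) (hs : Relation.ReflTransGen (StateStep P G) s₀ s) :
      (fun x => ∑ᶠ (q : (behavior P G).Place) (_ : L q.1.1 = some x), stateMarking P G s q) =
        fun x => {v | L (s v) = some x}.ncard :=
    funext fun x => finsum_stateMarking P G
      (reachable_validState hP hG (hs₀.validState hP) hs) L x
  constructor
  · rintro ⟨m, hm, hα⟩
    obtain ⟨s, hs, rfl⟩ := (reachable_iff hP hG hs₀ m).1 hm
    exact ⟨s, hs, h s hs ▸ hα⟩
  · rintro ⟨s, hs, hα⟩
    exact ⟨_, (reachable_iff hP hG hs₀ _).2 ⟨s, hs, rfl⟩, h s hs ▸ hα⟩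

/-! ### Composition of graphs in which ports name vertices -/

/-- Each port labels at most one vertex, each vertex has at most one port, and the process type of
its port. -/
structure PortSimple (G : LGraph) : Prop where
  unique_vertex : ∀ {v w π}, Label.port π ∈ G.lab v → Label.port π ∈ G.lab w → v = w
  unique_port : ∀ {v π π'}, Label.port π ∈ G.lab v → Label.port π' ∈ G.lab v → π = π'
  proc : ∀ {v π}, Label.port π ∈ G.lab v → Label.proc π.1 ∈ G.lab v

namespace LGraph

variable {G H : LGraph}

/-- The embeddings into a composition. -/
def compLeft (G H : LGraph) (v : G.V) : (comp G H).V := Quot.mk (Joined G H) (Sum.inl v)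
def compRight (G H : LGraph) (w : H.V) : (comp G H).V := Quot.mk (Joined G H) (Sum.inr w)

theorem comp_cases (x : (comp G H).V) :
    (∃ v, x = compLeft G H v) ∨ ∃ w, x = compRight G H w := by
  obtain ⟨v | w, rfl⟩ := Quot.exists_rep x
  exacts [Or.inl ⟨v, rfl⟩, Or.inr ⟨w, rfl⟩]

theorem mem_comp_lab (x : (comp G H).V) (l : Label) : l ∈ (comp G H).lab x ↔
    (∃ v, x = compLeft G H v ∧ l ∈ G.lab v) ∨ ∃ w, x = compRight G H w ∧ l ∈ H.lab w := by
  constructor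
  · rintro ⟨v | w, rfl, h⟩
    exacts [Or.inl ⟨v, rfl, h⟩, Or.inr ⟨w, rfl, h⟩]
  · rintro (⟨v, rfl, h⟩ | ⟨w, rfl, h⟩)
    exacts [⟨Sum.inl v, rfl, h⟩, ⟨Sum.inr w, rfl, h⟩]

theorem mem_comp_edges (x y : (comp G H).V) (δ : EdgeLabel) : (x, δ, y) ∈ (comp G H).edges ↔
    (∃ u v, x = compLeft G H u ∧ y = compLeft G H v ∧ (u, δ, v) ∈ G.edges) ∨
      ∃ u v, x = compRight G H u ∧ y = compRight G H v ∧ (u, δ, v) ∈ H.edges := by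
  constructor
  · rintro ⟨_, (⟨⟨u, δ, v⟩, h, rfl⟩ | ⟨⟨u, δ, v⟩, h, rfl⟩), h'⟩
    · simp only at h'
      obtain ⟨rfl, rfl, rfl⟩ := h'
      exact Or.inl ⟨u, v, rfl, rfl, h⟩
    · simp only at h'
      obtain ⟨rfl, rfl, rfl⟩ := h'
      exact Or.inr ⟨u, v, rfl, rfl, h⟩
  · rintro (⟨u, v, rfl, rfl, h⟩ | ⟨u, v, rfl, rfl, h⟩)
    · exact ⟨_, Or.inl ⟨_, h, rfl⟩, rfl⟩
    · exact ⟨_, Or.inr ⟨_, h, rfl⟩, rfl⟩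

open Classical in
/-- A canonical representative of the joined vertices. -/
noncomputable def compRep (G H : LGraph) : G.V ⊕ H.V → G.V ⊕ H.V
  | Sum.inl v => Sum.inl v
  | Sum.inr w => if h : ∃ v π, Label.port π ∈ G.lab v ∧ Label.port π ∈ H.lab w then
      Sum.inl h.choose else Sum.inr w

/-- Under `PortSimple` a vertex of either side is joined with at most one vertex of the other side.
Hence sending a right vertex to its left partner is constant on the classes, which makes both
embeddings into the composition injective. -/
theorem compRep_eq (hG : PortSimple G) (hH : PortSimple H) {a b : G.V ⊕ H.V}
    (h : (Quot.mk (Joined G H) a) = Quot.mk (Joined G H) b) : compRep G H a = compRep G H b := by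
  refine congrArg (Quot.lift (compRep G H) ?_) h
  rintro a b ⟨v, w, π, rfl, rfl, h₁, h₂⟩
  have h : ∃ v π, Label.port π ∈ G.lab v ∧ Label.port π ∈ H.lab w := ⟨v, π, h₁, h₂⟩
  simp only [compRep, h, dif_pos, Sum.inl.injEq]
  obtain ⟨π', h₃, h₄⟩ := h.choose_spec
  obtain rfl := hH.unique_port h₂ h₄
  exact hG.unique_vertex h₁ h₃

theorem compLeft_injective (hG : PortSimple G) (hH : PortSimple H) :
    Function.Injective (compLeft G H) := fun _ _ h => Sum.inl.inj (compRep_eq hG hH h)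

theorem compLeft_eq_compRight (hG : PortSimple G) (hH : PortSimple H) {v : G.V} {w : H.V} :
    compLeft G H v = compRight G H w ↔ ∃ π, Label.port π ∈ G.lab v ∧ Label.port π ∈ H.lab w := by
  constructor
  · intro h
    have h' := compRep_eq hG hH h
    simp only [compRep] at h'
    split_ifs at h' with h₁
    rw [Sum.inl.injEq] at h'
    rw [h']
    exact h₁.choose_spec
  · rintro ⟨π, h₁, h₂⟩
    exact Quot.sound ⟨v, w, π, rfl, rfl, h₁, h₂⟩

theorem compRight_injective (hG : PortSimple G) (hH : PortSimple H) :
    Function.Injective (compRight G H) := by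
  intro w w' h
  have h' := compRep_eq hG hH h
  simp only [compRep] at h'
  split_ifs at h' with h₁ h₂ h₂
  · rw [Sum.inl.injEq] at h'
    obtain ⟨π, h₃, h₄⟩ := h₁.choose_spec
    obtain ⟨π', h₅, h₆⟩ := h₂.choose_spec
    rw [h'] at h₃
    obtain rfl := hG.unique_port h₃ h₅
    exact hH.unique_vertex h₄ h₆
  · exact Sum.inr.inj h'

theorem portSimple_comp (hG : PortSimple G) (hH : PortSimple H) : PortSimple (comp G H) where
  unique_vertex {x y π} h h' := by
    rw [mem_comp_lab] at h h'
    obtain ⟨v, rfl, h⟩ | ⟨v, rfl, h⟩ := h <;> obtain ⟨w, rfl, h'⟩ | ⟨w, rfl, h'⟩ := h'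
    · rw [hG.unique_vertex h h']
    · exact (compLeft_eq_compRight hG hH).2 ⟨π, h, h'⟩
    · exact ((compLeft_eq_compRight hG hH).2 ⟨π, h', h⟩).symm
    · rw [hH.unique_vertex h h']
  unique_port {x π π'} h h' := by
    rw [mem_comp_lab] at h h'
    obtain ⟨v, rfl, h⟩ | ⟨v, rfl, h⟩ := h <;> obtain ⟨w, hw, h'⟩ | ⟨w, hw, h'⟩ := h'
    · obtain rfl := compLeft_injective hG hH hw
      exact hG.unique_port h h'
    · obtain ⟨ρ, h₁, h₂⟩ := (compLeft_eq_compRight hG hH).1 hw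
      rw [hG.unique_port h h₁, hH.unique_port h' h₂]
    · obtain ⟨ρ, h₁, h₂⟩ := (compLeft_eq_compRight hG hH).1 hw.symm
      rw [hG.unique_port h' h₁, hH.unique_port h h₂]
    · obtain rfl := compRight_injective hG hH hw
      exact hH.unique_port h h'
  proc {x π} h := by
    rw [mem_comp_lab] at h ⊢
    obtain ⟨v, rfl, h⟩ | ⟨v, rfl, h⟩ := h
    exacts [Or.inl ⟨v, rfl, hG.proc h⟩, Or.inr ⟨v, rfl, hH.proc h⟩]

theorem portSimple_edge (δ : EdgeLabel) {π₁ π₂ : Port} (h : π₁ ≠ π₂) :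
    PortSimple (edge δ π₁ π₂) where
  unique_vertex {v w π} h₁ h₂ := by
    cases v <;> cases w <;> simp_all [edge]
  unique_port {v π π'} h₁ h₂ := by
    cases v <;> simp_all [edge]
  proc {v π} h₁ := by
    cases v <;> simp_all [edge]

end LGraph

/-- `H'` consists of `H`, embedded by `j`, and edges between named vertices according to `es`. -/
structure IsGlue (es : List PortEdge) (H H' : LGraph) (j : H.V → H'.V) : Prop where
  inj : Function.Injective j
  simple : PortSimple H'
  lab : ∀ v, H'.lab (j v) = H.lab v
  cover : ∀ a, (∃ v, a = j v) ∨ ∃ e ∈ es, ∃ π, (π = e.2.1 ∨ π = e.2.2) ∧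
    H'.lab a = {Label.port π, Label.proc π.1}
  ports : ∀ e ∈ es, (∃ a, Label.port e.2.1 ∈ H'.lab a) ∧ ∃ a, Label.port e.2.2 ∈ H'.lab a
  edges : ∀ a δ b, (a, δ, b) ∈ H'.edges ↔
    (∃ u v, a = j u ∧ b = j v ∧ (u, δ, v) ∈ H.edges) ∨
      ∃ π₁ π₂, (δ, π₁, π₂) ∈ es ∧ Label.port π₁ ∈ H'.lab a ∧ Label.port π₂ ∈ H'.lab b

/-- A vertex of the edge graph carries only a port and the process type of that port; a vertex of
`H` with the same port has both labels already. -/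
theorem lab_compRight_edge {δ : EdgeLabel} {π₁ π₂ : Port} (h : π₁ ≠ π₂) {H : LGraph}
    (hH : PortSimple H) (w : H.V) :
    (LGraph.comp (LGraph.edge δ π₁ π₂) H).lab (LGraph.compRight _ _ w) = H.lab w := by
  have hE := LGraph.portSimple_edge δ h
  ext l
  rw [LGraph.mem_comp_lab]
  constructor
  · rintro (⟨v, hv, hl⟩ | ⟨w', hw', hl⟩)
    · obtain ⟨π, h₁, h₂⟩ := (LGraph.compLeft_eq_compRight hE hH).1 hv.symm
      have h₃ := hH.proc h₂
      cases v <;> simp [LGraph.edge] at hl h₁ <;> subst h₁ <;> rcases hl with rfl | rfl <;>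
        assumption
    · rwa [LGraph.compRight_injective hE hH hw']
  · exact fun hl => Or.inr ⟨w, rfl, hl⟩

/-- As ports are unique in the composition, an added edge is determined by the ports of its ends.
This description does not depend on whether the ends existed before. -/
theorem IsGlue.cons {δ : EdgeLabel} {π₁ π₂ : Port} (hne : π₁ ≠ π₂) {es : List PortEdge}
    {H₀ H : LGraph} {j : H₀.V → H.V} (hj : IsGlue es H₀ H j) :
    IsGlue ((δ, π₁, π₂) :: es) H₀ (LGraph.comp (LGraph.edge δ π₁ π₂) H)
      (LGraph.compRight _ _ ∘ j) := by
  have hE := LGraph.portSimple_edge δ hne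
  have hl := lab_compRight_edge (δ := δ) hne hj.simple
  have hC := LGraph.portSimple_comp hE hj.simple
  have hi := LGraph.compRight_injective hE hj.simple
  have hp₁ : Label.port π₁ ∈ (LGraph.comp (LGraph.edge δ π₁ π₂) H).lab
      (LGraph.compLeft _ _ false) :=
    (LGraph.mem_comp_lab _ _).2 (Or.inl ⟨_, rfl, by simp [LGraph.edge]⟩)
  have hp₂ : Label.port π₂ ∈ (LGraph.comp (LGraph.edge δ π₁ π₂) H).lab
      (LGraph.compLeft _ _ true) :=
    (LGraph.mem_comp_lab _ _).2 (Or.inl ⟨_, rfl, by simp [LGraph.edge]⟩)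
  refine ⟨hi.comp hj.inj, hC, fun v => (hl _).trans (hj.lab v),
    ?_, ?_, ?_⟩
  · intro a
    by_cases ha : ∃ w, a = LGraph.compRight _ _ w
    · obtain ⟨w, rfl⟩ := ha
      rcases hj.cover w with ⟨v, rfl⟩ | ⟨e, he, π, hπ, h⟩
      · exact Or.inl ⟨v, rfl⟩
      · exact Or.inr ⟨e, List.mem_cons_of_mem _ he, π, hπ, (hl w).trans h⟩
    · obtain ⟨v, rfl⟩ := (LGraph.comp_cases a).resolve_right ha
      have hlab : (LGraph.comp (LGraph.edge δ π₁ π₂) H).lab (LGraph.compLeft _ _ v) =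
          (LGraph.edge δ π₁ π₂).lab v := by
        ext l
        rw [LGraph.mem_comp_lab]
        constructor
        · rintro (⟨v', hv, h⟩ | ⟨w, hw, -⟩)
          · rwa [LGraph.compLeft_injective hE hj.simple hv]
          · exact (ha ⟨w, hw⟩).elim
        · exact fun h => Or.inl ⟨v, rfl, h⟩
      -- The vertex `true` of the edge graph is the `π₂`-end.
      refine Or.inr ⟨_, List.mem_cons_self, cond v π₂ π₁, ?_, ?_⟩
      · cases v <;> simp
      · rw [hlab]; cases v <;> rfl
  · intro e he
    rcases List.mem_cons.1 he with rfl | he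
    · exact ⟨⟨_, hp₁⟩, ⟨_, hp₂⟩⟩
    · obtain ⟨⟨a, ha⟩, ⟨b, hb⟩⟩ := hj.ports e he
      exact ⟨⟨_, (hl a).symm ▸ ha⟩, ⟨_, (hl b).symm ▸ hb⟩⟩
  · intro a d b
    rw [LGraph.mem_comp_edges]
    constructor
    · rintro (⟨u, v, rfl, rfl, h⟩ | ⟨u, v, rfl, rfl, h⟩)
      · have h' : (u, d, v) = (false, δ, true) := h
        obtain ⟨h₁, h₂⟩ := Prod.ext_iff.1 h'
        obtain ⟨h₃, h₄⟩ := Prod.ext_iff.1 h₂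
        dsimp only at h₁ h₃ h₄
        subst h₁ h₃ h₄
        exact Or.inr ⟨π₁, π₂, List.mem_cons_self, hp₁, hp₂⟩
      · rcases (hj.edges u d v).1 h with ⟨u', v', rfl, rfl, h'⟩ | ⟨ρ₁, ρ₂, he, h₁, h₂⟩
        · exact Or.inl ⟨u', v', rfl, rfl, h'⟩
        · exact Or.inr ⟨ρ₁, ρ₂, List.mem_cons_of_mem _ he, (hl u).symm ▸ h₁,
            (hl v).symm ▸ h₂⟩
    · rintro (⟨u, v, rfl, rfl, h⟩ | ⟨ρ₁, ρ₂, he, h₁, h₂⟩)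
      · exact Or.inr ⟨j u, j v, rfl, rfl, (hj.edges _ _ _).2 (Or.inl ⟨u, v, rfl, rfl, h⟩)⟩
      · rcases List.mem_cons.1 he with he | he
        · simp only [Prod.mk.injEq] at he
          obtain ⟨rfl, rfl, rfl⟩ := he
          exact Or.inl ⟨false, true, hC.unique_vertex h₁ hp₁, hC.unique_vertex h₂ hp₂, rfl⟩
        -- The ends of an earlier edge exist in `H` already, and uniqueness of ports identifies them
        -- with `a` and `b`.
        · obtain ⟨⟨x, hx⟩, ⟨y, hy⟩⟩ := hj.ports _ he
          refine Or.inr ⟨x, y, hC.unique_vertex h₁ ((hl x).symm ▸ hx),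
            hC.unique_vertex h₂ ((hl y).symm ▸ hy), ?_⟩
          exact (hj.edges _ _ _).2 (Or.inr ⟨ρ₁, ρ₂, he, hx, hy⟩)

theorem exists_isGlue {es : List PortEdge} (hes : ∀ e ∈ es, e.2.1 ≠ e.2.2) {t : HRTerm}
    (ht : PortSimple (algHR.val t)) :
    ∃ j, IsGlue es (algHR.val t) (algHR.val (glue es t)) j := by
  induction es with
  | nil =>
    refine ⟨id, fun _ _ h => h, ht, fun _ => rfl, fun a => Or.inl ⟨a, rfl⟩, by simp, ?_⟩
    intro a δ b
    change (a, δ, b) ∈ (algHR.val t).edges ↔ _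
    simp only [id, List.not_mem_nil, false_and, exists_false, or_false]
    constructor
    · exact fun h => ⟨a, b, rfl, rfl, h⟩
    · rintro ⟨u, v, rfl, rfl, h⟩
      exact h
  | cons e es ih =>
    obtain ⟨j, hj⟩ := ih fun e he => hes e (List.mem_cons_of_mem _ he)
    exact ⟨_, hj.cons (hes e List.mem_cons_self)⟩

/-! ### The process types of the translation -/

theorem mem_obsList {P : List ProcType} {t : PTrans} : t ∈ obsList P ↔ IsObs P t := by
  obtain ⟨i, j⟩ := t
  simp only [obsList, List.mem_flatMap, List.mem_map, List.mem_range, IsObs, Prod.exists,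
    List.mem_zipIdx_iff_getElem?, Prod.mk.injEq]
  constructor
  · rintro ⟨p, k, hk, j', hj, rfl, rfl⟩
    exact ⟨p, hk, hj⟩
  · rintro ⟨p, hp, hj⟩
    exact ⟨p, i, hp, j, hj, rfl, rfl⟩

theorem obsList_getElem?_idxOf {P : List ProcType} {t : PTrans} (h : IsObs P t) :
    (obsList P)[(obsList P).idxOf t]? = some t := by
  rw [List.getElem?_eq_getElem (List.idxOf_lt_length_of_mem (mem_obsList.2 h)), List.getElem_idxOf]

theorem routerIndex_injective {P : List ProcType} {t t' : PTrans} (h : IsObs P t)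
    (h' : IsObs P t') (he : routerIndex P t = routerIndex P t') : t = t' := by
  have he' : (obsList P).idxOf t = (obsList P).idxOf t' := by
    unfold routerIndex at he; omega
  have h₁ := obsList_getElem?_idxOf h
  rw [he', obsList_getElem?_idxOf h'] at h₁
  exact (Option.some.inj h₁).symm

theorem le_routerIndex (P : List ProcType) (t : PTrans) : P.length ≤ routerIndex P t :=
  Nat.le_add_right _ _

theorem routerIndex_lt {P : List ProcType} {t : PTrans} (h : IsObs P t) :
    routerIndex P t < (expandTypes P).length := by
  have := List.idxOf_lt_length_of_mem (mem_obsList.2 h)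
  simp only [routerIndex, expandTypes, List.length_append, List.length_map]
  omega

theorem expandTypes_half {P : List ProcType} {i : ℕ} (h : i < P.length) :
    (expandTypes P)[i]? = P[i]?.map ProcType.half := by
  rw [expandTypes, List.getElem?_append_left (by simpa using h), List.getElem?_map]

theorem expandTypes_router {P : List ProcType} {t : PTrans} (h : IsObs P t) :
    (expandTypes P)[routerIndex P t]? = some router := by
  rw [expandTypes, List.getElem?_append_right (by simp [routerIndex])]
  simp only [List.length_map, routerIndex, Nat.add_sub_cancel_left, List.getElem?_map,
    obsList_getElem?_idxOf h, Option.map_some]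

theorem expandTypes_router_of_le {P : List ProcType} {i : ℕ} {p : ProcType} (h : P.length ≤ i)
    (hp : (expandTypes P)[i]? = some p) : p = router := by
  rw [expandTypes, List.getElem?_append_right (by simpa using h), List.getElem?_map,
    Option.map_eq_some_iff] at hp
  obtain ⟨_, _, rfl⟩ := hp
  rfl

/-- Locates `try` and `commit` in the transition list of a half process. -/
theorem getElem?_flatMap_pair {α β : Type*} (f g : α → β) (l : List α) (j : ℕ) :
    (l.flatMap fun x => [f x, g x])[2 * j]? = l[j]?.map f ∧
      (l.flatMap fun x => [f x, g x])[2 * j + 1]? = l[j]?.map g := by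
  induction l generalizing j with
  | nil => simp
  | cons a l ih =>
    cases j with
    | zero => simp
    | succ j => simpa [Nat.mul_succ] using ih j

theorem expandTypes_wf {P : List ProcType} (hP : ∀ p ∈ P, p.WF) : ∀ p ∈ expandTypes P, p.WF := by
  intro p hp
  rcases List.mem_append.1 hp with hp | hp
  · obtain ⟨p, hp', rfl⟩ := List.mem_map.1 hp
    obtain ⟨h₁, h₂, h₃⟩ := hP p hp'
    refine ⟨Nat.lt_add_right _ h₁, ?_, fun a ha => ⟨Nat.lt_add_right _ (h₃ a ha).1,
      Nat.lt_add_right _ (h₃ a ha).2⟩⟩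
    rintro a ha
    simp only [ProcType.half, List.mem_flatMap, List.mem_cons, List.not_mem_nil, or_false] at ha ⊢
    obtain ⟨⟨b, j⟩, hb, ha⟩ := ha
    rw [List.mem_zipIdx_iff_getElem?] at hb
    obtain ⟨hj, -⟩ := List.getElem?_eq_some_iff.1 hb
    have h₄ := h₂ b (List.mem_of_getElem? hb)
    dsimp only at hj
    rcases ha with rfl | rfl <;> constructor <;> dsimp only <;> omega
  · obtain ⟨_, _, rfl⟩ := List.mem_map.1 hp
    refine ⟨by decide, ?_, ?_⟩ <;> simp [router, idlePlace, activePlace, waitPlace, replyPlace]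

/-- The place `h_t` of the half processes. -/
def halfPlace (P : List ProcType) (t : PTrans) : Place :=
  (t.1, (P[t.1]?.map ProcType.numPlaces).getD 0 + t.2)

/-- A place of the routing process `ε_t`. -/
def routerPlace (P : List ProcType) (t : PTrans) (q : ℕ) : Place := (routerIndex P t, q)

theorem IsObs.fst_lt {P : List ProcType} {t : PTrans} (h : IsObs P t) : t.1 < P.length := by
  obtain ⟨p, hp, -⟩ := h
  exact (List.getElem?_eq_some_iff.1 hp).1

theorem IsPlace.fst_lt {P : List ProcType} {q : Place} (h : IsPlace P q) : q.1 < P.length := by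
  obtain ⟨p, hp, -⟩ := h
  exact (List.getElem?_eq_some_iff.1 hp).1

/-- The new places are numbered from `numPlaces` on. This distinguishes a half process with a
pending request from one that is at home. -/
theorem not_isPlace_halfPlace (P : List ProcType) (t : PTrans) : ¬ IsPlace P (halfPlace P t) := by
  rintro ⟨p, hp, h⟩
  simp only [halfPlace] at hp h
  simp only [hp, Option.map_some, Option.getD_some] at h
  omega

theorem halfPlace_injective {P : List ProcType} {t t' : PTrans}
    (h : halfPlace P t = halfPlace P t') : t = t' := by
  obtain ⟨i, j⟩ := t
  obtain ⟨i', j'⟩ := t'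
  simp only [halfPlace, Prod.mk.injEq] at h
  obtain ⟨rfl, h⟩ := h
  simp only [Prod.mk.injEq, true_and]
  omega

theorem half_obs_try {P : List ProcType} {t : PTrans} (h : IsObs P t) :
    obsPre (expandTypes P) (tryT t) = obsPre P t ∧
      obsPost (expandTypes P) (tryT t) = some (halfPlace P t) := by
  have hlt := h.fst_lt
  obtain ⟨p, hp, ht⟩ := h
  simp only [obsPre, obsPost, tryT, expandTypes_half hlt, hp, Option.map_some, Option.bind_some,
    ProcType.half, (getElem?_flatMap_pair _ _ _ _).1, List.getElem?_zipIdx, Option.map_map, halfPlace]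
  simp [List.getElem?_eq_getElem ht]

theorem half_obs_commit {P : List ProcType} {t : PTrans} (h : IsObs P t) :
    obsPre (expandTypes P) (commitT t) = some (halfPlace P t) ∧
      obsPost (expandTypes P) (commitT t) = obsPost P t := by
  have hlt := h.fst_lt
  obtain ⟨p, hp, ht⟩ := h
  simp only [obsPre, obsPost, commitT, expandTypes_half hlt, hp, Option.map_some, Option.bind_some,
    ProcType.half, (getElem?_flatMap_pair _ _ _ _).2, List.getElem?_zipIdx, Option.map_map, halfPlace]
  simp [List.getElem?_eq_getElem ht]

section RouterTransitions

variable {P : List ProcType} {t : PTrans}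

theorem obs_recvT (h : IsObs P t) :
    obsPre (expandTypes P) (recvT P t) = some (routerPlace P t idlePlace) ∧
      obsPost (expandTypes P) (recvT P t) = some (routerPlace P t activePlace) := by
  constructor <;> simp [obsPre, obsPost, recvT, expandTypes_router h, router, routerPlace]

theorem obs_fwdT (h : IsObs P t) :
    obsPre (expandTypes P) (fwdT P t) = some (routerPlace P t activePlace) ∧
      obsPost (expandTypes P) (fwdT P t) = some (routerPlace P t waitPlace) := by
  constructor <;> simp [obsPre, obsPost, fwdT, expandTypes_router h, router, routerPlace]

theorem obs_ackT (h : IsObs P t) :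
    obsPre (expandTypes P) (ackT P t) = some (routerPlace P t waitPlace) ∧
      obsPost (expandTypes P) (ackT P t) = some (routerPlace P t replyPlace) := by
  constructor <;> simp [obsPre, obsPost, ackT, expandTypes_router h, router, routerPlace]

theorem obs_resetT (h : IsObs P t) :
    obsPre (expandTypes P) (resetT P t) = some (routerPlace P t replyPlace) ∧
      obsPost (expandTypes P) (resetT P t) = some (routerPlace P t idlePlace) := by
  constructor <;> simp [obsPre, obsPost, resetT, expandTypes_router h, router, routerPlace]

theorem obs_syncT (h : IsObs P t) :
    obsPre (expandTypes P) (syncT P t) = some (routerPlace P t activePlace) ∧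
      obsPost (expandTypes P) (syncT P t) = some (routerPlace P t replyPlace) := by
  constructor <;> simp [obsPre, obsPost, syncT, expandTypes_router h, router, routerPlace]

end RouterTransitions

theorem isObs_of_obsPre {P : List ProcType} {t : PTrans} {q : Place} (h : obsPre P t = some q) :
    IsObs P t := by
  simp only [obsPre, Option.bind_eq_some_iff, Option.map_eq_some_iff] at h
  obtain ⟨p, hp, a, ha, -⟩ := h
  exact ⟨p, hp, (List.getElem?_eq_some_iff.1 ha).1⟩

/-- Half processes keep their internal transitions and routers have none. -/
theorem isInternal_expandTypes {P : List ProcType} {t : PTrans} :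
    IsInternal (expandTypes P) t ↔ IsInternal P t := by
  by_cases ht : t.1 < P.length
  · simp only [IsInternal, expandTypes_half ht, Option.map_eq_some_iff]
    constructor
    · rintro ⟨_, ⟨p, hp, rfl⟩, h⟩
      exact ⟨p, hp, h⟩
    · rintro ⟨p, hp, h⟩
      exact ⟨_, ⟨p, hp, rfl⟩, h⟩
  · constructor
    · rintro ⟨p, hp, h⟩
      rw [expandTypes_router_of_le (not_lt.1 ht) hp] at h
      exact absurd h (Nat.not_lt_zero _)
    · rintro ⟨p, hp, h⟩
      exact absurd (List.getElem?_eq_some_iff.1 hp).1 ht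

theorem internal_expandTypes {P : List ProcType} {t : PTrans} (ht : t.1 < P.length) :
    internalPre (expandTypes P) t = internalPre P t ∧
      internalPost (expandTypes P) t = internalPost P t := by
  simp only [internalPre, internalPost, expandTypes_half ht]
  cases P[t.1]? <;> simp [ProcType.half]

theorem expandLabeling_of_isPlace {P : List ProcType} (L : Place → Option ℕ) {q : Place}
    (h : IsPlace P q) : expandLabeling P L q = L q := by
  have hlt := h.fst_lt
  obtain ⟨p, hp, hq⟩ := h
  simp only [expandLabeling, hlt, if_true, hp, Option.bind_some, hq]

theorem expandLabeling_halfPlace {P : List ProcType} (L : Place → Option ℕ) {t : PTrans}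
    (h : IsObs P t) : expandLabeling P L (halfPlace P t) = none := by
  have hlt := h.fst_lt
  obtain ⟨p, hp, hq⟩ := h
  simp only [expandLabeling, halfPlace, hlt, hp, if_true, Option.map_some, Option.getD_some,
    Option.bind_some]
  rw [if_neg (by omega)]

theorem expandLabeling_routerPlace {P : List ProcType} (L : Place → Option ℕ) {t : PTrans}
    (h : IsObs P t) (q : ℕ) : expandLabeling P L (routerPlace P t q) =
      if q = activePlace then (obsPre P t).bind L
      else if q = replyPlace then (obsPost P t).bind L else none := by
  have hlt := le_routerIndex P t
  rw [expandLabeling, if_neg (by simpa [routerPlace] using hlt)]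
  simp only [routerPlace, routerIndex, Nat.add_sub_cancel_left, obsList_getElem?_idxOf h,
    Option.bind_some]
  rfl

/-! ### Router networks -/

/-- `a` is a routing process for the transition `t`. -/
def IsRouter (P : List ProcType) (H : LGraph) (t : PTrans) (a : H.V) : Prop :=
  IsObs P t ∧ ∀ i, Label.proc i ∈ H.lab a ↔ i = routerIndex P t

/-- The routers on a path that starts at `x`, for the transition `t`, last router first. -/
inductive RouterPath {V W : Type} (first : V → PTrans → W → Prop) (up : PTrans → W → W → Prop)
    (x : V) (t : PTrans) : List W → Prop
  | single {a : W} : first x t a → RouterPath first up x t [a]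
  | cons {a b : W} {l : List W} : RouterPath first up x t (a :: l) → up t a b →
      RouterPath first up x t (b :: a :: l)

/-- The graph `H` consists of a half process for each vertex of `G` and of routers: `first` are
the edges from the half processes to the routers, `up` those between a router and the next one, and
the edges `sync` between routers are those for the edges of `G`. -/
structure Network (P : List ProcType) (G H : LGraph) where
  half : G.V → H.V
  first : G.V → PTrans → H.V → Prop
  up : PTrans → H.V → H.V → Prop
  sync : PTrans → PTrans → H.V → H.V → Prop
  half_injective : Function.Injective half
  proc_spec : ∀ x, ∃ i < P.length, ∀ k, Label.proc k ∈ G.lab x ↔ k = i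
  proc_half : ∀ x i, Label.proc i ∈ H.lab (half x) ↔ Label.proc i ∈ G.lab x
  vertex_cases : ∀ a, (∃ x, a = half x) ∨ ∃ t, IsRouter P H t a
  first_spec : ∀ {x t a}, first x t a → Label.proc t.1 ∈ G.lab x ∧ IsRouter P H t a
  up_spec : ∀ {t a b}, up t a b → IsRouter P H t a ∧ IsRouter P H t b ∧ a ≠ b
  sync_spec : ∀ {t t' a b}, sync t t' a b → IsRouter P H t a ∧ IsRouter P H t' b ∧ a ≠ b
  first_unique : ∀ {x t a b}, first x t a → first x t b → a = b
  up_unique : ∀ {t a b c}, up t a b → up t a c → b = c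
  edges : ∀ a δ b, (a, δ, b) ∈ H.edges ↔
    (∃ x t, first x t b ∧ a = half x ∧
      (δ = (tryT t, recvT P t) ∨ δ = (commitT t, resetT P t))) ∨
    (∃ t, up t a b ∧ (δ = (fwdT P t, recvT P t) ∨ δ = (ackT P t, resetT P t))) ∨
    ∃ t t', sync t t' a b ∧ δ = (syncT P t, syncT P t')
  -- The typing premises exclude the labels for which `syncEdges` is empty. Disjoint paths without
  -- repetitions allow both requests to be under way at the same time.
  complete : ∀ {x t t' y}, (x, (t, t'), y) ∈ G.edges → IsObs P t → IsObs P t' →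
    Label.proc t.1 ∈ G.lab x → Label.proc t'.1 ∈ G.lab y → ∃ a l b l', sync t t' a b ∧
      RouterPath first up x t (a :: l) ∧ RouterPath first up y t' (b :: l') ∧
      (a :: l).Nodup ∧ (b :: l').Nodup ∧ (a :: l).Disjoint (b :: l')
  sound : ∀ {x t t' y a l b l'}, sync t t' a b → RouterPath first up x t (a :: l) →
    RouterPath first up y t' (b :: l') → (x, (t, t'), y) ∈ G.edges

namespace Network

variable {P : List ProcType} {G H : LGraph} (N : Network P G H)

abbrev Path (x : G.V) (t : PTrans) (l : List H.V) : Prop := RouterPath N.first N.up x t l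

variable {N}

theorem isRouter_unique {t t' : PTrans} {a : H.V} (h : IsRouter P H t a) (h' : IsRouter P H t' a) :
    t = t' :=
  routerIndex_injective h.1 h'.1 ((h'.2 _).1 ((h.2 _).2 rfl))

/-- The index of a half process is below `P.length`, that of a router is not. -/
theorem not_isRouter_half (x : G.V) (t : PTrans) : ¬ IsRouter P H t (N.half x) := by
  intro h
  obtain ⟨i, hi, hx⟩ := N.proc_spec x
  have h' := (h.2 i).1 ((N.proc_half x i).2 ((hx i).2 rfl))
  have := le_routerIndex P t
  omega

theorem Path.isRouter {x : G.V} {t : PTrans} {l : List H.V} (h : N.Path x t l) :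
    ∀ a ∈ l, IsRouter P H t a := by
  induction h with
  | single h => simpa using (N.first_spec h).2
  | cons h hu ih =>
    intro a ha
    rcases List.mem_cons.1 ha with rfl | ha
    · exact (N.up_spec hu).2.1
    · exact ih a ha

theorem Path.tail {x : G.V} {t : PTrans} {a b : H.V} {l : List H.V}
    (h : N.Path x t (b :: a :: l)) : N.Path x t (a :: l) ∧ N.up t a b := by
  cases h with
  | cons h hu => exact ⟨h, hu⟩

/-- Paths are listed from the top, so the entry router is the last element of the list. -/
theorem Path.first_eq {x : G.V} {t : PTrans} {a : H.V} {l : List H.V} (h : N.Path x t (a :: l))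
    {r : H.V} (hr : N.first x t r) : (r = a ∧ l = []) ∨ r ∈ l := by
  generalize hl : a :: l = l' at h
  induction h generalizing a l with
  | single h =>
    obtain ⟨rfl, rfl⟩ := List.cons.inj hl
    exact Or.inl ⟨N.first_unique hr h, rfl⟩
  | cons h hu ih =>
    obtain ⟨rfl, rfl⟩ := List.cons.inj hl
    rcases ih rfl with ⟨rfl, rfl⟩ | h
    · simp
    · exact Or.inr (List.mem_cons_of_mem _ h)

/-- Finds on the path the router for which a waiting router waits; by `up_unique` there is no other
candidate. -/
theorem Path.exists_up {x : G.V} {t : PTrans} {a : H.V} {l : List H.V} (h : N.Path x t (a :: l))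
    {c : H.V} (hc : c ∈ l) : (∃ l', l = c :: l' ∧ N.up t c a) ∨ ∃ b ∈ l, N.up t c b := by
  generalize hl : a :: l = l' at h
  induction h generalizing a l with
  | single h =>
    obtain ⟨rfl, rfl⟩ := List.cons.inj hl
    cases hc
  | @cons a' b l' h hu ih =>
    obtain ⟨rfl, rfl⟩ := List.cons.inj hl
    rcases List.mem_cons.1 hc with rfl | hc
    · exact Or.inl ⟨_, rfl, hu⟩
    · rcases ih hc rfl with ⟨l'', rfl, h'⟩ | ⟨b', hb, h'⟩
      · exact Or.inr ⟨_, List.mem_cons_self, h'⟩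
      · exact Or.inr ⟨b', List.mem_cons_of_mem _ hb, h'⟩

variable (N)

/-- The vertex `x` is in place `q`, where its token is carried by the routers of `l`. -/
def Carries (q : Place) (s : H.V → Place) (x : G.V) : List H.V → Prop
  | [] => s (N.half x) = q
  | r :: l => ∃ t, N.Path x t (r :: l) ∧ s (N.half x) = halfPlace P t ∧
      (∀ c ∈ l, s c = routerPlace P t waitPlace) ∧
      -- Until the synchronization the vertex counts as being in the predecessor of `t`, afterwards
      -- in the successor; the half process itself stays in `h_t`.
      ((s r = routerPlace P t activePlace ∧ obsPre P t = some q) ∨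
        (s r = routerPlace P t replyPlace ∧ obsPost P t = some q))

/-- The state `s'` of `H` represents the state `s` of `G`, with the routers on `path x` busy with
the vertex `x`. -/
structure Represents (s : G.V → Place) (s' : H.V → Place) (path : G.V → List H.V) : Prop where
  carries : ∀ x, N.Carries (s x) s' x (path x)
  nodup : ∀ x, (path x).Nodup
  disj : ∀ {x y a}, a ∈ path x → a ∈ path y → x = y
  idle : ∀ {t a}, IsRouter P H t a → (∀ x, a ∉ path x) → s' a = routerPlace P t idlePlace

variable {N}

theorem Carries.exists_isRouter {q : Place} {s : H.V → Place} {x : G.V} {l : List H.V}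
    (h : N.Carries q s x l) {a : H.V} (ha : a ∈ l) : ∃ t, IsRouter P H t a := by
  cases l with
  | nil => cases ha
  | cons r l =>
    obtain ⟨t, hp, -⟩ := h
    exact ⟨t, hp.isRouter a ha⟩

theorem Carries.congr {q : Place} {s s' : H.V → Place} {x : G.V} {l : List H.V}
    (h : N.Carries q s x l) (hx : s' (N.half x) = s (N.half x)) (hl : ∀ a ∈ l, s' a = s a) :
    N.Carries q s' x l := by
  cases l with
  | nil => exact hx.trans h
  | cons r l =>
    obtain ⟨t, hp, h₁, h₂, h₃⟩ := h
    refine ⟨t, hp, hx.trans h₁, fun c hc => ?_, ?_⟩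
    · rw [hl c (List.mem_cons_of_mem _ hc), h₂ c hc]
    · rwa [hl r List.mem_cons_self]

/-- Every step of the protocol concerns one vertex `x` and its routers. By `hd` and `hs'` the
routers of other vertices are untouched, so only the new data of `x` and the freed routers (`hi`)
have to be examined. -/
theorem Represents.modify {s s₂ : G.V → Place} {s' s'' : H.V → Place} {path path' : G.V → List H.V}
    (h : N.Represents s s' path) (x : G.V) (hs : ∀ y, y ≠ x → s₂ y = s y)
    (hp : ∀ y, y ≠ x → path' y = path y) (hx : N.Carries (s₂ x) s'' x (path' x))
    (hn : (path' x).Nodup) (hd : ∀ a ∈ path' x, ∀ y, a ∈ path y → y = x)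
    (hs' : ∀ a, a ≠ N.half x → a ∉ path x → a ∉ path' x → s'' a = s' a)
    (hi : ∀ a ∈ path x, a ∉ path' x → ∀ t, IsRouter P H t a → s'' a = routerPlace P t idlePlace) :
    N.Represents s₂ s'' path' := by
  have hd' : ∀ y a, y ≠ x → a ∈ path y → a ∉ path x ∧ a ∉ path' x := fun y a hy ha =>
    ⟨fun ha' => hy (h.disj ha ha'), fun ha' => hy (hd a ha' y ha)⟩
  have hr : ∀ {y a}, a ∈ path y → ∀ z, a ≠ N.half z := by
    rintro y _ ha z rfl
    obtain ⟨t, ht⟩ := (h.carries y).exists_isRouter ha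
    exact not_isRouter_half z t ht
  have hr' : ∀ {a}, a ∈ path' x → ∀ z, a ≠ N.half z := by
    rintro _ ha z rfl
    obtain ⟨t, ht⟩ := hx.exists_isRouter ha
    exact not_isRouter_half z t ht
  refine ⟨fun y => ?_, fun y => ?_, fun {y z a} hy hz => ?_, fun {t a} ht ha => ?_⟩
  · by_cases hy : y = x
    · subst hy; exact hx
    · rw [hs y hy, hp y hy]
      refine (h.carries y).congr ?_ fun a ha => ?_
      · exact hs' _ (fun e => hy (N.half_injective e)) (fun e => hr e _ rfl) (fun e => hr' e _ rfl)
      · exact hs' _ (hr ha _) (hd' y a hy ha).1 (hd' y a hy ha).2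
  · by_cases hy : y = x
    · subst hy; exact hn
    · rw [hp y hy]; exact h.nodup y
  · by_cases hyx : y = x <;> by_cases hzx : z = x
    · rw [hyx, hzx]
    · rw [hyx] at hy
      rw [hp z hzx] at hz
      exact absurd hy (hd' z a hzx hz).2
    · rw [hzx] at hz
      rw [hp y hyx] at hy
      exact absurd hz (hd' y a hyx hy).2
    · rw [hp y hyx] at hy
      rw [hp z hzx] at hz
      exact h.disj hy hz
  · by_cases hax : a ∈ path x
    · exact hi a hax (ha x) t ht
    · rw [hs' a ?_ hax (ha x)]
      · refine h.idle ht fun y hy => ?_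
        by_cases hyx : y = x
        · subst hyx; exact hax hy
        · exact ha y (by rwa [hp y hyx])
      · rintro rfl
        exact not_isRouter_half x t ht

theorem routerPlace_inj {t t' : PTrans} {q q' : ℕ} :
    routerPlace P t q = routerPlace P t' q' → q = q' := fun h => (Prod.mk.inj h).2

/-- Routers on a path are active, waiting or replying. -/
theorem Represents.not_mem_of_idle {s : G.V → Place} {s' : H.V → Place} {path : G.V → List H.V}
    (h : N.Represents s s' path) {t : PTrans} {a : H.V} (ha : s' a = routerPlace P t idlePlace)
    (x : G.V) : a ∉ path x := by
  intro hx
  have hc := h.carries x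
  generalize path x = l at hx hc
  cases l with
  | nil => cases hx
  | cons r l =>
    obtain ⟨t', -, -, h₂, h₃⟩ := hc
    rcases List.mem_cons.1 hx with rfl | hx
    · rcases h₃ with ⟨h₃, -⟩ | ⟨h₃, -⟩ <;> rw [ha] at h₃ <;>
        exact absurd (routerPlace_inj h₃) (by decide)
    · have h₂ := h₂ a hx
      rw [ha] at h₂
      exact absurd (routerPlace_inj h₂) (by decide)

/-- A busy router is on a path. -/
theorem Represents.exists_path {s : G.V → Place} {s' : H.V → Place} {path : G.V → List H.V}
    (h : N.Represents s s' path) {t : PTrans} {a : H.V} (hr : IsRouter P H t a) {q : ℕ}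
    (ha : s' a = routerPlace P t q) (hq : q ≠ idlePlace) : ∃ x r l, path x = r :: l ∧
      a ∈ path x ∧ N.Path x t (r :: l) ∧ s' (N.half x) = halfPlace P t ∧
      (∀ c ∈ l, s' c = routerPlace P t waitPlace) ∧
      ((s' r = routerPlace P t activePlace ∧ obsPre P t = some (s x)) ∨
        (s' r = routerPlace P t replyPlace ∧ obsPost P t = some (s x))) := by
  by_cases hx : ∃ x, a ∈ path x
  · obtain ⟨x, hx⟩ := hx
    have hc := h.carries x
    cases hl : path x with
    | nil => rw [hl] at hx; cases hx
    | cons r l =>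
      rw [hl] at hx hc
      obtain ⟨t', hp, h'⟩ := hc
      obtain rfl := isRouter_unique hr (hp.isRouter a hx)
      exact ⟨x, r, l, hl, hl ▸ hx, hp, h'⟩
  · rw [h.idle hr (not_exists.1 hx)] at ha
    exact absurd (routerPlace_inj ha).symm hq

/-- During a request the half process is in some `h_t`, which is not a place of `P`. -/
theorem Represents.home {s : G.V → Place} {s' : H.V → Place} {path : G.V → List H.V}
    (h : N.Represents s s' path) {x : G.V} (hx : IsPlace P (s' (N.half x))) :
    path x = [] ∧ s' (N.half x) = s x := by
  have hc := h.carries x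
  cases hl : path x with
  | nil => rw [hl] at hc; exact ⟨rfl, hc⟩
  | cons r l =>
    rw [hl] at hc
    obtain ⟨t, -, hh, -⟩ := hc
    rw [hh] at hx
    exact absurd hx (not_isPlace_halfPlace P t)

theorem exists_half_of_proc {v : H.V} {i : ℕ} (hi : i < P.length)
    (hv : Label.proc i ∈ H.lab v) : ∃ x, v = N.half x := by
  refine (N.vertex_cases v).resolve_right ?_
  rintro ⟨t, ht⟩
  have := (ht.2 _).1 hv
  have := le_routerIndex P t
  omega

end Network

namespace Network

variable {P : List ProcType} {G H : LGraph} {N : Network P G H}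

/-! ### Soundness of the simulation -/

/-- Internal transitions belong to half processes, and their predecessors are places of `P`, so the
half process that moves is at home. -/
theorem Represents.internal_sound (hP : ∀ p ∈ P, p.WF) {s : G.V → Place} {s' s'' : H.V → Place}
    {path : G.V → List H.V} (h : N.Represents s s' path) {v : H.V} {t : PTrans} {q : Place}
    (ht : IsInternal (expandTypes P) t) (hv : Label.proc t.1 ∈ H.lab v)
    (hpre : internalPre (expandTypes P) t = some (s' v))
    (hpost : internalPost (expandTypes P) t = some q)
    (h₁ : s'' v = q) (h₂ : ∀ u, u ≠ v → s'' u = s' u) :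
    ∃ s₂, StateStep P G s s₂ ∧ N.Represents s₂ s'' path := by
  classical
  rw [isInternal_expandTypes] at ht
  have hlt : t.1 < P.length := by
    obtain ⟨p, hp, -⟩ := ht
    exact (List.getElem?_eq_some_iff.1 hp).1
  obtain ⟨x, rfl⟩ := N.exists_half_of_proc hlt hv
  rw [(internal_expandTypes hlt).1] at hpre
  rw [(internal_expandTypes hlt).2] at hpost
  obtain ⟨hx, hs⟩ := h.home (isPlace_of_internalPre hP hpre).1
  refine ⟨Function.update s x q, .internal x t q ht ((N.proc_half _ _).1 hv) (hs ▸ hpre) hpost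
    (by simp) (fun u hu => by simp [hu]), ?_⟩
  refine h.modify x (fun y hy => by simp [hy]) (fun y _ => rfl) ?_ (h.nodup x)
    (fun a ha y hy => h.disj hy ha) (fun a ha _ _ => h₂ a ha) (fun a ha ha' => absurd ha ha')
  rw [hx]
  simpa [Carries] using h₁

/-- An idle router is on no path and may therefore begin the path of `x`. -/
theorem Represents.try_sound (hP : ∀ p ∈ P, p.WF) {s : G.V → Place} {s' s'' : H.V → Place}
    {path : G.V → List H.V} (h : N.Represents s s' path) {x : G.V} {t : PTrans} {r : H.V}
    (hr : N.first x t r) (hpre : obsPre P t = some (s' (N.half x)))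
    (hr' : s' r = routerPlace P t idlePlace) (h₁ : s'' (N.half x) = halfPlace P t)
    (h₂ : s'' r = routerPlace P t activePlace)
    (h₃ : ∀ u, u ≠ N.half x → u ≠ r → s'' u = s' u) {path' : G.V → List H.V}
    (hx : path' x = [r]) (hy : ∀ y, y ≠ x → path' y = path y) : N.Represents s s'' path' := by
  obtain ⟨hx', hs⟩ := h.home (isPlace_of_obsPre hP hpre).1
  refine h.modify x (fun _ _ => rfl) hy ?_ (by simp [hx]) ?_ ?_ (by simp [hx'])
  · rw [hx]
    exact ⟨t, .single hr, h₁, by simp, Or.inl ⟨h₂, hs ▸ hpre⟩⟩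
  · intro a ha y hy
    rw [hx, List.mem_singleton] at ha
    exact absurd (ha ▸ hy) (h.not_mem_of_idle hr' y)
  · intro a ha _ ha'
    rw [hx, List.mem_singleton] at ha'
    exact h₃ a ha ha'

/-- All routers below the head of a path wait. If the entry router replies, it is thus the head, so
the path is just `[r]` and the transition has already been executed. -/
theorem Represents.commit_sound {s : G.V → Place} {s' s'' : H.V → Place}
    {path : G.V → List H.V} (h : N.Represents s s' path) {x : G.V} {t : PTrans} {r : H.V}
    {q : Place} (hr : N.first x t r) (hpost : obsPost P t = some q)
    (hx : s' (N.half x) = halfPlace P t) (hr' : s' r = routerPlace P t replyPlace)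
    (hs : IsPlace P (s x)) (h₁ : s'' (N.half x) = q)
    (h₂ : s'' r = routerPlace P t idlePlace)
    (h₃ : ∀ u, u ≠ N.half x → u ≠ r → s'' u = s' u) {path' : G.V → List H.V}
    (hx' : path' x = []) (hy : ∀ y, y ≠ x → path' y = path y) :
    path x = [r] ∧ N.Represents s s'' path' := by
  have hpx : path x = [r] ∧ obsPost P t = some (s x) := by
    have hc := h.carries x
    cases hl : path x with
    | nil =>
      -- With an empty path the place `s x` would be `h_t`, contrary to `hs`.
      rw [hl] at hc
      rw [← show s' (N.half x) = s x from hc, hx] at hs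
      exact absurd hs (not_isPlace_halfPlace P t)
    | cons a l =>
      rw [hl] at hc
      obtain ⟨t', hp, hh, hw, ha⟩ := hc
      obtain rfl := halfPlace_injective (hx.symm.trans hh)
      rcases Path.first_eq hp hr with ⟨rfl, rfl⟩ | hr
      · rcases ha with ⟨ha, -⟩ | ⟨-, ha⟩
        · rw [hr'] at ha
          exact absurd (routerPlace_inj ha) (by decide)
        · exact ⟨rfl, ha⟩
      · have := hw r hr
        rw [hr'] at this
        exact absurd (routerPlace_inj this) (by decide)
  obtain ⟨hpx, hsx⟩ := hpx
  refine ⟨hpx, h.modify x (fun _ _ => rfl) hy ?_ (by simp [hx']) (by simp [hx']) ?_ ?_⟩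
  · rw [hx']
    rw [hpost] at hsx
    exact h₁.trans (Option.some.inj hsx)
  · intro a ha ha' _
    rw [hpx, List.mem_singleton] at ha'
    exact h₃ a ha ha'
  · intro a ha _ t' ht'
    rw [hpx, List.mem_singleton] at ha
    subst ha
    obtain rfl := isRouter_unique ht' (N.first_spec hr).2
    exact h₂

/-- The active router `a` is the head of the path it lies on, and the idle router `b` is free, so
`b` can be put on top. -/
theorem Represents.fwd_sound {s : G.V → Place} {s' s'' : H.V → Place}
    {path : G.V → List H.V} (h : N.Represents s s' path) {t : PTrans} {a b : H.V}
    (hab : N.up t a b) (ha : s' a = routerPlace P t activePlace)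
    (hb : s' b = routerPlace P t idlePlace) (h₁ : s'' a = routerPlace P t waitPlace)
    (h₂ : s'' b = routerPlace P t activePlace) (h₃ : ∀ u, u ≠ a → u ≠ b → s'' u = s' u) :
    ∃ x l, path x = a :: l ∧ ∀ path' : G.V → List H.V, path' x = b :: a :: l →
      (∀ y, y ≠ x → path' y = path y) → N.Represents s s'' path' := by
  obtain ⟨hra, hrb, hne⟩ := N.up_spec hab
  obtain ⟨x, r, l, hx, hax, hp, hh, hw, hr⟩ := h.exists_path hra ha (by decide)
  have har : a = r := by
    rw [hx] at hax
    refine (List.mem_cons.1 hax).resolve_right fun hl => ?_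
    have := hw a hl
    rw [ha] at this
    exact absurd (routerPlace_inj this) (by decide)
  subst har
  have hbx := h.not_mem_of_idle hb
  have hn := h.nodup x
  refine ⟨x, l, hx, fun path' hx' hy => ?_⟩
  refine h.modify x (fun _ _ => rfl) hy ?_ ?_ ?_ ?_ ?_
  · rw [hx']
    refine ⟨t, .cons hp hab, ?_, ?_, Or.inl ⟨h₂, ?_⟩⟩
    · rw [h₃ _ (fun e => not_isRouter_half x t (e ▸ hra)) fun e => not_isRouter_half x t (e ▸ hrb)]
      exact hh
    · intro c hc
      rcases List.mem_cons.1 hc with rfl | hc'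
      · exact h₁
      · rw [h₃, hw c hc']
        · rintro rfl
          rw [hx] at hn
          exact (List.nodup_cons.1 hn).1 hc'
        · rintro rfl
          exact hbx x (hx ▸ List.mem_cons_of_mem _ hc')
    · rcases hr with ⟨-, hr⟩ | ⟨hr, -⟩
      · exact hr
      · rw [ha] at hr
        exact absurd (routerPlace_inj hr) (by decide)
  · rw [hx', ← hx]
    exact List.nodup_cons.2 ⟨hbx x, hn⟩
  · intro c hc y hcy
    rw [hx', ← hx] at hc
    rcases List.mem_cons.1 hc with rfl | hc
    · exact absurd hcy (hbx y)
    · exact h.disj hcy hc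
  · intro c _ hc hc'
    rw [hx', ← hx, List.mem_cons, not_or] at hc'
    refine h₃ c ?_ hc'.1
    rintro rfl
    exact hc hax
  · intro c hc hc'
    rw [hx', ← hx] at hc'
    exact absurd (List.mem_cons_of_mem _ hc) hc'

/-- The waiting router `a` is not a head, so its only successor `b` lies on the same path; since `b`
replies instead of waiting, `b` is the head and can be removed. -/
theorem Represents.ack_sound {s : G.V → Place} {s' s'' : H.V → Place}
    {path : G.V → List H.V} (h : N.Represents s s' path) {t : PTrans} {a b : H.V}
    (hab : N.up t a b) (ha : s' a = routerPlace P t waitPlace)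
    (hb : s' b = routerPlace P t replyPlace) (h₁ : s'' a = routerPlace P t replyPlace)
    (h₂ : s'' b = routerPlace P t idlePlace) (h₃ : ∀ u, u ≠ a → u ≠ b → s'' u = s' u) :
    ∃ x l, path x = b :: a :: l ∧ ∀ path' : G.V → List H.V, path' x = a :: l →
      (∀ y, y ≠ x → path' y = path y) → N.Represents s s'' path' := by
  obtain ⟨hra, hrb, hne⟩ := N.up_spec hab
  obtain ⟨x, r, l, hx, hax, hp, hh, hw, hr⟩ := h.exists_path hra ha (by decide)
  have hal : a ∈ l := by
    rw [hx] at hax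
    refine (List.mem_cons.1 hax).resolve_left ?_
    rintro rfl
    rcases hr with ⟨hr, -⟩ | ⟨hr, -⟩ <;> rw [ha] at hr <;>
      exact absurd (routerPlace_inj hr) (by decide)
  have hrl : b = r ∧ ∃ l', l = a :: l' := by
    rcases Path.exists_up hp hal with ⟨l', rfl, hu⟩ | ⟨c, hc, hu⟩
    · exact ⟨N.up_unique hab hu, l', rfl⟩
    · obtain rfl := N.up_unique hab hu
      have := hw b hc
      rw [hb] at this
      exact absurd (routerPlace_inj this) (by decide)
  obtain ⟨rfl, l', rfl⟩ := hrl
  have hn := h.nodup x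
  rw [hx, List.nodup_cons] at hn
  refine ⟨x, l', hx, fun path' hx' hy => ?_⟩
  refine h.modify x (fun _ _ => rfl) hy ?_ ?_ ?_ ?_ ?_
  · rw [hx']
    refine ⟨t, (Path.tail hp).1, ?_, ?_, Or.inr ⟨h₁, ?_⟩⟩
    · rw [h₃ _ (fun e => not_isRouter_half x t (e ▸ hra)) fun e => not_isRouter_half x t (e ▸ hrb)]
      exact hh
    · intro c hc
      rw [h₃, hw c (List.mem_cons_of_mem _ hc)]
      · rintro rfl
        exact (List.nodup_cons.1 hn.2).1 hc
      · rintro rfl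
        exact hn.1 (List.mem_cons_of_mem _ hc)
    · rcases hr with ⟨hr, -⟩ | ⟨-, hr⟩
      · rw [hb] at hr
        exact absurd (routerPlace_inj hr) (by decide)
      · exact hr
  · rw [hx']
    exact hn.2
  · intro c hc y hcy
    rw [hx'] at hc
    exact h.disj hcy (hx ▸ List.mem_cons_of_mem _ hc)
  · intro c _ hc _
    rw [hx] at hc
    refine h₃ c ?_ ?_ <;> rintro rfl <;> simp at hc
  · intro c hc hc' t' ht'
    rw [hx'] at hc'
    rw [hx] at hc
    obtain rfl := (List.mem_cons.1 hc).resolve_right hc'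
    obtain rfl := isRouter_unique ht' hrb
    exact h₂

/-- The change of a top router when its transition is executed. -/
theorem Represents.reply {s s₂ : G.V → Place} {s' s'' : H.V → Place}
    {path : G.V → List H.V} (h : N.Represents s s' path) {t : PTrans} {x : G.V} {a : H.V}
    {l : List H.V} (hra : IsRouter P H t a) (hx : path x = a :: l)
    (h₁ : s'' a = routerPlace P t replyPlace) (h₂ : ∀ u, u ≠ a → s'' u = s' u)
    (hs : obsPost P t = some (s₂ x)) (hs' : ∀ y, y ≠ x → s₂ y = s y) :
    N.Represents s₂ s'' path := by
  have hn := h.nodup x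
  have hc := h.carries x
  refine h.modify x hs' (fun _ _ => rfl) ?_ hn (fun a ha y hy => h.disj hy ha) ?_
    (fun a ha ha' => absurd ha ha')
  · rw [hx] at hn hc ⊢
    obtain ⟨t', hp, hh, hw, hr⟩ := hc
    obtain rfl := isRouter_unique hra (hp.isRouter a List.mem_cons_self)
    refine ⟨t, hp, ?_, fun c hc => ?_, Or.inr ⟨h₁, hs⟩⟩
    · rw [h₂ _ fun e => not_isRouter_half x t (e ▸ hra), hh]
    · rw [h₂, hw c hc]
      rintro rfl
      exact (List.nodup_cons.1 hn).1 hc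
  · intro c _ hc _
    refine h₂ c ?_
    rintro rfl
    exact hc (hx ▸ List.mem_cons_self)

theorem Represents.exists_top {s : G.V → Place} {s' : H.V → Place} {path : G.V → List H.V}
    (h : N.Represents s s' path) {t : PTrans} {a : H.V} (hra : IsRouter P H t a)
    (ha : s' a = routerPlace P t activePlace) :
    ∃ x l, path x = a :: l ∧ N.Path x t (a :: l) ∧ obsPre P t = some (s x) := by
  obtain ⟨x, r, l, hx, hax, hp, -, hw, hr⟩ := h.exists_path hra ha (by decide)
  have har : a = r := by
    rw [hx] at hax
    refine (List.mem_cons.1 hax).resolve_right fun hl => ?_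
    have := hw a hl
    rw [ha] at this
    exact absurd (routerPlace_inj this) (by decide)
  subst har
  refine ⟨x, l, hx, hp, ?_⟩
  rcases hr with ⟨-, hr⟩ | ⟨hr, -⟩
  · exact hr
  · rw [ha] at hr
    exact absurd (routerPlace_inj hr) (by decide)

/-- Both ends are active, hence heads of paths, and `Network.sound` yields the edge of `G` between
the vertices that own these paths. -/
theorem Represents.sync_sound (hG : IsSystem P G) {s : G.V → Place} {s' s'' : H.V → Place}
    {path : G.V → List H.V} (h : N.Represents s s' path) {t t' : PTrans} {a b : H.V}
    (hab : N.sync t t' a b) (ha : s' a = routerPlace P t activePlace)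
    (hb : s' b = routerPlace P t' activePlace) (h₁ : s'' a = routerPlace P t replyPlace)
    (h₂ : s'' b = routerPlace P t' replyPlace) (h₃ : ∀ u, u ≠ a → u ≠ b → s'' u = s' u) :
    ∃ s₂, StateStep P G s s₂ ∧ N.Represents s₂ s'' path := by
  classical
  obtain ⟨hra, hrb, hne⟩ := N.sync_spec hab
  obtain ⟨x, l, hx, hp, hpre⟩ := h.exists_top hra ha
  obtain ⟨y, l', hy, hp', hpre'⟩ := h.exists_top hrb hb
  obtain ⟨_, q, -, hq⟩ := exists_obsPre_obsPost hra.1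
  obtain ⟨_, q', -, hq'⟩ := exists_obsPre_obsPost hrb.1
  have he := N.sound hab hp hp'
  have hxy := (hG.2 _ _ _ he).1
  refine ⟨Function.update (Function.update s x q) y q',
    .edge x y (t, t') q q' he hpre hpre' hq hq' ?_ ?_ ?_, ?_⟩
  · rw [Function.update_of_ne hxy, Function.update_self]
  · rw [Function.update_self]
  · intro u h1 h2
    rw [Function.update_of_ne h2, Function.update_of_ne h1]
  -- Only the first end has moved here. This pair of states need not be reachable; it splits the
  -- step into two applications of `reply`.
  have hmid : N.Represents (Function.update s x q)
      (Function.update s' a (routerPlace P t replyPlace)) path := by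
    refine h.reply hra hx ?_ ?_ ?_ ?_
    · rw [Function.update_self]
    · exact fun u hu => Function.update_of_ne hu _ _
    · rw [Function.update_self, hq]
    · exact fun u hu => Function.update_of_ne hu _ _
  refine hmid.reply hrb hy h₂ ?_ ?_ ?_
  · intro u hu
    by_cases hua : u = a
    · subst hua
      rw [h₁, Function.update_self]
    · rw [Function.update_of_ne hua, h₃ u hua hu]
  · rw [Function.update_self, hq']
  · exact fun u hu => Function.update_of_ne hu _ _

/-- Internal and synchronization steps are single steps of `G`; the other four kinds of edges leave
the state of `G` alone and change only the path of one vertex. -/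
theorem Represents.step_sound (hP : ∀ p ∈ P, p.WF) (hG : IsSystem P G) {s : G.V → Place}
    {s' s'' : H.V → Place} {path : G.V → List H.V} (h : N.Represents s s' path)
    (hs : ValidState P G s) (hst : StateStep (expandTypes P) H s' s'') :
    ∃ s₂ path₂, Relation.ReflTransGen (StateStep P G) s s₂ ∧ N.Represents s₂ s'' path₂ := by
  classical
  have hup (path : G.V → List H.V) (x : G.V) (l : List H.V) :
      Function.update path x l x = l ∧ ∀ y, y ≠ x → Function.update path x l y = path y :=
    ⟨Function.update_self .., fun y hy => Function.update_of_ne hy ..⟩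
  cases hst with
  | internal v t q ht hv hpre hpost h₁ h₂ =>
    obtain ⟨s₂, hs₂, h⟩ := h.internal_sound hP ht hv hpre hpost h₁ h₂
    exact ⟨s₂, path, .single hs₂, h⟩
  | edge v w δ q q' he hpre hpre' hpost hpost' h₁ h₂ h₃ =>
    rcases (N.edges v δ w).1 he with ⟨x, t, hf, rfl, rfl | rfl⟩ | ⟨t, hu, rfl | rfl⟩ |
      ⟨t, t', hsync, rfl⟩
    · have ht := (N.first_spec hf).2.1
      dsimp only at hpre hpre' hpost hpost'
      rw [(half_obs_try ht).1] at hpre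
      rw [(half_obs_try ht).2, Option.some.injEq] at hpost
      rw [(obs_recvT ht).1, Option.some.injEq] at hpre'
      rw [(obs_recvT ht).2, Option.some.injEq] at hpost'
      exact ⟨s, _, .refl, h.try_sound hP hf hpre hpre'.symm (h₁.trans hpost.symm)
        (h₂.trans hpost'.symm) h₃ (hup path x [w]).1 (hup path x [w]).2⟩
    · have ht := (N.first_spec hf).2.1
      dsimp only at hpre hpre' hpost hpost'
      rw [(half_obs_commit ht).1, Option.some.injEq] at hpre
      rw [(half_obs_commit ht).2] at hpost
      rw [(obs_resetT ht).1, Option.some.injEq] at hpre'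
      rw [(obs_resetT ht).2, Option.some.injEq] at hpost'
      exact ⟨s, _, .refl, (h.commit_sound hf hpost hpre.symm hpre'.symm (hs x).1 h₁
        (h₂.trans hpost'.symm) h₃ (hup path x []).1 (hup path x []).2).2⟩
    · have ht := (N.up_spec hu).1.1
      dsimp only at hpre hpre' hpost hpost'
      rw [(obs_fwdT ht).1, Option.some.injEq] at hpre
      rw [(obs_fwdT ht).2, Option.some.injEq] at hpost
      rw [(obs_recvT ht).1, Option.some.injEq] at hpre'
      rw [(obs_recvT ht).2, Option.some.injEq] at hpost'
      obtain ⟨x, l, -, h'⟩ := h.fwd_sound hu hpre.symm hpre'.symm (h₁.trans hpost.symm)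
        (h₂.trans hpost'.symm) h₃
      exact ⟨s, _, .refl, h' _ (hup path x _).1 (hup path x _).2⟩
    · have ht := (N.up_spec hu).1.1
      dsimp only at hpre hpre' hpost hpost'
      rw [(obs_ackT ht).1, Option.some.injEq] at hpre
      rw [(obs_ackT ht).2, Option.some.injEq] at hpost
      rw [(obs_resetT ht).1, Option.some.injEq] at hpre'
      rw [(obs_resetT ht).2, Option.some.injEq] at hpost'
      obtain ⟨x, l, -, h'⟩ := h.ack_sound hu hpre.symm hpre'.symm (h₁.trans hpost.symm)
        (h₂.trans hpost'.symm) h₃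
      exact ⟨s, _, .refl, h' _ (hup path x _).1 (hup path x _).2⟩
    · have ht := (N.sync_spec hsync).1.1
      have ht' := (N.sync_spec hsync).2.1.1
      dsimp only at hpre hpre' hpost hpost'
      rw [(obs_syncT ht).1, Option.some.injEq] at hpre
      rw [(obs_syncT ht).2, Option.some.injEq] at hpost
      rw [(obs_syncT ht').1, Option.some.injEq] at hpre'
      rw [(obs_syncT ht').2, Option.some.injEq] at hpost'
      obtain ⟨s₂, hs₂, h'⟩ := h.sync_sound hG hsync hpre.symm hpre'.symm (h₁.trans hpost.symm)
        (h₂.trans hpost'.symm) h₃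
      exact ⟨s₂, path, .single hs₂, h'⟩

/-! ### Completeness of the simulation -/

/-- Induction along the path: `try` activates the first router, and each `fwd` moves the request one
router up. Every router of `l` is free and so still idle when its turn comes. The last clause keeps
the head of a first path active while a second request climbs. -/
theorem Represents.climb (hP : ∀ p ∈ P, p.WF) {s : G.V → Place} {s' : H.V → Place}
    {path path' : G.V → List H.V} (h : N.Represents s s' path) {x : G.V} {t : PTrans}
    {l : List H.V} (hp : N.Path x t l) (hx : path x = []) (hn : l.Nodup)
    (hpre : obsPre P t = some (s x)) (hl : ∀ a ∈ l, ∀ y, a ∉ path y)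
    (hx' : path' x = l) (hy : ∀ y, y ≠ x → path' y = path y) :
    ∃ s'', Relation.ReflTransGen (StateStep (expandTypes P) H) s' s'' ∧
      N.Represents s s'' path' ∧ (∀ a, l.head? = some a → s'' a = routerPlace P t activePlace) ∧
      ∀ a, a ≠ N.half x → a ∉ l → s'' a = s' a := by
  classical
  induction hp generalizing path' with
  | @single a hf =>
    obtain ⟨hpt, hra⟩ := N.first_spec hf
    have ht := hra.1
    have hne : N.half x ≠ a := fun e => not_isRouter_half x t (e ▸ hra)
    have hsx : s' (N.half x) = s x := by simpa [hx, Carries] using h.carries x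
    have hsa : s' a = routerPlace P t idlePlace := h.idle hra (hl a (by simp))
    refine ⟨Function.update (Function.update s' (N.half x) (halfPlace P t)) a
      (routerPlace P t activePlace), .single (.edge (N.half x) a (tryT t, recvT P t)
        (halfPlace P t) (routerPlace P t activePlace) ?_ ?_ ?_ (half_obs_try ht).2
        (obs_recvT ht).2 ?_ ?_ ?_), ?_, ?_, ?_⟩
    · exact (N.edges _ _ _).2 (Or.inl ⟨x, t, hf, rfl, Or.inl rfl⟩)
    · rw [hsx, ← hpre]
      exact (half_obs_try ht).1
    · rw [hsa]
      exact (obs_recvT ht).1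
    · rw [Function.update_of_ne hne, Function.update_self]
    · rw [Function.update_self]
    · intro u h1 h2
      rw [Function.update_of_ne h2, Function.update_of_ne h1]
    · refine h.try_sound hP hf (hsx ▸ hpre) hsa ?_ ?_ ?_ hx' hy
      · rw [Function.update_of_ne hne, Function.update_self]
      · rw [Function.update_self]
      · intro u h1 h2
        rw [Function.update_of_ne h2, Function.update_of_ne h1]
    · intro b hb
      obtain rfl : a = b := by simpa using hb
      rw [Function.update_self]
    · intro u h1 h2
      rw [Function.update_of_ne (by simpa using h2), Function.update_of_ne h1]
  | @cons a b l hp hu ih =>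
    obtain ⟨hra, hrb, hne⟩ := N.up_spec hu
    have ht := hra.1
    rw [List.nodup_cons] at hn
    obtain ⟨s₁, hst, h₁, hact, heq⟩ := ih (path' := Function.update path x (a :: l)) hn.2
      (fun c hc => hl c (List.mem_cons_of_mem _ hc)) (Function.update_self ..)
      (fun y hy => Function.update_of_ne hy ..)
    have hsa := hact a rfl
    have hsb : s₁ b = routerPlace P t idlePlace := by
      rw [heq b (fun e => not_isRouter_half x t (e ▸ hrb)) hn.1]
      exact h.idle hrb (hl b List.mem_cons_self)
    have hb₁ : ∀ u, u ≠ a → u ≠ b → Function.update (Function.update s₁ a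
        (routerPlace P t waitPlace)) b (routerPlace P t activePlace) u = s₁ u := by
      intro u h1 h2
      rw [Function.update_of_ne h2, Function.update_of_ne h1]
    refine ⟨Function.update (Function.update s₁ a (routerPlace P t waitPlace)) b
      (routerPlace P t activePlace), hst.tail (.edge a b (fwdT P t, recvT P t)
        (routerPlace P t waitPlace) (routerPlace P t activePlace) ?_ ?_ ?_ (obs_fwdT ht).2
        (obs_recvT ht).2 ?_ ?_ hb₁), ?_, ?_, ?_⟩
    · exact (N.edges _ _ _).2 (Or.inr (Or.inl ⟨t, hu, Or.inl rfl⟩))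
    · rw [hsa]
      exact (obs_fwdT ht).1
    · rw [hsb]
      exact (obs_recvT ht).1
    · rw [Function.update_of_ne hne, Function.update_self]
    · rw [Function.update_self]
    · obtain ⟨z, l', hz, h'⟩ := h₁.fwd_sound hu hsa hsb
        (by rw [Function.update_of_ne hne, Function.update_self]) (by rw [Function.update_self]) hb₁
      obtain rfl : z = x := by
        refine h₁.disj (a := a) (hz ▸ List.mem_cons_self) ?_
        rw [Function.update_self]
        exact List.mem_cons_self
      rw [Function.update_self] at hz
      obtain ⟨-, rfl⟩ := List.cons.inj hz
      exact h' path' hx' fun y hyx => by rw [hy y hyx, Function.update_of_ne hyx]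
    · intro c hc
      obtain rfl : b = c := by simpa using hc
      rw [Function.update_self]
    · intro u h1 h2
      rw [List.mem_cons, not_or] at h2
      rw [hb₁ u (fun e => h2.2 (e ▸ List.mem_cons_self)) h2.1, heq u h1 h2.2]

/-- The reverse of `climb`: each `ack` hands the reply down and frees the router above, and `commit`
brings the vertex home. -/
theorem Represents.descend {s : G.V → Place} {s' : H.V → Place}
    {path path' : G.V → List H.V} (h : N.Represents s s' path) {x : G.V} {t : PTrans}
    {a : H.V} {l : List H.V} (hp : N.Path x t (a :: l)) (hx : path x = a :: l)
    (hs : IsPlace P (s x)) (ha : s' a = routerPlace P t replyPlace)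
    (hx' : path' x = []) (hy : ∀ y, y ≠ x → path' y = path y) :
    ∃ s'', Relation.ReflTransGen (StateStep (expandTypes P) H) s' s'' ∧
      N.Represents s s'' path' ∧ ∀ b, b ≠ N.half x → b ∉ a :: l → s'' b = s' b := by
  classical
  have hra := Path.isRouter hp a List.mem_cons_self
  have ht := hra.1
  have hc := h.carries x
  rw [hx] at hc
  obtain ⟨t', hp', hh, hw, hr⟩ := hc
  obtain rfl := isRouter_unique hra (hp'.isRouter a List.mem_cons_self)
  have hpost : obsPost P t = some (s x) := by
    rcases hr with ⟨hr, -⟩ | ⟨-, hr⟩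
    · rw [ha] at hr
      exact absurd (routerPlace_inj hr) (by decide)
    · exact hr
  induction l generalizing a s' path with
  | nil =>
    have hf : N.first x t a := by cases hp with | single hf => exact hf
    have hne : N.half x ≠ a := fun e => not_isRouter_half x t (e ▸ hra)
    have hb₁ : ∀ u, u ≠ N.half x → u ≠ a → Function.update (Function.update s' (N.half x)
        (s x)) a (routerPlace P t idlePlace) u = s' u := by
      intro u h1 h2
      rw [Function.update_of_ne h2, Function.update_of_ne h1]
    refine ⟨Function.update (Function.update s' (N.half x) (s x)) a (routerPlace P t idlePlace),
      .single (.edge (N.half x) a (commitT t, resetT P t) (s x) (routerPlace P t idlePlace)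
        ?_ ?_ ?_ ?_ (obs_resetT ht).2 ?_ ?_ hb₁), ?_, ?_⟩
    · exact (N.edges _ _ _).2 (Or.inl ⟨x, t, hf, rfl, Or.inr rfl⟩)
    · rw [hh]
      exact (half_obs_commit ht).1
    · rw [ha]
      exact (obs_resetT ht).1
    · exact (half_obs_commit ht).2.trans hpost
    · rw [Function.update_of_ne hne, Function.update_self]
    · rw [Function.update_self]
    · refine (h.commit_sound hf hpost hh ha hs ?_ ?_ hb₁ hx' hy).2
      · rw [Function.update_of_ne hne, Function.update_self]
      · rw [Function.update_self]
    · intro u h1 h2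
      exact hb₁ u h1 (by simpa using h2)
  | cons b l ih =>
    obtain ⟨hpb, hu⟩ := Path.tail hp
    obtain ⟨hrb, -, hne⟩ := N.up_spec hu
    have hb := hw b List.mem_cons_self
    set s₁ := Function.update (Function.update s' b (routerPlace P t replyPlace)) a
      (routerPlace P t idlePlace) with hs₁
    have hb₁ : ∀ u, u ≠ b → u ≠ a → s₁ u = s' u := by
      intro u h1 h2
      rw [hs₁, Function.update_of_ne h2, Function.update_of_ne h1]
    have hs₁b : s₁ b = routerPlace P t replyPlace := by
      rw [hs₁, Function.update_of_ne hne, Function.update_self]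
    have hs₁a : s₁ a = routerPlace P t idlePlace := by
      rw [hs₁, Function.update_self]
    have hn := h.nodup x
    rw [hx, List.nodup_cons, List.nodup_cons] at hn
    have hst : StateStep (expandTypes P) H s' s₁ := by
      refine .edge b a (ackT P t, resetT P t) (routerPlace P t replyPlace)
        (routerPlace P t idlePlace) ?_ ?_ ?_ (obs_ackT ht).2 (obs_resetT ht).2 hs₁b hs₁a hb₁
      · exact (N.edges _ _ _).2 (Or.inr (Or.inl ⟨t, hu, Or.inr rfl⟩))
      · rw [hb]
        exact (obs_ackT ht).1
      · rw [ha]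
        exact (obs_resetT ht).1
    obtain ⟨z, l', hz, h'⟩ := h.ack_sound hu hb ha hs₁b hs₁a hb₁
    obtain rfl : z = x := h.disj (a := a) (hz ▸ List.mem_cons_self) (hx ▸ List.mem_cons_self)
    rw [hx] at hz
    obtain ⟨-, hz⟩ := List.cons.inj hz
    obtain ⟨-, rfl⟩ := List.cons.inj hz
    have h₁ := h' (Function.update path z (b :: l)) (Function.update_self ..)
      (fun y hy => Function.update_of_ne hy ..)
    have hhalf : s₁ (N.half z) = s' (N.half z) :=
      hb₁ _ (fun e => not_isRouter_half z t (e ▸ hrb)) fun e => not_isRouter_half z t (e ▸ hra)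
    obtain ⟨s'', hst', hrep, heq⟩ := ih h₁ hpb (Function.update_self ..) hs₁b
      (fun y hyz => by rw [hy y hyz, Function.update_of_ne hyz]) hrb hpb (hhalf.trans hh)
      (fun c hc => by
        rw [hb₁ c, hw c (List.mem_cons_of_mem _ hc)]
        · rintro rfl
          exact hn.2.1 hc
        · rintro rfl
          exact hn.1 (List.mem_cons_of_mem _ hc)) (Or.inr ⟨hs₁b, hpost⟩)
    refine ⟨s'', .head hst hst', hrep, fun u h1 h2 => ?_⟩
    rw [List.mem_cons, not_or] at h2
    rw [heq u h1 h2.2, hb₁ u (fun e => h2.2 (e ▸ List.mem_cons_self)) h2.1]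

/-- Both requests climb, their heads synchronize, and both replies descend. The round ends with all
routers idle again, so it can be iterated. -/
theorem Represents.step_complete (hP : ∀ p ∈ P, p.WF) (hG : IsSystem P G) {s s₂ : G.V → Place}
    {s' : H.V → Place} (h : N.Represents s s' fun _ => []) (hs : ValidState P G s)
    (hst : StateStep P G s s₂) : ∃ s'', Relation.ReflTransGen (StateStep (expandTypes P) H) s' s'' ∧
      N.Represents s₂ s'' fun _ => [] := by
  classical
  have hs₂ := hst.validState hP hG hs
  have hhome : ∀ x, s' (N.half x) = s x := fun x => h.carries x
  cases hst with
  | internal v t q ht hv hpre hpost h₁ h₂ =>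
    have hlt : t.1 < P.length := by
      obtain ⟨p, hp, -⟩ := ht
      exact (List.getElem?_eq_some_iff.1 hp).1
    refine ⟨Function.update s' (N.half v) q, .single (.internal (N.half v) t q
      (isInternal_expandTypes.2 ht) ((N.proc_half _ _).2 hv) ?_ ?_ (Function.update_self ..)
      fun u hu => Function.update_of_ne hu ..), ?_⟩
    · rw [(internal_expandTypes hlt).1, hpre, hhome]
    · rw [(internal_expandTypes hlt).2, hpost]
    · refine h.modify v h₂ (fun _ _ => rfl) ?_ List.nodup_nil (by simp)
        (fun u hu _ _ => Function.update_of_ne hu ..) (by simp)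
      exact (Function.update_self ..).trans h₁.symm
  | edge x y δ q q' he hpre hpre' hpost hpost' h₁ h₂ h₃ =>
    obtain ⟨t, t'⟩ := δ
    obtain ⟨hxy, ht, hpx, ht', hpy⟩ := hG.2 _ _ _ he
    obtain ⟨a, l, b, l', hsync, hp, hp', hn, hn', hd⟩ := N.complete he ht ht' hpx hpy
    obtain ⟨hra, hrb, hne⟩ := N.sync_spec hsync
    have hbl : b ∉ a :: l := fun hb => hd hb List.mem_cons_self
    have hal : a ∉ b :: l' := fun ha => hd List.mem_cons_self ha
    -- The occupied paths after the first climb, after the second climb, and after the first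
    -- descent.
    set path₁ : G.V → List H.V := Function.update (fun _ => []) x (a :: l) with hpath₁
    set path₂ : G.V → List H.V := Function.update path₁ y (b :: l') with hpath₂
    set path₃ : G.V → List H.V := Function.update path₂ x [] with hpath₃
    have hp₁x : path₁ x = a :: l := Function.update_self ..
    have hp₁y : ∀ z, z ≠ x → path₁ z = [] := fun z hz => Function.update_of_ne hz ..
    have hp₂y : path₂ y = b :: l' := Function.update_self ..
    have hp₂z : ∀ z, z ≠ y → path₂ z = path₁ z := fun z hz => Function.update_of_ne hz ..
    have hp₃x : path₃ x = [] := Function.update_self ..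
    have hp₃z : ∀ z, z ≠ x → path₃ z = path₂ z := fun z hz => Function.update_of_ne hz ..
    obtain ⟨s₁', hst₁, hr₁, hact₁, heq₁⟩ := h.climb hP hp rfl hn hpre (by simp) hp₁x hp₁y
    obtain ⟨s₂', hst₂, hr₂, hact₂, heq₂⟩ := hr₁.climb hP hp' (hp₁y y hxy.symm) hn' hpre'
      (fun c hc z hz => by
        by_cases hzx : z = x
        · rw [hzx, hp₁x] at hz
          exact hd hz hc
        · rw [hp₁y z hzx] at hz
          cases hz) hp₂y hp₂z
    have hb₂ := hact₂ b rfl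
    have ha₂ : s₂' a = routerPlace P t activePlace := by
      rw [heq₂ a (fun e => not_isRouter_half y t (e ▸ hra)) hal]
      exact hact₁ a rfl
    set s₃' := Function.update s₂' a (routerPlace P t replyPlace) with hs₃'
    set s₄' := Function.update s₃' b (routerPlace P t' replyPlace) with hs₄'
    have ha₄ : s₄' a = routerPlace P t replyPlace := by
      rw [hs₄', Function.update_of_ne hne, hs₃', Function.update_self]
    have hb₄ : s₄' b = routerPlace P t' replyPlace := by
      rw [hs₄', Function.update_self]
    have hst₄ : StateStep (expandTypes P) H s₂' s₄' := by
      refine .edge a b (syncT P t, syncT P t') (routerPlace P t replyPlace)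
        (routerPlace P t' replyPlace) ?_ ?_ ?_ (obs_syncT ht).2 (obs_syncT ht').2 ha₄ hb₄ ?_
      · exact (N.edges _ _ _).2 (Or.inr (Or.inr ⟨t, t', hsync, rfl⟩))
      · rw [ha₂]
        exact (obs_syncT ht).1
      · rw [hb₂]
        exact (obs_syncT ht').1
      · intro u h1 h2
        rw [hs₄', Function.update_of_ne h2, hs₃', Function.update_of_ne h1]
    have hp₂x : path₂ x = a :: l := (hp₂z x hxy).trans hp₁x
    have hr₃ : N.Represents (Function.update s x q) s₃' path₂ := by
      refine hr₂.reply hra hp₂x ?_ ?_ ?_ ?_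
      · rw [hs₃', Function.update_self]
      · exact fun u hu => Function.update_of_ne hu _ _
      · rw [Function.update_self]
        exact hpost
      · exact fun u hu => Function.update_of_ne hu _ _
    have hr₄ : N.Represents s₂ s₄' path₂ := by
      refine hr₃.reply hrb hp₂y hb₄ ?_ ?_ ?_
      · exact fun u hu => Function.update_of_ne hu _ _
      · rw [h₂]
        exact hpost'
      · intro z hz
        by_cases hzx : z = x
        · rw [hzx, Function.update_self, h₁]
        · rw [Function.update_of_ne hzx, h₃ z hzx hz]
    obtain ⟨s₅', hst₅, hr₅, heq₅⟩ := hr₄.descend hp hp₂x (hs₂ x).1 ha₄ hp₃x hp₃z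
    have hb₅ : s₅' b = routerPlace P t' replyPlace := by
      rw [heq₅ b (fun e => not_isRouter_half x t' (e ▸ hrb)) hbl, hb₄]
    obtain ⟨s₆', hst₆, hr₆, -⟩ := hr₅.descend (path' := fun _ => []) hp'
      ((hp₃z y hxy.symm).trans hp₂y) (hs₂ y).1 hb₅ rfl (fun z hz => by
        by_cases hzx : z = x
        · rw [hzx, hp₃x]
        · rw [hp₃z z hzx, hp₂z z hz, hp₁y z hzx])
    exact ⟨s₆', ((hst₁.trans hst₂).tail hst₄).trans (hst₅.trans hst₆), hr₆⟩

/-! ### Reachability -/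

theorem represents_init {s : G.V → Place} {s' : H.V → Place} (hs : InitState P G s)
    (hs' : InitState (expandTypes P) H s') : N.Represents s s' fun _ => [] := by
  refine ⟨fun x => ?_, fun x => List.nodup_nil, by simp, fun {t a} ht _ => ?_⟩
  · obtain ⟨h₁, h₂⟩ := hs x
    obtain ⟨h₃, h₄⟩ := hs' (N.half x)
    obtain ⟨i, hi, hx⟩ := N.proc_spec x
    rw [N.proc_half, hx] at h₄
    rw [hx] at h₂
    rw [h₂] at h₁
    rw [h₄] at h₃
    simp only [startPlace, expandTypes_half hi, Option.map_map, Option.map_eq_some_iff] at h₁ h₃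
    obtain ⟨p, hp, h₁⟩ := h₁
    obtain ⟨p', hp', h₃⟩ := h₃
    rw [hp] at hp'
    obtain rfl := Option.some.inj hp'
    exact h₃.symm.trans h₁
  · obtain ⟨h₃, h₄⟩ := hs' a
    rw [ht.2] at h₄
    rw [h₄] at h₃
    simp only [startPlace, expandTypes_router ht.1, Option.map_some, Option.some.injEq] at h₃
    exact h₃.symm

/-- The head of the path of `x`, or its half process if the path is empty, has the label of `s x`.
All other vertices of `H` are in unlabeled places: `h_t`, `wait` or `idle`. -/
theorem Represents.ncard_eq {s : G.V → Place} {s' : H.V → Place} {path : G.V → List H.V}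
    (h : N.Represents s s' path) (hs : ValidState P G s) (L : Place → Option ℕ) (i : ℕ) :
    {a | expandLabeling P L (s' a) = some i}.ncard = {x | L (s x) = some i}.ncard := by
  set rep : G.V → H.V := fun x => (path x).headD (N.half x) with hrep
  have hmem : ∀ x, (path x = [] ∧ rep x = N.half x) ∨ rep x ∈ path x := by
    intro x
    simp only [hrep]
    cases path x <;> simp
  have hinj : Function.Injective rep := by
    intro x y hxy
    rcases hmem x with ⟨hx, hx'⟩ | hx <;> rcases hmem y with ⟨hy, hy'⟩ | hy
    · exact N.half_injective (hx'.symm.trans (hxy.trans hy'))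
    · rw [← hxy, hx'] at hy
      obtain ⟨t, ht⟩ := (h.carries y).exists_isRouter hy
      exact absurd ht (not_isRouter_half x t)
    · rw [hxy, hy'] at hx
      obtain ⟨t, ht⟩ := (h.carries x).exists_isRouter hx
      exact absurd ht (not_isRouter_half y t)
    · exact h.disj hx (hxy ▸ hy)
  have hlab : ∀ x, expandLabeling P L (s' (rep x)) = L (s x) := by
    intro x
    have hc := h.carries x
    simp only [hrep]
    cases hl : path x with
    | nil =>
      rw [hl] at hc
      change expandLabeling P L (s' (N.half x)) = L (s x)
      rw [show s' (N.half x) = s x from hc, expandLabeling_of_isPlace L (hs x).1]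
    | cons r l =>
      rw [hl] at hc
      obtain ⟨t, hp, -, -, hr⟩ := hc
      have ht := (hp.isRouter r List.mem_cons_self).1
      change expandLabeling P L (s' r) = L (s x)
      rcases hr with ⟨hr, hpre⟩ | ⟨hr, hpost⟩
      · rw [hr, expandLabeling_routerPlace L ht, if_pos rfl, hpre, Option.bind_some]
      · rw [hr, expandLabeling_routerPlace L ht, if_neg (by decide), if_pos rfl, hpost,
          Option.bind_some]
  have hout : ∀ a, (∀ x, a ≠ rep x) → expandLabeling P L (s' a) = none := by
    intro a ha
    rcases N.vertex_cases a with ⟨x, rfl⟩ | ⟨t, ht⟩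
    · have hc := h.carries x
      have hx := ha x
      simp only [hrep] at hx
      cases hl : path x with
      | nil =>
        rw [hl] at hx
        exact absurd rfl hx
      | cons r l =>
        rw [hl] at hc
        obtain ⟨t, hp, hh, -, -⟩ := hc
        rw [hh, expandLabeling_halfPlace L (hp.isRouter r List.mem_cons_self).1]
    · by_cases hx : ∃ x, a ∈ path x
      · obtain ⟨x, hx⟩ := hx
        have hc := h.carries x
        have hne := ha x
        simp only [hrep] at hne
        cases hl : path x with
        | nil => rw [hl] at hx; cases hx
        | cons r l =>
          rw [hl] at hc hx hne
          obtain ⟨t', hp, -, hw, -⟩ := hc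
          have hal := (List.mem_cons.1 hx).resolve_left hne
          rw [hw a hal, expandLabeling_routerPlace L (hp.isRouter a hx).1, if_neg (by decide),
            if_neg (by decide)]
      · rw [h.idle ht (not_exists.1 hx), expandLabeling_routerPlace L ht.1, if_neg (by decide),
          if_neg (by decide)]
  have himage : {a | expandLabeling P L (s' a) = some i} = rep '' {x | L (s x) = some i} := by
    ext a
    constructor
    · intro ha
      by_cases hr : ∃ x, a = rep x
      · obtain ⟨x, rfl⟩ := hr
        exact ⟨x, (hlab x).symm.trans ha, rfl⟩
      · rw [Set.mem_ofPred_eq, hout a (not_exists.1 hr)] at ha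
        cases ha
    · rintro ⟨x, hx, rfl⟩
      exact (hlab x).trans hx
  rw [himage, Set.ncard_image_of_injective _ hinj]

/-- Counts agree in every represented state. So a run of `H` may stop in the middle of the protocol,
while runs of `G` are simulated between states in which all routers are idle. -/
theorem sat_iff_sat (hP : ∀ p ∈ P, p.WF) (hG : IsSystem P G) (hH : IsSystem (expandTypes P) H)
    (N : Network P G H) (L : Place → Option ℕ) (α : ArithFormula) :
    (behavior P G).Sat (fun x => L x.1.1) α ↔
      (behavior (expandTypes P) H).Sat (fun x => expandLabeling P L x.1.1) α := by
  obtain ⟨s₀, hs₀⟩ := exists_initState hG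
  obtain ⟨s₀', hs₀'⟩ := exists_initState hH
  have hv₀ := hs₀.validState hP
  have h₀ : N.Represents s₀ s₀' fun _ => [] := represents_init hs₀ hs₀'
  rw [sat_iff hP hG hs₀ L, sat_iff (expandTypes_wf hP) hH hs₀' (expandLabeling P L)]
  constructor
  · rintro ⟨s, hs, hα⟩
    have : ∃ s', Relation.ReflTransGen (StateStep (expandTypes P) H) s₀' s' ∧
        N.Represents s s' fun _ => [] := by
      clear hα
      induction hs with
      | refl => exact ⟨s₀', .refl, h₀⟩
      | tail hs hst ih =>
        obtain ⟨s', hs', h⟩ := ih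
        obtain ⟨s'', hs'', h'⟩ := h.step_complete hP hG (reachable_validState hP hG hv₀ hs) hst
        exact ⟨s'', hs'.trans hs'', h'⟩
    obtain ⟨s', hs', h⟩ := this
    refine ⟨s', hs', ?_⟩
    convert hα using 2 with i
    exact h.ncard_eq (reachable_validState hP hG hv₀ hs) L i
  · rintro ⟨s', hs', hα⟩
    have : ∃ s path, Relation.ReflTransGen (StateStep P G) s₀ s ∧ N.Represents s s' path := by
      clear hα
      induction hs' with
      | refl => exact ⟨s₀, _, .refl, h₀⟩
      | tail hs' hst ih =>
        obtain ⟨s, path, hs, h⟩ := ih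
        obtain ⟨s₂, path₂, hs₂, h'⟩ :=
          h.step_sound hP hG (reachable_validState hP hG hv₀ hs) hst
        exact ⟨s₂, path₂, hs.trans hs₂, h'⟩
    obtain ⟨s, path, hs, h⟩ := this
    refine ⟨s, hs, ?_⟩
    convert hα using 2 with i
    exact (h.ncard_eq (reachable_validState hP hG hv₀ hs) L i).symm

end Network

/-! ### Router networks with ports -/

theorem RouterPath.map {V V' W W' : Type} {first : V → PTrans → W → Prop}
    {up : PTrans → W → W → Prop} {first' : V' → PTrans → W' → Prop}
    {up' : PTrans → W' → W' → Prop} {x : V} {x' : V'} {t : PTrans} (j : W → W')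
    (hf : ∀ a, first x t a → first' x' t (j a)) (hu : ∀ a b, up t a b → up' t (j a) (j b))
    {l : List W} (h : RouterPath first up x t l) : RouterPath first' up' x' t (l.map j) := by
  induction h with
  | single h => exact .single (hf _ h)
  | cons _ h ih => exact .cons ih (hu _ _ h)

/-- A path pulls back along a map whose image contains its entry router and is closed under
successors. -/
theorem RouterPath.exists_map {V V' W W' : Type} {first : V → PTrans → W → Prop}
    {up : PTrans → W → W → Prop} {first' : V' → PTrans → W' → Prop}
    {up' : PTrans → W' → W' → Prop} {x : V} {x' : V'} {t : PTrans} (j : W → W')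
    (hf : ∀ b, first' x' t b → ∃ a, b = j a ∧ first x t a)
    (hu : ∀ a b, up' t (j a) b → ∃ b', b = j b' ∧ up t a b')
    {l : List W'} (h : RouterPath first' up' x' t l) :
    ∃ l', l = l'.map j ∧ RouterPath first up x t l' := by
  induction h with
  | single h =>
    obtain ⟨a, rfl, ha⟩ := hf _ h
    exact ⟨[a], rfl, .single ha⟩
  | cons _ h ih =>
    obtain ⟨l', hl, h'⟩ := ih
    cases l' with
    | nil => cases hl
    | cons a l' =>
      obtain ⟨rfl, rfl⟩ := List.cons.inj hl
      obtain ⟨b', rfl, hb⟩ := hu _ _ h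
      exact ⟨b' :: a :: l', rfl, .cons h' hb⟩

theorem Network.Path.reflTransGen {P : List ProcType} {G H : LGraph} {N : Network P G H} {x : G.V}
    {t : PTrans} {a : H.V} {l : List H.V} (h : N.Path x t (a :: l)) {c : H.V} (hc : c ∈ a :: l) :
    Relation.ReflTransGen (N.up t) c a := by
  generalize hl : a :: l = l' at h hc
  induction h generalizing a l with
  | single h =>
    obtain ⟨rfl, rfl⟩ := List.cons.inj hl
    obtain rfl := List.mem_singleton.1 hc
    exact .refl
  | cons h hu ih =>
    obtain ⟨rfl, rfl⟩ := List.cons.inj hl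
    rcases List.mem_cons.1 hc with rfl | hc
    · exact .refl
    · exact (ih rfl hc).tail hu

/-- Two paths that meet and cannot be extended have the same end. -/
theorem Network.Path.top_unique {P : List ProcType} {G H : LGraph} {N : Network P G H} {x y : G.V}
    {t t' : PTrans} {a b : H.V} {l l' : List H.V} (h : N.Path x t (a :: l))
    (h' : N.Path y t' (b :: l')) (ha : ∀ t c, ¬ N.up t a c) (hb : ∀ t c, ¬ N.up t b c) {c : H.V}
    (hc : c ∈ a :: l) (hc' : c ∈ b :: l') : a = b := by
  obtain rfl := Network.isRouter_unique (h.isRouter c hc) (h'.isRouter c hc')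
  have hU : Relator.RightUnique (N.up t) := fun _ _ _ h₁ h₂ => N.up_unique h₁ h₂
  rcases (h.reflTransGen hc).total_of_right_unique hU (h'.reflTransGen hc') with h₁ | h₁
  · rcases h₁.cases_head with h₁ | ⟨d, h₁, -⟩
    · exact h₁
    · exact absurd h₁ (ha _ _)
  · rcases h₁.cases_head with h₁ | ⟨d, h₁, -⟩
    · exact h₁.symm
    · exact absurd h₁ (hb _ _)

/-- A network in which the last routers on the paths that start at a vertex with a port in `Q`
have ports. -/
structure PortNetwork (P : List ProcType) (Q : List Port) (G H : LGraph) extends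
    Network P G H where
  port_unique : ∀ {x π π'}, Label.port π ∈ G.lab x → Label.port π' ∈ G.lab x → π = π'
  port_spec : ∀ {x π}, Label.port π ∈ G.lab x → Label.proc π.1 ∈ G.lab x ∧ π ∈ Q
  simple : PortSimple H
  half_no_port : ∀ x p, Label.port p ∉ H.lab (half x)
  router_port : ∀ {t a p}, IsRouter P H t a → Label.port p ∈ H.lab a →
    ∃ π ∈ Q, t.1 = π.1 ∧ p = routerPort P 0 π t
  port_top : ∀ {a p}, Label.port p ∈ H.lab a → ∀ t b, ¬ up t a b
  port_no_sync : ∀ {a p}, Label.port p ∈ H.lab a →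
    ∀ t t' b, ¬ sync t t' a b ∧ ¬ sync t t' b a
  reach : ∀ {x π t}, Label.port π ∈ G.lab x → IsObs P t → t.1 = π.1 → ∃ a l,
    RouterPath first up x t (a :: l) ∧ (a :: l).Nodup ∧ Label.port (routerPort P 0 π t) ∈ H.lab a
  reach_sound : ∀ {x π t a l}, RouterPath first up x t (a :: l) →
    Label.port (routerPort P 0 π t) ∈ H.lab a → t.1 = π.1 → Label.port π ∈ G.lab x

/-! ### Router ports and their renaming -/

theorem mem_obsOf {P : List ProcType} {i : ℕ} {t : PTrans} :
    t ∈ obsOf P i ↔ IsObs P t ∧ t.1 = i := by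
  simp [obsOf, mem_obsList]

theorem mem_layerRenaming {P : List ProcType} {Q : List Port} {b : ℕ} {p p' : Port} :
    (p, p') ∈ layerRenaming P Q b ↔ ∃ π ∈ Q, ∃ t, IsObs P t ∧ t.1 = π.1 ∧
      p = routerPort P 0 π t ∧ p' = routerPort P b π t := by
  simp only [layerRenaming, List.mem_flatMap, List.mem_map, mem_obsOf, Prod.mk.injEq]
  constructor
  · rintro ⟨π, hπ, t, ⟨ht, h⟩, rfl, rfl⟩
    exact ⟨π, hπ, t, ht, h, rfl, rfl⟩
  · rintro ⟨π, hπ, t, ht, h, rfl, rfl⟩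
    exact ⟨π, hπ, t, ⟨ht, h⟩, rfl, rfl⟩

/-- The parity of the name `2 * π.2 + b` gives the layer and its half gives the name of `π`. The
type of `π` is not encoded, but `h` and `h'` recover it from the transition. -/
theorem routerPort_inj {P : List ProcType} {b b' : ℕ} {π π' : Port} {t t' : PTrans}
    (hb : b < 2) (hb' : b' < 2) (ht : IsObs P t) (ht' : IsObs P t') (h : t.1 = π.1)
    (h' : t'.1 = π'.1) (he : routerPort P b π t = routerPort P b' π' t') :
    b = b' ∧ π = π' ∧ t = t' := by
  obtain ⟨he, he'⟩ := Prod.mk.inj he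
  obtain rfl := routerIndex_injective ht ht' he
  refine ⟨by omega, Prod.ext (h.symm.trans h') (by omega), rfl⟩

theorem routerPort_layer_ne {P : List ProcType} {π π' : Port} {t t' : PTrans} :
    routerPort P 0 π t ≠ routerPort P 1 π' t' := by
  intro h
  have := (Prod.mk.inj h).2
  omega

theorem mem_rename_port {α : List (Port × Port)} {G : LGraph} {v : G.V} {p : Port} :
    Label.port p ∈ (LGraph.rename α G).lab v ↔ ∃ p', Label.port p' ∈ G.lab v ∧ (p', p) ∈ α := by
  constructor
  · rintro (⟨π, π', h, hα, he⟩ | ⟨i, he, -⟩)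
    · cases he
      exact ⟨π, h, hα⟩
    · cases he
  · rintro ⟨π, h, hα⟩
    exact Or.inl ⟨π, p, h, hα, rfl⟩

theorem mem_rename_proc {α : List (Port × Port)} {G : LGraph} {v : G.V} {i : ℕ} :
    Label.proc i ∈ (LGraph.rename α G).lab v ↔ Label.proc i ∈ G.lab v := by
  constructor
  · rintro (⟨π, π', h, hα, he⟩ | ⟨i, he, h⟩)
    · cases he
    · exact h
  · exact fun h => Or.inr ⟨i, rfl, h⟩

/-- Renaming of router ports keeps port-simple graphs port-simple. -/
theorem PortSimple.rename_layer {P : List ProcType} {Q : List Port} {b : ℕ} (hb : b < 2)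
    {G : LGraph} (hG : PortSimple G) : PortSimple (LGraph.rename (layerRenaming P Q b) G) where
  unique_vertex {v w p} h h' := by
    obtain ⟨p₁, h₁, h⟩ := mem_rename_port.1 h
    obtain ⟨p₂, h₂, h'⟩ := mem_rename_port.1 h'
    obtain ⟨π, -, t, ht, e, rfl, rfl⟩ := mem_layerRenaming.1 h
    obtain ⟨π', -, t', ht', e', rfl, he⟩ := mem_layerRenaming.1 h'
    obtain ⟨-, rfl, rfl⟩ := routerPort_inj hb hb ht ht' e e' he
    exact hG.unique_vertex h₁ h₂
  unique_port {v p p'} h h' := by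
    obtain ⟨p₁, h₁, h⟩ := mem_rename_port.1 h
    obtain ⟨p₂, h₂, h'⟩ := mem_rename_port.1 h'
    obtain ⟨π, -, t, ht, e, rfl, rfl⟩ := mem_layerRenaming.1 h
    obtain ⟨π', -, t', ht', e', rfl, rfl⟩ := mem_layerRenaming.1 h'
    obtain ⟨-, rfl, rfl⟩ := routerPort_inj zero_lt_two zero_lt_two ht ht' e e'
      (hG.unique_port h₁ h₂)
    rfl
  proc {v p} h := by
    obtain ⟨p₁, h₁, h⟩ := mem_rename_port.1 h
    obtain ⟨π, -, t, ht, e, rfl, rfl⟩ := mem_layerRenaming.1 h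
    have h₂ := hG.proc h₁
    exact mem_rename_proc.2 h₂

theorem mem_rename_keep {P : List ProcType} {Q : List Port} {G : LGraph} {v : G.V} {p : Port} :
    Label.port p ∈ (LGraph.rename (layerRenaming P Q 0) G).lab v ↔ Label.port p ∈ G.lab v ∧
      ∃ π ∈ Q, ∃ t, IsObs P t ∧ t.1 = π.1 ∧ p = routerPort P 0 π t := by
  rw [mem_rename_port]
  constructor
  · rintro ⟨p', h, h'⟩
    obtain ⟨π, hπ, t, ht, e, rfl, rfl⟩ := mem_layerRenaming.1 h'
    exact ⟨h, π, hπ, t, ht, e, rfl⟩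
  · rintro ⟨h, π, hπ, t, ht, e, rfl⟩
    exact ⟨_, h, mem_layerRenaming.2 ⟨π, hπ, t, ht, e, rfl, rfl⟩⟩

theorem isRouter_rename {P : List ProcType} {α : List (Port × Port)} {G : LGraph} {t : PTrans}
    {a : G.V} : IsRouter P (LGraph.rename α G) t a ↔ IsRouter P G t a := by
  unfold IsRouter
  refine and_congr_right fun _ => forall_congr' fun i => ?_
  rw [← mem_rename_proc (α := α)]

theorem portSimple_vertex (π : Port) : PortSimple (LGraph.vertex π) where
  unique_vertex _ _ := rfl
  unique_port h h' := by
    simp only [LGraph.vertex, Set.mem_insert_iff, Label.port.injEq, Set.mem_singleton_iff,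
      reduceCtorEq, or_false] at h h'
    rw [h, h']
  proc h := by
    simp only [LGraph.vertex, Set.mem_insert_iff, Label.port.injEq, Set.mem_singleton_iff,
      reduceCtorEq, or_false] at h
    subst h
    simp [LGraph.vertex]

/-! ### The network of a single vertex -/

theorem mem_attachEdges {P : List ProcType} {π : Port} {e : PortEdge} :
    e ∈ attachEdges P π ↔ ∃ t, IsObs P t ∧ t.1 = π.1 ∧
      (e = ((tryT t, recvT P t), halfPort π, routerPort P 0 π t) ∨
        e = ((commitT t, resetT P t), halfPort π, routerPort P 0 π t)) := by
  simp only [attachEdges, List.mem_flatMap, mem_obsOf, List.mem_cons, List.not_mem_nil, or_false]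
  simp only [and_assoc]

/-- The network of a single vertex. -/
theorem nonempty_portNetwork_vertex {P : List ProcType} {Q : List Port} {π : Port}
    (hP : π.1 < P.length) (hQ : π ∈ Q) {K : LGraph} {j : (LGraph.vertex (halfPort π)).V → K.V}
    (hK : IsGlue (attachEdges P π) (LGraph.vertex (halfPort π)) K j) :
    Nonempty (PortNetwork P Q (LGraph.vertex π) (LGraph.rename (layerRenaming P Q 0) K)) := by
  have hport : ∀ {x ρ}, Label.port ρ ∈ (LGraph.vertex π).lab x ↔ ρ = π := by
    intro x ρ
    simp [LGraph.vertex]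
  have hproc : ∀ {x i}, Label.proc i ∈ (LGraph.vertex π).lab x ↔ i = π.1 := by
    intro x i
    simp [LGraph.vertex]
  have hhalf : ∀ x l, l ∈ K.lab (j x) ↔ l = Label.port (halfPort π) ∨ l = Label.proc π.1 := by
    intro x l
    rw [hK.lab]
    rfl
  have hne : ∀ t, halfPort π ≠ routerPort P 0 π t := by
    intro t h
    have h₁ := (Prod.mk.inj h).1
    have := le_routerIndex P t
    omega
  have hrouter : ∀ {t a}, IsObs P t → Label.port (routerPort P 0 π t) ∈ K.lab a →
      K.lab a = {Label.port (routerPort P 0 π t), Label.proc (routerIndex P t)} := by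
    intro t a ht ha
    rcases hK.cover a with ⟨x, rfl⟩ | ⟨e, -, p, -, h⟩
    · rcases (hhalf x _).1 ha with h | h
      · exact absurd (Label.port.inj h).symm (hne t)
      · cases h
    · rw [h] at ha
      rcases ha with h' | h'
      · rw [h, ← Label.port.inj h']
        rfl
      · cases h'
  have hisr : ∀ {t a}, IsObs P t → Label.port (routerPort P 0 π t) ∈ K.lab a →
      IsRouter P (LGraph.rename (layerRenaming P Q 0) K) t a := by
    intro t a ht ha
    refine isRouter_rename.2 ⟨ht, fun i => ?_⟩
    rw [hrouter ht ha]
    simp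
  have hcover : ∀ a, (∃ x, a = j x) ∨ ∃ t, IsObs P t ∧ t.1 = π.1 ∧
      Label.port (routerPort P 0 π t) ∈ K.lab a := by
    intro a
    rcases hK.cover a with h | ⟨e, he, p, hp, h⟩
    · exact Or.inl h
    · obtain ⟨t, ht, e', he⟩ := mem_attachEdges.1 he
      have hp' : p = halfPort π ∨ p = routerPort P 0 π t := by
        rcases he with rfl | rfl <;> exact hp
      rcases hp' with rfl | rfl
      · refine Or.inl ⟨(), hK.simple.unique_vertex (π := halfPort π) (h ▸ Or.inl rfl) ?_⟩
        exact (hhalf _ _).2 (Or.inl rfl)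
      · exact Or.inr ⟨t, ht, e', h ▸ Or.inl rfl⟩
  have hhp : ∀ x p, Label.port p ∉ (LGraph.rename (layerRenaming P Q 0) K).lab (j x) := by
    intro x p h
    obtain ⟨h, ρ, -, t, ht, e, rfl⟩ := mem_rename_keep.1 h
    rcases (hhalf x _).1 h with h | h
    · have h₁ := (Prod.mk.inj (Label.port.inj h)).1
      have := le_routerIndex P t
      omega
    · cases h
  -- No router has a successor yet, so the path consists of the entry router.
  have hpath : ∀ {x t a l}, RouterPath (V := (LGraph.vertex π).V) (W := K.V)
      (fun _ t a => (IsObs P t ∧ t.1 = π.1) ∧ Label.port (routerPort P 0 π t) ∈ K.lab a)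
      (fun _ _ _ => False) x t (a :: l) →
        (IsObs P t ∧ t.1 = π.1) ∧ Label.port (routerPort P 0 π t) ∈ K.lab a := by
    intro x t a l h
    cases h with
    | single h => exact h
    | cons _ h => exact h.elim
  refine ⟨{
    half := j
    first := fun _ t a => (IsObs P t ∧ t.1 = π.1) ∧ Label.port (routerPort P 0 π t) ∈ K.lab a
    up := fun _ _ _ => False
    sync := fun _ _ _ _ => False
    half_injective := hK.inj
    proc_spec := fun x => ⟨π.1, hP, fun k => hproc⟩
    proc_half := ?_
    vertex_cases := ?_
    first_spec := ?_
    up_spec := fun h => h.elim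
    sync_spec := fun h => h.elim
    first_unique := ?_
    up_unique := fun h => h.elim
    edges := ?_
    complete := fun h => h.elim
    sound := fun h => h.elim
    port_unique := ?_
    port_spec := ?_
    simple := hK.simple.rename_layer zero_lt_two
    half_no_port := hhp
    router_port := ?_
    port_top := fun _ _ _ h => h
    port_no_sync := fun _ _ _ _ => ⟨fun h => h, fun h => h⟩
    reach := ?_
    reach_sound := ?_ }⟩
  · intro x i
    refine mem_rename_proc.trans ((hhalf x _).trans (Iff.trans ?_ hproc.symm))
    simp
  · intro a
    rcases hcover a with h | ⟨t, ht, -, h⟩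
    · exact Or.inl h
    · exact Or.inr ⟨t, hisr ht h⟩
  · rintro x t a ⟨⟨ht, e⟩, h⟩
    exact ⟨hproc.2 e, hisr ht h⟩
  · rintro x t a b ⟨-, h⟩ ⟨-, h'⟩
    exact hK.simple.unique_vertex h h'
  · intro a δ b
    refine (hK.edges a δ b).trans ?_
    constructor
    · rintro (⟨u, v, -, -, h⟩ | ⟨p, p', h, ha, hb⟩)
      · exact h.elim
      · obtain ⟨t, ht, e, h⟩ := mem_attachEdges.1 h
        have haj : a = j () := by
          refine hK.simple.unique_vertex (π := halfPort π) ?_ ((hhalf _ _).2 (Or.inl rfl))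
          rcases h with h | h <;> cases h <;> exact ha
        refine Or.inl ⟨(), t, ⟨⟨ht, e⟩, ?_⟩, haj, ?_⟩
        · rcases h with h | h <;> cases h <;> exact hb
        · rcases h with h | h <;> cases h <;> simp
    · rintro (⟨x, t, ⟨⟨ht, e⟩, h⟩, rfl, hδ⟩ | ⟨t, h, -⟩ | ⟨t, t', h, -⟩)
      · refine Or.inr ⟨halfPort π, routerPort P 0 π t, mem_attachEdges.2 ⟨t, ht, e, ?_⟩,
          (hhalf _ _).2 (Or.inl rfl), h⟩
        rcases hδ with rfl | rfl <;> simp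
      · exact h.elim
      · exact h.elim
  · intro x ρ ρ' h h'
    exact (hport.1 h).trans (hport.1 h').symm
  · intro x ρ h
    obtain rfl := hport.1 h
    exact ⟨hproc.2 rfl, hQ⟩
  · intro t a p hr h
    obtain ⟨-, ρ, hρ, t', ht', e, rfl⟩ := mem_rename_keep.1 h
    have hpr := (hK.simple.rename_layer (P := P) (Q := Q) zero_lt_two).proc h
    obtain rfl := routerIndex_injective ht' hr.1 ((hr.2 _).1 hpr)
    exact ⟨ρ, hρ, e, rfl⟩
  · intro x ρ t h ht e
    obtain rfl := hport.1 h
    have he : ((tryT t, recvT P t), halfPort ρ, routerPort P 0 ρ t) ∈ attachEdges P ρ :=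
      mem_attachEdges.2 ⟨t, ht, e, Or.inl rfl⟩
    obtain ⟨-, a, ha⟩ := hK.ports _ he
    exact ⟨a, [], .single ⟨⟨ht, e⟩, ha⟩, List.nodup_singleton a,
      mem_rename_keep.2 ⟨ha, ρ, hQ, t, ht, e, rfl⟩⟩
  · intro x ρ t a l h ha e
    obtain ⟨⟨ht, e'⟩, h⟩ := hpath h
    have := hK.simple.unique_port (mem_rename_keep.1 ha).1 h
    exact hport.2 (routerPort_inj zero_lt_two zero_lt_two ht ht e e' this).2.1

/-! ### Networks of disjoint unions -/

theorem mem_union_edges_left {G₁ G₂ : LGraph} {x y : G₁.V} {δ : EdgeLabel} :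
    (Sum.inl x, δ, Sum.inl y) ∈ (LGraph.union G₁ G₂).edges ↔ (x, δ, y) ∈ G₁.edges := by
  constructor
  · rintro (⟨⟨u, d, v⟩, h, he⟩ | ⟨⟨u, d, v⟩, h, he⟩) <;> cases he
    exact h
  · exact fun h => Or.inl ⟨_, h, rfl⟩

theorem mem_union_edges_right {G₁ G₂ : LGraph} {x y : G₂.V} {δ : EdgeLabel} :
    (Sum.inr x, δ, Sum.inr y) ∈ (LGraph.union G₁ G₂).edges ↔ (x, δ, y) ∈ G₂.edges := by
  constructor
  · rintro (⟨⟨u, d, v⟩, h, he⟩ | ⟨⟨u, d, v⟩, h, he⟩) <;> cases he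
    exact h
  · exact fun h => Or.inr ⟨_, h, rfl⟩

theorem not_mem_union_edges {G₁ G₂ : LGraph} {x : G₁.V} {y : G₂.V} {δ : EdgeLabel} :
    (Sum.inl x, δ, Sum.inr y) ∉ (LGraph.union G₁ G₂).edges ∧
      (Sum.inr y, δ, Sum.inl x) ∉ (LGraph.union G₁ G₂).edges := by
  constructor <;> rintro (⟨⟨u, d, v⟩, h, he⟩ | ⟨⟨u, d, v⟩, h, he⟩) <;> cases he

/-- The network of a disjoint union. -/
theorem nonempty_portNetwork_union {P : List ProcType} {Q : List Port} {G₁ G₂ H₁ H₂ : LGraph}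
    (N₁ : PortNetwork P Q G₁ H₁) (N₂ : PortNetwork P Q G₂ H₂) :
    Nonempty (PortNetwork P Q (LGraph.union G₁ G₂) (LGraph.comp H₁ H₂)) := by
  have hs₁ := N₁.simple
  have hs₂ := N₂.simple
  set j₁ : H₁.V → (LGraph.comp H₁ H₂).V := LGraph.compLeft H₁ H₂ with hj₁
  set j₂ : H₂.V → (LGraph.comp H₁ H₂).V := LGraph.compRight H₁ H₂ with hj₂
  have hi₁ : Function.Injective j₁ := LGraph.compLeft_injective hs₁ hs₂
  have hi₂ : Function.Injective j₂ := LGraph.compRight_injective hs₁ hs₂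
  have hjoin : ∀ {v w}, j₁ v = j₂ w → ∃ p, Label.port p ∈ H₁.lab v ∧ Label.port p ∈ H₂.lab w :=
    fun h => (LGraph.compLeft_eq_compRight hs₁ hs₂).1 h
  -- Half processes have no ports, so joined vertices are routers. Their common port is the only
  -- port of either one, and it determines the process type.
  have hsame : ∀ {v w}, j₁ v = j₂ w → ∀ l, l ∈ H₁.lab v ↔ l ∈ H₂.lab w := by
    intro v w h l
    obtain ⟨p, hv, hw⟩ := hjoin h
    rcases N₁.vertex_cases v with ⟨x, rfl⟩ | ⟨t, ht⟩
    · exact absurd hv (N₁.half_no_port x p)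
    rcases N₂.vertex_cases w with ⟨x, rfl⟩ | ⟨t', ht'⟩
    · exact absurd hw (N₂.half_no_port x p)
    have e₁ := (ht.2 _).1 (hs₁.proc hv)
    have e₂ := (ht'.2 _).1 (hs₂.proc hw)
    cases l with
    | proc i => rw [ht.2, ht'.2, ← e₁, ← e₂]
    | port q =>
      constructor
      · intro hq
        rwa [hs₁.unique_port hq hv]
      · intro hq
        rwa [hs₂.unique_port hq hw]
  have hl₁ : ∀ v l, l ∈ (LGraph.comp H₁ H₂).lab (j₁ v) ↔ l ∈ H₁.lab v := by
    intro v l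
    rw [LGraph.mem_comp_lab]
    constructor
    · rintro (⟨v', h, hl⟩ | ⟨w, h, hl⟩)
      · rwa [hi₁ h]
      · exact (hsame h l).2 hl
    · exact fun hl => Or.inl ⟨v, rfl, hl⟩
  have hl₂ : ∀ v l, l ∈ (LGraph.comp H₁ H₂).lab (j₂ v) ↔ l ∈ H₂.lab v := by
    intro v l
    rw [LGraph.mem_comp_lab]
    constructor
    · rintro (⟨w, h, hl⟩ | ⟨v', h, hl⟩)
      · exact (hsame h.symm l).1 hl
      · rwa [hi₂ h]
    · exact fun hl => Or.inr ⟨v, rfl, hl⟩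
  have hr₁ : ∀ {t v}, IsRouter P H₁ t v → IsRouter P (LGraph.comp H₁ H₂) t (j₁ v) :=
    fun h => ⟨h.1, fun i => (hl₁ _ _).trans (h.2 i)⟩
  have hr₂ : ∀ {t v}, IsRouter P H₂ t v → IsRouter P (LGraph.comp H₁ H₂) t (j₂ v) :=
    fun h => ⟨h.1, fun i => (hl₂ _ _).trans (h.2 i)⟩
  have hr₁' : ∀ {t v}, IsRouter P (LGraph.comp H₁ H₂) t (j₁ v) → IsRouter P H₁ t v :=
    fun h => ⟨h.1, fun i => (hl₁ _ _).symm.trans (h.2 i)⟩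
  have hr₂' : ∀ {t v}, IsRouter P (LGraph.comp H₁ H₂) t (j₂ v) → IsRouter P H₂ t v :=
    fun h => ⟨h.1, fun i => (hl₂ _ _).symm.trans (h.2 i)⟩
  have hcases : ∀ a, (∃ v, a = j₁ v) ∨ ∃ w, a = j₂ w := LGraph.comp_cases
  let half : G₁.V ⊕ G₂.V → (LGraph.comp H₁ H₂).V := Sum.elim (j₁ ∘ N₁.half) (j₂ ∘ N₂.half)
  let first : G₁.V ⊕ G₂.V → PTrans → (LGraph.comp H₁ H₂).V → Prop :=
    Sum.elim (fun x t b => ∃ a, b = j₁ a ∧ N₁.first x t a)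
      (fun x t b => ∃ a, b = j₂ a ∧ N₂.first x t a)
  let up : PTrans → (LGraph.comp H₁ H₂).V → (LGraph.comp H₁ H₂).V → Prop := fun t a b =>
    (∃ u v, a = j₁ u ∧ b = j₁ v ∧ N₁.up t u v) ∨ ∃ u v, a = j₂ u ∧ b = j₂ v ∧ N₂.up t u v
  let sync : PTrans → PTrans → (LGraph.comp H₁ H₂).V → (LGraph.comp H₁ H₂).V → Prop :=
    fun t t' a b => (∃ u v, a = j₁ u ∧ b = j₁ v ∧ N₁.sync t t' u v) ∨
      ∃ u v, a = j₂ u ∧ b = j₂ v ∧ N₂.sync t t' u v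
  -- A path cannot change sides: only vertices with ports are shared, and these have no successor.
  have hup₁ : ∀ {t a b}, up t (j₁ a) b → ∃ b', b = j₁ b' ∧ N₁.up t a b' := by
    rintro t a b (⟨u, v, ha, rfl, h⟩ | ⟨u, v, ha, rfl, h⟩)
    · obtain rfl := hi₁ ha
      exact ⟨v, rfl, h⟩
    · obtain ⟨p, -, hp⟩ := hjoin ha
      exact absurd h (N₂.port_top hp t v)
  have hup₂ : ∀ {t a b}, up t (j₂ a) b → ∃ b', b = j₂ b' ∧ N₂.up t a b' := by
    rintro t a b (⟨u, v, ha, rfl, h⟩ | ⟨u, v, ha, rfl, h⟩)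
    · obtain ⟨p, hp, -⟩ := hjoin ha.symm
      exact absurd h (N₁.port_top hp t v)
    · obtain rfl := hi₂ ha
      exact ⟨v, rfl, h⟩
  have hpath₁ : ∀ {x t l}, RouterPath first up (Sum.inl x) t l →
      ∃ l', l = l'.map j₁ ∧ RouterPath N₁.first N₁.up x t l' :=
    fun h => RouterPath.exists_map j₁ (fun _ h => h) (fun _ _ h => hup₁ h) h
  have hpath₂ : ∀ {x t l}, RouterPath first up (Sum.inr x) t l →
      ∃ l', l = l'.map j₂ ∧ RouterPath N₂.first N₂.up x t l' :=
    fun h => RouterPath.exists_map j₂ (fun _ h => h) (fun _ _ h => hup₂ h) h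
  have hmap₁ : ∀ {x t l}, RouterPath N₁.first N₁.up x t l →
      RouterPath first up (Sum.inl x) t (l.map j₁) :=
    fun h => RouterPath.map j₁ (fun a h => ⟨a, rfl, h⟩)
      (fun a b h => Or.inl ⟨a, b, rfl, rfl, h⟩) h
  have hmap₂ : ∀ {x t l}, RouterPath N₂.first N₂.up x t l →
      RouterPath first up (Sum.inr x) t (l.map j₂) :=
    fun h => RouterPath.map j₂ (fun a h => ⟨a, rfl, h⟩)
      (fun a b h => Or.inr ⟨a, b, rfl, rfl, h⟩) h
  have hp₁ : ∀ {x t a l}, RouterPath first up (Sum.inl x) t (a :: l) →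
      ∃ a' l', a = j₁ a' ∧ RouterPath N₁.first N₁.up x t (a' :: l') := by
    intro x t a l h
    obtain ⟨_ | ⟨a', l'⟩, hl, h⟩ := hpath₁ h
    · cases hl
    · exact ⟨a', l', (List.cons.inj hl).1, h⟩
  have hp₂ : ∀ {x t a l}, RouterPath first up (Sum.inr x) t (a :: l) →
      ∃ a' l', a = j₂ a' ∧ RouterPath N₂.first N₂.up x t (a' :: l') := by
    intro x t a l h
    obtain ⟨_ | ⟨a', l'⟩, hl, h⟩ := hpath₂ h
    · cases hl
    · exact ⟨a', l', (List.cons.inj hl).1, h⟩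
  -- The ends of synchronization edges have no ports and are never joined, so no vertex of the other
  -- side acquires their edges.
  have hsync₁ : ∀ {t t' u v}, N₁.sync t t' u v → (∀ w, j₁ u ≠ j₂ w) ∧ ∀ w, j₁ v ≠ j₂ w := by
    refine fun h => ⟨fun w e => ?_, fun w e => ?_⟩
    · obtain ⟨p, hp, -⟩ := hjoin e
      exact (N₁.port_no_sync hp _ _ _).1 h
    · obtain ⟨p, hp, -⟩ := hjoin e
      exact (N₁.port_no_sync hp _ _ _).2 h
  have hsync₂ : ∀ {t t' u v}, N₂.sync t t' u v → (∀ w, j₂ u ≠ j₁ w) ∧ ∀ w, j₂ v ≠ j₁ w := by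
    refine fun h => ⟨fun w e => ?_, fun w e => ?_⟩
    · obtain ⟨p, -, hp⟩ := hjoin e.symm
      exact (N₂.port_no_sync hp _ _ _).1 h
    · obtain ⟨p, -, hp⟩ := hjoin e.symm
      exact (N₂.port_no_sync hp _ _ _).2 h
  refine ⟨{
    half := half
    first := first
    up := up
    sync := sync
    half_injective := ?_
    proc_spec := ?_
    proc_half := ?_
    vertex_cases := ?_
    first_spec := ?_
    up_spec := ?_
    sync_spec := ?_
    first_unique := ?_
    up_unique := ?_
    edges := ?_
    complete := ?_
    sound := ?_
    port_unique := ?_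
    port_spec := ?_
    simple := LGraph.portSimple_comp hs₁ hs₂
    half_no_port := ?_
    router_port := ?_
    port_top := ?_
    port_no_sync := ?_
    reach := ?_
    reach_sound := ?_ }⟩
  · rintro (x | x) (y | y) h
    · rw [N₁.half_injective (hi₁ h)]
    · obtain ⟨p, hp, -⟩ := hjoin h
      exact absurd hp (N₁.half_no_port x p)
    · obtain ⟨p, hp, -⟩ := hjoin h.symm
      exact absurd hp (N₁.half_no_port y p)
    · rw [N₂.half_injective (hi₂ h)]
  · rintro (x | x)
    exacts [N₁.proc_spec x, N₂.proc_spec x]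
  · rintro (x | x) i
    exacts [(hl₁ _ _).trans (N₁.proc_half x i), (hl₂ _ _).trans (N₂.proc_half x i)]
  · intro a
    rcases hcases a with ⟨v, rfl⟩ | ⟨v, rfl⟩
    · rcases N₁.vertex_cases v with ⟨x, rfl⟩ | ⟨t, ht⟩
      exacts [Or.inl ⟨Sum.inl x, rfl⟩, Or.inr ⟨t, hr₁ ht⟩]
    · rcases N₂.vertex_cases v with ⟨x, rfl⟩ | ⟨t, ht⟩
      exacts [Or.inl ⟨Sum.inr x, rfl⟩, Or.inr ⟨t, hr₂ ht⟩]
  · rintro (x | x) t _ ⟨a, rfl, h⟩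
    exacts [⟨(N₁.first_spec h).1, hr₁ (N₁.first_spec h).2⟩,
      ⟨(N₂.first_spec h).1, hr₂ (N₂.first_spec h).2⟩]
  · rintro t _ _ (⟨u, v, rfl, rfl, h⟩ | ⟨u, v, rfl, rfl, h⟩)
    · obtain ⟨h₁, h₂, h₃⟩ := N₁.up_spec h
      exact ⟨hr₁ h₁, hr₁ h₂, fun e => h₃ (hi₁ e)⟩
    · obtain ⟨h₁, h₂, h₃⟩ := N₂.up_spec h
      exact ⟨hr₂ h₁, hr₂ h₂, fun e => h₃ (hi₂ e)⟩
  · rintro t t' _ _ (⟨u, v, rfl, rfl, h⟩ | ⟨u, v, rfl, rfl, h⟩)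
    · obtain ⟨h₁, h₂, h₃⟩ := N₁.sync_spec h
      exact ⟨hr₁ h₁, hr₁ h₂, fun e => h₃ (hi₁ e)⟩
    · obtain ⟨h₁, h₂, h₃⟩ := N₂.sync_spec h
      exact ⟨hr₂ h₁, hr₂ h₂, fun e => h₃ (hi₂ e)⟩
  · rintro (x | x) t _ _ ⟨a, rfl, h⟩ ⟨b, rfl, h'⟩
    exacts [congrArg j₁ (N₁.first_unique h h'), congrArg j₂ (N₂.first_unique h h')]
  · rintro t a b c (⟨u, v, rfl, rfl, h⟩ | ⟨u, v, rfl, rfl, h⟩) h'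
    · obtain ⟨c, rfl, h''⟩ := hup₁ h'
      exact congrArg j₁ (N₁.up_unique h h'')
    · obtain ⟨c, rfl, h''⟩ := hup₂ h'
      exact congrArg j₂ (N₂.up_unique h h'')
  · intro a δ b
    rw [LGraph.mem_comp_edges]
    constructor
    · rintro (⟨u, v, rfl, rfl, h⟩ | ⟨u, v, rfl, rfl, h⟩)
      · rcases (N₁.edges _ _ _).1 h with ⟨x, t, h', rfl, hδ⟩ | ⟨t, h, hδ⟩ | ⟨t, t', h, hδ⟩
        · exact Or.inl ⟨Sum.inl x, t, ⟨v, rfl, h'⟩, rfl, hδ⟩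
        · exact Or.inr (Or.inl ⟨t, Or.inl ⟨u, v, rfl, rfl, h⟩, hδ⟩)
        · exact Or.inr (Or.inr ⟨t, t', Or.inl ⟨u, v, rfl, rfl, h⟩, hδ⟩)
      · rcases (N₂.edges _ _ _).1 h with ⟨x, t, h', rfl, hδ⟩ | ⟨t, h, hδ⟩ | ⟨t, t', h, hδ⟩
        · exact Or.inl ⟨Sum.inr x, t, ⟨v, rfl, h'⟩, rfl, hδ⟩
        · exact Or.inr (Or.inl ⟨t, Or.inr ⟨u, v, rfl, rfl, h⟩, hδ⟩)
        · exact Or.inr (Or.inr ⟨t, t', Or.inr ⟨u, v, rfl, rfl, h⟩, hδ⟩)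
    · rintro (⟨x | x, t, ⟨v, rfl, h⟩, rfl, hδ⟩ | ⟨t, ⟨u, v, rfl, rfl, h⟩ | ⟨u, v, rfl, rfl, h⟩, hδ⟩ |
        ⟨t, t', ⟨u, v, rfl, rfl, h⟩ | ⟨u, v, rfl, rfl, h⟩, hδ⟩)
      · exact Or.inl ⟨_, _, rfl, rfl, (N₁.edges _ _ _).2 (Or.inl ⟨x, t, h, rfl, hδ⟩)⟩
      · exact Or.inr ⟨_, _, rfl, rfl, (N₂.edges _ _ _).2 (Or.inl ⟨x, t, h, rfl, hδ⟩)⟩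
      · exact Or.inl ⟨_, _, rfl, rfl, (N₁.edges _ _ _).2 (Or.inr (Or.inl ⟨t, h, hδ⟩))⟩
      · exact Or.inr ⟨_, _, rfl, rfl, (N₂.edges _ _ _).2 (Or.inr (Or.inl ⟨t, h, hδ⟩))⟩
      · exact Or.inl ⟨_, _, rfl, rfl, (N₁.edges _ _ _).2 (Or.inr (Or.inr ⟨t, t', h, hδ⟩))⟩
      · exact Or.inr ⟨_, _, rfl, rfl, (N₂.edges _ _ _).2 (Or.inr (Or.inr ⟨t, t', h, hδ⟩))⟩
  · rintro (x | x) t t' (y | y) he ht ht' hx hy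
    · obtain ⟨a, l, b, l', h₁, h₂, h₃, h₄, h₅, h₆⟩ :=
        N₁.complete (mem_union_edges_left.1 he) ht ht' hx hy
      exact ⟨j₁ a, l.map j₁, j₁ b, l'.map j₁, Or.inl ⟨a, b, rfl, rfl, h₁⟩, hmap₁ h₂, hmap₁ h₃,
        h₄.map hi₁, h₅.map hi₁, List.disjoint_map hi₁ h₆⟩
    · exact absurd he not_mem_union_edges.1
    · exact absurd he not_mem_union_edges.2
    · obtain ⟨a, l, b, l', h₁, h₂, h₃, h₄, h₅, h₆⟩ :=
        N₂.complete (mem_union_edges_right.1 he) ht ht' hx hy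
      exact ⟨j₂ a, l.map j₂, j₂ b, l'.map j₂, Or.inr ⟨a, b, rfl, rfl, h₁⟩, hmap₂ h₂, hmap₂ h₃,
        h₄.map hi₂, h₅.map hi₂, List.disjoint_map hi₂ h₆⟩
  -- Paths from a vertex stay on its side, and a synchronization edge has no end that is shared with
  -- the other side; only the two unmixed cases survive.
  · rintro (x | x) t t' (y | y) a l b l' (⟨u, v, rfl, rfl, h⟩ | ⟨u, v, rfl, rfl, h⟩) h₁ h₂
    · obtain ⟨a', l₁, ha, h₁⟩ := hp₁ h₁
      obtain ⟨b', l₂, hb, h₂⟩ := hp₁ h₂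
      obtain rfl := hi₁ ha
      obtain rfl := hi₁ hb
      exact mem_union_edges_left.2 (N₁.sound h h₁ h₂)
    · obtain ⟨a', l₁, ha, h₁⟩ := hp₁ h₁
      exact absurd ha ((hsync₂ h).1 _)
    · obtain ⟨b', l₂, hb, h₂⟩ := hp₂ h₂
      exact absurd hb ((hsync₁ h).2 _)
    · obtain ⟨a', l₁, ha, h₁⟩ := hp₁ h₁
      exact absurd ha ((hsync₂ h).1 _)
    · obtain ⟨a', l₁, ha, h₁⟩ := hp₂ h₁
      exact absurd ha ((hsync₁ h).1 _)
    · obtain ⟨b', l₂, hb, h₂⟩ := hp₁ h₂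
      exact absurd hb ((hsync₂ h).2 _)
    · obtain ⟨a', l₁, ha, h₁⟩ := hp₂ h₁
      exact absurd ha ((hsync₁ h).1 _)
    · obtain ⟨a', l₁, ha, h₁⟩ := hp₂ h₁
      obtain ⟨b', l₂, hb, h₂⟩ := hp₂ h₂
      obtain rfl := hi₂ ha
      obtain rfl := hi₂ hb
      exact mem_union_edges_right.2 (N₂.sound h h₁ h₂)
  · rintro (x | x) π π' h h'
    exacts [N₁.port_unique h h', N₂.port_unique h h']
  · rintro (x | x) π h
    exacts [N₁.port_spec h, N₂.port_spec h]
  · rintro (x | x) p h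
    exacts [N₁.half_no_port x p ((hl₁ _ _).1 h), N₂.half_no_port x p ((hl₂ _ _).1 h)]
  · intro t a p hr h
    rcases hcases a with ⟨v, rfl⟩ | ⟨v, rfl⟩
    exacts [N₁.router_port (hr₁' hr) ((hl₁ _ _).1 h), N₂.router_port (hr₂' hr) ((hl₂ _ _).1 h)]
  · intro a p h t b hu
    rcases hcases a with ⟨v, rfl⟩ | ⟨v, rfl⟩
    · obtain ⟨b', -, hu⟩ := hup₁ hu
      exact N₁.port_top ((hl₁ _ _).1 h) _ _ hu
    · obtain ⟨b', -, hu⟩ := hup₂ hu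
      exact N₂.port_top ((hl₂ _ _).1 h) _ _ hu
  · intro a p h t t' b
    constructor
    · rintro (⟨u, v, rfl, rfl, h'⟩ | ⟨u, v, rfl, rfl, h'⟩)
      · exact (N₁.port_no_sync ((hl₁ _ _).1 h) _ _ _).1 h'
      · exact (N₂.port_no_sync ((hl₂ _ _).1 h) _ _ _).1 h'
    · rintro (⟨u, v, rfl, rfl, h'⟩ | ⟨u, v, rfl, rfl, h'⟩)
      · exact (N₁.port_no_sync ((hl₁ _ _).1 h) _ _ _).2 h'
      · exact (N₂.port_no_sync ((hl₂ _ _).1 h) _ _ _).2 h'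
  · rintro (x | x) π t h ht e
    · obtain ⟨a, l, h₁, h₂, h₃⟩ := N₁.reach h ht e
      exact ⟨j₁ a, l.map j₁, hmap₁ h₁, h₂.map hi₁, (hl₁ _ _).2 h₃⟩
    · obtain ⟨a, l, h₁, h₂, h₃⟩ := N₂.reach h ht e
      exact ⟨j₂ a, l.map j₂, hmap₂ h₁, h₂.map hi₂, (hl₂ _ _).2 h₃⟩
  · rintro (x | x) π t a l h hp e
    · obtain ⟨a', l', rfl, h'⟩ := hp₁ h
      exact N₁.reach_sound h' ((hl₁ _ _).1 hp) e
    · obtain ⟨a', l', rfl, h'⟩ := hp₂ h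
      exact N₂.reach_sound h' ((hl₂ _ _).1 hp) e

/-! ### Networks of edge creations and port redefinitions -/

theorem mem_forwardEdges {P : List ProcType} {α : List (Port × Port)} {e : PortEdge} :
    e ∈ forwardEdges P α ↔ ∃ π π' t, (π, π') ∈ α ∧ IsObs P t ∧ t.1 = π.1 ∧
      (e = ((fwdT P t, recvT P t), routerPort P 1 π t, routerPort P 0 π' t) ∨
        e = ((ackT P t, resetT P t), routerPort P 1 π t, routerPort P 0 π' t)) := by
  simp only [forwardEdges, List.mem_flatMap, mem_obsOf, List.mem_cons, List.not_mem_nil, or_false]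
  constructor
  · rintro ⟨⟨π, π'⟩, hα, t, ⟨ht, h⟩, he⟩
    exact ⟨π, π', t, hα, ht, h, he⟩
  · rintro ⟨π, π', t, hα, ht, h, he⟩
    exact ⟨⟨π, π'⟩, hα, t, ⟨ht, h⟩, he⟩

theorem mem_syncEdges {P : List ProcType} {δ : EdgeLabel} {π₁ π₂ : Port} {e : PortEdge} :
    e ∈ syncEdges P δ π₁ π₂ ↔ δ.1.1 = π₁.1 ∧ δ.2.1 = π₂.1 ∧
      e = ((syncT P δ.1, syncT P δ.2), routerPort P 1 π₁ δ.1, routerPort P 1 π₂ δ.2) := by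
  unfold syncEdges
  split_ifs with h
  · simp [h]
  · simp only [List.not_mem_nil, false_iff]
    exact fun h' => h ⟨h'.1, h'.2.1⟩

/-- The network of a graph `G'` that is obtained from `G` by adding edges between the vertices
with ports according to `D`, and redefining ports according to `α`. -/
theorem nonempty_portNetwork_layer {P : List ProcType} {Q : List Port} {G X : LGraph}
    (N : PortNetwork P Q G X) {edges' : Set (G.V × EdgeLabel × G.V)} {finE : edges'.Finite}
    {lab' : G.V → Set Label} {α : List (Port × Port)} {D : List PortEdge} {es : List PortEdge}
    (hα : ∀ π π', (π, π') ∈ α → π.1 = π'.1 ∧ π' ∈ Q)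
    (hα' : ∀ π π₁ π₂, (π, π₁) ∈ α → (π, π₂) ∈ α → π₁ = π₂)
    (hD : ∀ δ π₁ π₂, (δ, π₁, π₂) ∈ D → IsObs P δ.1 ∧ IsObs P δ.2 ∧ π₁ ≠ π₂)
    (hport : ∀ x π', Label.port π' ∈ lab' x ↔ ∃ π, Label.port π ∈ G.lab x ∧ (π, π') ∈ α)
    (hproc : ∀ x i, Label.proc i ∈ lab' x ↔ Label.proc i ∈ G.lab x)
    (hedges : ∀ x δ y, (x, δ, y) ∈ edges' ↔ (x, δ, y) ∈ G.edges ∨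
      ∃ π₁ π₂, (δ, π₁, π₂) ∈ D ∧ Label.port π₁ ∈ G.lab x ∧ Label.port π₂ ∈ G.lab y)
    (hes : ∀ e, e ∈ es ↔ (∃ δ π₁ π₂, (δ, π₁, π₂) ∈ D ∧ e ∈ syncEdges P δ π₁ π₂) ∨
      e ∈ forwardEdges P α)
    {K : LGraph} {j : X.V → K.V}
    (hK : IsGlue es (LGraph.rename (layerRenaming P Q 1) X) K j) :
    Nonempty (PortNetwork P Q ⟨G.V, G.finV, edges', finE, lab'⟩
      (LGraph.rename (layerRenaming P Q 0) K)) := by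
  have hKs := hK.simple
  have hlab : ∀ a : X.V, K.lab (j a) = (LGraph.rename (layerRenaming P Q 1) X).lab a := hK.lab
  have hprocj : ∀ a i, Label.proc i ∈ K.lab (j a) ↔ Label.proc i ∈ X.lab a := by
    intro a i
    rw [hlab]
    exact mem_rename_proc
  have hportj : ∀ {a p}, Label.port p ∈ K.lab (j a) → ∃ π ∈ Q, ∃ t, IsObs P t ∧ t.1 = π.1 ∧
      p = routerPort P 1 π t ∧ Label.port (routerPort P 0 π t) ∈ X.lab a := by
    intro a p h
    rw [hlab] at h
    obtain ⟨p', h₀, h'⟩ := mem_rename_port.1 h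
    obtain ⟨π, hπ, t, ht, e, rfl, rfl⟩ := mem_layerRenaming.1 h'
    exact ⟨π, hπ, t, ht, e, rfl, h₀⟩
  have hportj' : ∀ {a π t}, π ∈ Q → IsObs P t → t.1 = π.1 →
      Label.port (routerPort P 0 π t) ∈ X.lab a → Label.port (routerPort P 1 π t) ∈ K.lab (j a) := by
    intro a π t hπ ht e h
    rw [hlab]
    exact mem_rename_port.2 ⟨_, h, mem_layerRenaming.2 ⟨π, hπ, t, ht, e, rfl, rfl⟩⟩
  have hportj1 : ∀ {a π t}, IsObs P t → t.1 = π.1 →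
      Label.port (routerPort P 1 π t) ∈ K.lab (j a) →
        Label.port (routerPort P 0 π t) ∈ X.lab a := by
    intro a π t ht e h
    obtain ⟨π', -, t', ht', e', hp, h'⟩ := hportj h
    obtain ⟨-, rfl, rfl⟩ := routerPort_inj one_lt_two one_lt_two ht ht' e e' hp
    exact h'
  have hportj0 : ∀ {a π t}, Label.port (routerPort P 0 π t) ∉ K.lab (j a) := by
    intro a π t h
    obtain ⟨π', -, t', ht', e', hp, h'⟩ := hportj h
    exact routerPort_layer_ne hp
  -- A vertex has at most one port, so it cannot belong to both layers.
  have hlayer : ∀ {a π t π' t'}, Label.port (routerPort P 0 π t) ∈ K.lab a →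
      Label.port (routerPort P 1 π' t') ∉ K.lab a :=
    fun h h' => routerPort_layer_ne (hKs.unique_port h h')
  -- The new vertices are all routers, possibly for ports that no vertex carries.
  have hcover : ∀ a, (∃ v, a = j v) ∨ ∃ b < 2, ∃ π t, IsObs P t ∧ t.1 = π.1 ∧
      K.lab a = {Label.port (routerPort P b π t), Label.proc (routerIndex P t)} := by
    intro a
    rcases hK.cover a with h | ⟨e, he, p, hp, h⟩
    · exact Or.inl h
    · refine Or.inr ?_
      rcases (hes e).1 he with ⟨δ, π₁, π₂, hδ, he⟩ | he
      · obtain ⟨h₁, h₂⟩ := hD _ _ _ hδ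
        obtain ⟨e₁, e₂, rfl⟩ := mem_syncEdges.1 he
        rcases hp with rfl | rfl
        · exact ⟨1, one_lt_two, π₁, δ.1, h₁, e₁, h⟩
        · exact ⟨1, one_lt_two, π₂, δ.2, h₂.1, e₂, h⟩
      · obtain ⟨π, π', t, hπ, ht, e', he⟩ := mem_forwardEdges.1 he
        have hp' : p = routerPort P 1 π t ∨ p = routerPort P 0 π' t := by
          rcases he with rfl | rfl <;> exact hp
        rcases hp' with rfl | rfl
        · exact ⟨1, one_lt_two, π, t, ht, e', h⟩
        · exact ⟨0, zero_lt_two, π', t, ht, e'.trans (hα _ _ hπ).1, h⟩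
  have hrj : ∀ {t v}, IsRouter P X t v ↔ IsRouter P K t (j v) := by
    intro t v
    refine and_congr_right fun _ => forall_congr' fun i => ?_
    rw [hprocj]
  have hvert : ∀ a, (∃ x, a = j (N.half x)) ∨ ∃ t, IsRouter P K t a := by
    intro a
    rcases hcover a with ⟨v, rfl⟩ | ⟨b, -, π, t, ht, -, h⟩
    · rcases N.vertex_cases v with ⟨x, rfl⟩ | ⟨t, ht⟩
      · exact Or.inl ⟨x, rfl⟩
      · exact Or.inr ⟨t, hrj.1 ht⟩
    · exact Or.inr ⟨t, ht, fun i => by rw [h]; simp⟩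
  have hhalf : ∀ x p, Label.port p ∉ K.lab (j (N.half x)) := by
    intro x p h
    obtain ⟨π, -, t, -, -, -, h⟩ := hportj h
    exact N.half_no_port _ _ h
  have hrouter : ∀ {b π t a}, IsObs P t → Label.port (routerPort P b π t) ∈ K.lab a →
      IsRouter P K t a := by
    intro b π t a ht h
    rcases hvert a with ⟨x, rfl⟩ | ⟨t', ht'⟩
    · exact absurd h (hhalf x _)
    · have h' := (ht'.2 _).1 (hKs.proc h)
      obtain rfl := routerIndex_injective ht ht'.1 h'
      exact ht'
  let first : G.V → PTrans → K.V → Prop := fun x t b => ∃ a, b = j a ∧ N.first x t a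
  let up : PTrans → K.V → K.V → Prop := fun t a b =>
    (∃ u v, a = j u ∧ b = j v ∧ N.up t u v) ∨
      ∃ π π', (π, π') ∈ α ∧ IsObs P t ∧ t.1 = π.1 ∧
        Label.port (routerPort P 1 π t) ∈ K.lab a ∧ Label.port (routerPort P 0 π' t) ∈ K.lab b
  let sync : PTrans → PTrans → K.V → K.V → Prop := fun t t' a b =>
    (∃ u v, a = j u ∧ b = j v ∧ N.sync t t' u v) ∨
      ∃ π₁ π₂, ((t, t'), π₁, π₂) ∈ D ∧ t.1 = π₁.1 ∧ t'.1 = π₂.1 ∧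
        Label.port (routerPort P 1 π₁ t) ∈ K.lab a ∧ Label.port (routerPort P 1 π₂ t') ∈ K.lab b
  have hmap : ∀ {x t l}, RouterPath N.first N.up x t l → RouterPath first up x t (l.map j) :=
    fun h => RouterPath.map j (fun a h => ⟨a, rfl, h⟩)
      (fun a b h => Or.inl ⟨a, b, rfl, rfl, h⟩) h
  -- A path ends in the old network or at a new collecting router one step above it, from which
  -- nothing leads on. In the second case the forward edge started at a router with an old port,
  -- which by `reach_sound` is a port of `x`.
  have hpath : ∀ {x t l}, RouterPath first up x t l →
      (∃ a l', l = j a :: l' ∧ ∃ l'', RouterPath N.first N.up x t (a :: l'')) ∨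
      ∃ b l' π π', l = b :: l' ∧ Label.port π ∈ G.lab x ∧ (π, π') ∈ α ∧ IsObs P t ∧ t.1 = π.1 ∧
        Label.port (routerPort P 0 π' t) ∈ K.lab b := by
    intro x t l h
    induction h with
    | single h =>
      obtain ⟨a, rfl, h⟩ := h
      exact Or.inl ⟨a, [], rfl, [], .single h⟩
    | cons _ hu ih =>
      rcases ih with ⟨a, l', he, l'', hp⟩ | ⟨b, l', π, π', he, -, -, -, -, hb⟩
      · obtain ⟨rfl, rfl⟩ := List.cons.inj he
        rcases hu with ⟨u, v, hau, rfl, hu⟩ | ⟨π, π', hπ, ht, e, ha, hb⟩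
        · obtain rfl := hK.inj hau
          exact Or.inl ⟨v, _, rfl, _, .cons hp hu⟩
        · exact Or.inr ⟨_, _, π, π', rfl, N.reach_sound hp (hportj1 ht e ha) e, hπ, ht, e, hb⟩
      · obtain ⟨rfl, rfl⟩ := List.cons.inj he
        rcases hu with ⟨u, v, rfl, -, -⟩ | ⟨ρ, ρ', -, -, -, ha, -⟩
        · exact absurd hb hportj0
        · exact absurd ha (hlayer hb)
  have hpathj : ∀ {x t a l}, RouterPath first up x t (a :: l) →
      (∀ π, Label.port (routerPort P 0 π t) ∉ K.lab a) →
      ∃ u l', a = j u ∧ RouterPath N.first N.up x t (u :: l') := by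
    intro x t a l h ha
    rcases hpath h with ⟨u, l', he, l'', h'⟩ | ⟨b, l', π, π', he, -, -, -, -, hb⟩
    · exact ⟨u, l'', (List.cons.inj he).1, h'⟩
    · rw [← (List.cons.inj he).1] at hb
      exact absurd hb (ha _)
  refine ⟨{
    half := fun x => j (N.half x)
    first := first
    up := up
    sync := sync
    half_injective := hK.inj.comp N.half_injective
    proc_spec := ?_
    proc_half := ?_
    vertex_cases := ?_
    first_spec := ?_
    up_spec := ?_
    sync_spec := ?_
    first_unique := ?_
    up_unique := ?_
    edges := ?_
    complete := ?_
    sound := ?_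
    port_unique := ?_
    port_spec := ?_
    simple := hKs.rename_layer zero_lt_two
    half_no_port := ?_
    router_port := ?_
    port_top := ?_
    port_no_sync := ?_
    reach := ?_
    reach_sound := ?_ }⟩
  · intro x
    obtain ⟨i, hi, h⟩ := N.proc_spec x
    exact ⟨i, hi, fun k => (hproc x k).trans (h k)⟩
  · intro x i
    exact mem_rename_proc.trans ((hprocj _ _).trans ((N.proc_half x i).trans (hproc x i).symm))
  · intro a
    rcases hvert a with h | ⟨t, ht⟩
    · exact Or.inl h
    · exact Or.inr ⟨t, isRouter_rename.2 ht⟩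
  · rintro x t _ ⟨a, rfl, h⟩
    obtain ⟨h₁, h₂⟩ := N.first_spec h
    exact ⟨(hproc _ _).2 h₁, isRouter_rename.2 (hrj.1 h₂)⟩
  · rintro t a b (⟨u, v, rfl, rfl, h⟩ | ⟨π, π', hπ, ht, e, ha, hb⟩)
    · obtain ⟨h₁, h₂, h₃⟩ := N.up_spec h
      exact ⟨isRouter_rename.2 (hrj.1 h₁), isRouter_rename.2 (hrj.1 h₂), fun e => h₃ (hK.inj e)⟩
    · refine ⟨isRouter_rename.2 (hrouter ht ha), isRouter_rename.2 (hrouter ht hb), ?_⟩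
      rintro rfl
      exact hlayer hb ha
  · rintro t t' a b (⟨u, v, rfl, rfl, h⟩ | ⟨π₁, π₂, hπ, e₁, e₂, ha, hb⟩)
    · obtain ⟨h₁, h₂, h₃⟩ := N.sync_spec h
      exact ⟨isRouter_rename.2 (hrj.1 h₁), isRouter_rename.2 (hrj.1 h₂), fun e => h₃ (hK.inj e)⟩
    · obtain ⟨ht, ht', hne⟩ := hD _ _ _ hπ
      refine ⟨isRouter_rename.2 (hrouter ht ha), isRouter_rename.2 (hrouter ht' hb), ?_⟩
      rintro rfl
      exact hne (routerPort_inj one_lt_two one_lt_two ht ht' e₁ e₂ (hKs.unique_port ha hb)).2.1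
  · rintro x t _ _ ⟨a, rfl, h⟩ ⟨b, rfl, h'⟩
    exact congrArg j (N.first_unique h h')
  -- A forward edge leaves a router that had a port in `X` and so no old successor; this settles the
  -- mixed cases. Two forward edges agree because `α` is a function.
  · rintro t a b c (⟨u, v, rfl, rfl, h⟩ | ⟨π, π', hπ, ht, e, ha, hb⟩)
      (⟨u', v', hu, rfl, h'⟩ | ⟨ρ, ρ', hρ, ht', e', ha', hb'⟩)
    · obtain rfl := hK.inj hu
      exact congrArg j (N.up_unique h h')
    · exact absurd h (N.port_top (hportj1 ht' e' ha') _ _)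
    · rw [hu] at ha
      exact absurd h' (N.port_top (hportj1 ht e ha) _ _)
    · obtain ⟨-, rfl, -⟩ := routerPort_inj one_lt_two one_lt_two ht ht' e e'
        (hKs.unique_port ha ha')
      obtain rfl := hα' _ _ _ hπ hρ
      exact hKs.unique_vertex hb hb'
  · intro a δ b
    refine (hK.edges a δ b).trans ?_
    constructor
    · rintro (⟨u, v, rfl, rfl, h⟩ | ⟨p, p', h, ha, hb⟩)
      · rcases (N.edges _ _ _).1 h with
          ⟨x, t, h', rfl, hδ⟩ | ⟨t, h', hδ⟩ | ⟨t, t', h', hδ⟩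
        · exact Or.inl ⟨x, t, ⟨v, rfl, h'⟩, rfl, hδ⟩
        · exact Or.inr (Or.inl ⟨t, Or.inl ⟨u, v, rfl, rfl, h'⟩, hδ⟩)
        · exact Or.inr (Or.inr ⟨t, t', Or.inl ⟨u, v, rfl, rfl, h'⟩, hδ⟩)
      · rcases (hes _).1 h with ⟨δ', π₁, π₂, hδ', he⟩ | he
        · obtain ⟨e₁, e₂, he⟩ := mem_syncEdges.1 he
          cases he
          exact Or.inr (Or.inr ⟨δ'.1, δ'.2, Or.inr ⟨π₁, π₂, hδ', e₁, e₂, ha, hb⟩, rfl⟩)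
        · obtain ⟨π, π', t, hπ, ht, e', he⟩ := mem_forwardEdges.1 he
          refine Or.inr (Or.inl ⟨t, Or.inr ⟨π, π', hπ, ht, e', ?_, ?_⟩, ?_⟩)
          · rcases he with he | he <;> cases he <;> exact ha
          · rcases he with he | he <;> cases he <;> exact hb
          · rcases he with he | he <;> cases he <;> simp
    · rintro (⟨x, t, ⟨v, rfl, h⟩, rfl, hδ⟩ | ⟨t, ⟨u, v, rfl, rfl, h⟩ | ⟨π, π', hπ, ht, e, ha, hb⟩, hδ⟩ |
        ⟨t, t', ⟨u, v, rfl, rfl, h⟩ | ⟨π₁, π₂, hπ, e₁, e₂, ha, hb⟩, rfl⟩)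
      · exact Or.inl ⟨_, _, rfl, rfl, (N.edges _ _ _).2 (Or.inl ⟨x, t, h, rfl, hδ⟩)⟩
      · exact Or.inl ⟨_, _, rfl, rfl, (N.edges _ _ _).2 (Or.inr (Or.inl ⟨t, h, hδ⟩))⟩
      · refine Or.inr ⟨_, _, (hes _).2 (Or.inr (mem_forwardEdges.2
          ⟨π, π', t, hπ, ht, e, ?_⟩)), ha, hb⟩
        rcases hδ with rfl | rfl <;> simp
      · exact Or.inl ⟨_, _, rfl, rfl, (N.edges _ _ _).2 (Or.inr (Or.inr ⟨t, t', h, rfl⟩))⟩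
      · exact Or.inr ⟨_, _, (hes _).2 (Or.inl ⟨_, π₁, π₂, hπ, mem_syncEdges.2 ⟨e₁, e₂, rfl⟩⟩),
          ha, hb⟩
  · intro x t t' y he ht ht' hx hy
    rcases (hedges _ _ _).1 he with he | ⟨π₁, π₂, hπ, hπ₁, hπ₂⟩
    · obtain ⟨a, l, b, l', h₁, h₂, h₃, h₄, h₅, h₆⟩ :=
        N.complete he ht ht' ((hproc _ _).1 hx) ((hproc _ _).1 hy)
      exact ⟨j a, l.map j, j b, l'.map j, Or.inl ⟨a, b, rfl, rfl, h₁⟩, hmap h₂, hmap h₃,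
        h₄.map hK.inj, h₅.map hK.inj, List.disjoint_map hK.inj h₆⟩
    · have htype : ∀ {z i k}, Label.proc i ∈ G.lab z → Label.proc k ∈ G.lab z → i = k := by
        intro z i k hi hk
        obtain ⟨m, -, hm⟩ := N.proc_spec z
        exact ((hm _).1 hi).trans ((hm _).1 hk).symm
      obtain ⟨hp₁, hQ₁⟩ := N.port_spec hπ₁
      obtain ⟨hp₂, hQ₂⟩ := N.port_spec hπ₂
      have e₁ : t.1 = π₁.1 := htype ((hproc _ _).1 hx) hp₁
      have e₂ : t'.1 = π₂.1 := htype ((hproc _ _).1 hy) hp₂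
      obtain ⟨a, l, h₁, h₂, h₃⟩ := N.reach hπ₁ ht e₁
      obtain ⟨b, l', h₄, h₅, h₆⟩ := N.reach hπ₂ ht' e₂
      refine ⟨j a, l.map j, j b, l'.map j, Or.inr ⟨π₁, π₂, hπ, e₁, e₂, hportj' hQ₁ ht e₁ h₃,
        hportj' hQ₂ ht' e₂ h₆⟩, hmap h₁, hmap h₄, h₂.map hK.inj, h₅.map hK.inj, ?_⟩
      -- Paths that meet have the same head, which would then carry the router ports of two
      -- different classes.
      refine List.disjoint_map (s := a :: l) (t := b :: l') hK.inj fun c hc hc' => ?_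
      obtain rfl := Network.Path.top_unique (N := N.toNetwork) h₁ h₄ (N.port_top h₃)
        (N.port_top h₆) hc hc'
      exact (hD _ _ _ hπ).2.2 (routerPort_inj zero_lt_two zero_lt_two ht ht' e₁ e₂
        (N.simple.unique_port h₃ h₆)).2.1
  · rintro x t t' y a l b l' (⟨u, v, rfl, rfl, h⟩ | ⟨π₁, π₂, hπ, e₁, e₂, ha, hb⟩) h₁ h₂
    · obtain ⟨u', l₁, hu, h₁⟩ := hpathj h₁ fun _ => hportj0
      obtain ⟨v', l₂, hv, h₂⟩ := hpathj h₂ fun _ => hportj0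
      obtain rfl := hK.inj hu
      obtain rfl := hK.inj hv
      exact (hedges _ _ _).2 (Or.inl (N.sound h h₁ h₂))
    -- The ends of a new synchronization edge have layer-`1` ports, so the paths end within the old
    -- network and their starting vertices have the ports `π₁` and `π₂`.
    · obtain ⟨ht, ht', -⟩ := hD _ _ _ hπ
      obtain ⟨u, l₁, rfl, h₁'⟩ := hpathj h₁ fun _ h => hlayer h ha
      obtain ⟨v, l₂, rfl, h₂'⟩ := hpathj h₂ fun _ h => hlayer h hb
      exact (hedges _ _ _).2 (Or.inr ⟨π₁, π₂, hπ, N.reach_sound h₁' (hportj1 ht e₁ ha) e₁,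
        N.reach_sound h₂' (hportj1 ht' e₂ hb) e₂⟩)
  · intro x π π' h h'
    obtain ⟨ρ, h₁, h₂⟩ := (hport _ _).1 h
    obtain ⟨ρ', h₃, h₄⟩ := (hport _ _).1 h'
    obtain rfl := N.port_unique h₁ h₃
    exact hα' _ _ _ h₂ h₄
  · intro x π h
    obtain ⟨ρ, h₁, h₂⟩ := (hport _ _).1 h
    obtain ⟨h₃, h₄⟩ := hα _ _ h₂
    exact ⟨(hproc _ _).2 (h₃ ▸ (N.port_spec h₁).1), h₄⟩
  · intro x p h
    exact hhalf x p (mem_rename_keep.1 h).1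
  · intro t a p hr h
    obtain ⟨h, ρ, hρ, t', ht', e, rfl⟩ := mem_rename_keep.1 h
    obtain rfl := Network.isRouter_unique (hrouter ht' h) (isRouter_rename.1 hr)
    exact ⟨ρ, hρ, e, rfl⟩
  · intro a p h t b hu
    obtain ⟨h, ρ, hρ, t', ht', e, rfl⟩ := mem_rename_keep.1 h
    rcases hu with ⟨u, v, rfl, -, -⟩ | ⟨π, π', -, -, -, ha, -⟩
    · exact hportj0 h
    · exact hlayer h ha
  · intro a p h t t' b
    obtain ⟨h, ρ, hρ, t', ht', e, rfl⟩ := mem_rename_keep.1 h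
    constructor
    · rintro (⟨u, v, rfl, -, -⟩ | ⟨π₁, π₂, -, -, -, ha, -⟩)
      · exact hportj0 h
      · exact hlayer h ha
    · rintro (⟨u, v, -, rfl, -⟩ | ⟨π₁, π₂, -, -, -, -, ha⟩)
      · exact hportj0 h
      · exact hlayer h ha
  · intro x π' t h ht e
    obtain ⟨π, h, hπ⟩ := (hport _ _).1 h
    obtain ⟨e', hQ⟩ := hα _ _ hπ
    have e'' : t.1 = π.1 := e.trans e'.symm
    obtain ⟨a, l, h₁, h₂, h₃⟩ := N.reach h ht e''
    have he : ((fwdT P t, recvT P t), routerPort P 1 π t, routerPort P 0 π' t) ∈ es :=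
      (hes _).2 (Or.inr (mem_forwardEdges.2 ⟨π, π', t, hπ, ht, e'', Or.inl rfl⟩))
    obtain ⟨-, b, hb⟩ := hK.ports _ he
    refine ⟨b, (a :: l).map j, .cons (hmap h₁) (Or.inr ⟨π, π', hπ, ht, e'',
      hportj' (N.port_spec h).2 ht e'' h₃, hb⟩), ?_, mem_rename_keep.2 ⟨hb, π', hQ, t, ht, e, rfl⟩⟩
    -- The new head has a port of layer `0`, unlike any embedded vertex.
    refine List.nodup_cons.2 ⟨fun hm => ?_, h₂.map hK.inj⟩
    obtain ⟨u, -, rfl⟩ := List.mem_map.1 hm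
    exact hportj0 hb
  · intro x π' t a l h ha e
    obtain ⟨ha, -⟩ := mem_rename_keep.1 ha
    rcases hpath h with ⟨u, l', he, -⟩ | ⟨b, l', π, ρ, he, hπ, hα₁, ht, e', hb⟩
    · obtain ⟨rfl, -⟩ := List.cons.inj he
      exact absurd ha hportj0
    · obtain ⟨rfl, rfl⟩ := List.cons.inj he
      have := hKs.unique_port ha hb
      obtain ⟨-, rfl, -⟩ := routerPort_inj zero_lt_two zero_lt_two ht ht e
        (e'.trans (hα _ _ hα₁).1) this
      exact (hport _ _).2 ⟨π, hπ, hα₁⟩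

/-! ### Induction on VR terms -/

/-- The operations of a VR term are over `P`, and the ports they produce belong to `Q`. -/
def PortsIn (P : List ProcType) (Q : List Port) (t : VRTerm) : Prop :=
  t.AllOps (fun π => IsPort P π ∧ π ∈ Q)
    (fun b => b.OK P ∧ ∀ α, b = VRUnary.rename α → ∀ r ∈ α, r.2 ∈ Q)

theorem mem_layerEdges_addEdge {P : List ProcType} {Q : List Port} {δ : EdgeLabel} {π₁ π₂ : Port}
    {e : PortEdge} : e ∈ layerEdges P Q (VRUnary.addEdge δ π₁ π₂) ↔
      e ∈ syncEdges P δ π₁ π₂ ∨ e ∈ forwardEdges P (Q.map fun π => (π, π)) :=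
  List.mem_append

/-- The edges with which vertices and routers are glued together connect different ports. -/
theorem attachEdges_ends_ne {P : List ProcType} {π : Port} (hπ : IsPort P π) :
    ∀ e ∈ attachEdges P π, e.2.1 ≠ e.2.2 := by
  intro e he h
  obtain ⟨t, ht, -, he⟩ := mem_attachEdges.1 he
  have := le_routerIndex P t
  have hlt : π.1 < P.length := hπ
  rcases he with rfl | rfl <;>
  · have h' : π.1 = routerIndex P t := (Prod.mk.inj h).1
    omega

theorem forwardEdges_ends_ne {P : List ProcType} {α : List (Port × Port)} :
    ∀ e ∈ forwardEdges P α, e.2.1 ≠ e.2.2 := by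
  intro e he h
  obtain ⟨π, π', t, -, -, -, he⟩ := mem_forwardEdges.1 he
  rcases he with rfl | rfl <;> exact routerPort_layer_ne h.symm

theorem syncEdges_ends_ne {P : List ProcType} {δ : EdgeLabel} {π₁ π₂ : Port}
    (h : EdgeOK P δ π₁ π₂) : ∀ e ∈ syncEdges P δ π₁ π₂, e.2.1 ≠ e.2.2 := by
  intro e he h'
  obtain ⟨e₁, e₂, rfl⟩ := mem_syncEdges.1 he
  exact h.2.2.2.2 (routerPort_inj one_lt_two one_lt_two h.1 h.2.1 e₁ e₂ h').2.1

theorem layerEdges_ends_ne {P : List ProcType} {Q : List Port} {b : VRUnary} (hb : b.OK P) :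
    ∀ e ∈ layerEdges P Q b, e.2.1 ≠ e.2.2 := by
  cases b with
  | addEdge δ π₁ π₂ =>
    intro e he
    rcases mem_layerEdges_addEdge.1 he with he | he
    · exact syncEdges_ends_ne hb e he
    · exact forwardEdges_ends_ne e he
  | rename α => exact forwardEdges_ends_ne

/-- The value of the translation of a ground term is a network of the value of the term. -/
theorem nonempty_portNetwork_val {P : List ProcType} {Q : List Port} {θ : VRTerm}
    (hg : θ.Ground) (hθ : PortsIn P Q θ) :
    Nonempty (PortNetwork P Q (algVR.val θ) (algHR.val (translateTerm P Q θ))) := by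
  induction θ with
  | var X => exact hg.elim
  | const π =>
    obtain ⟨hP, hQ⟩ := hθ
    obtain ⟨j, hj⟩ := exists_isGlue (attachEdges_ends_ne hP)
      (t := Term.const (HRConst.vertex (halfPort π))) (portSimple_vertex (halfPort π))
    exact nonempty_portNetwork_vertex hP hQ hj
  | bin t₁ t₂ ih₁ ih₂ =>
    obtain ⟨N₁⟩ := ih₁ hg.1 hθ.1
    obtain ⟨N₂⟩ := ih₂ hg.2 hθ.2
    exact nonempty_portNetwork_union N₁ N₂
  | un b t ih =>
    obtain ⟨⟨hb, hbQ⟩, ht⟩ := hθ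
    obtain ⟨N⟩ := ih hg ht
    obtain ⟨j, hj⟩ := exists_isGlue (layerEdges_ends_ne (Q := Q) hb)
      (t := Term.un (layerRenaming P Q 1) (translateTerm P Q t)) (N.simple.rename_layer one_lt_two)
    cases b with
    | addEdge δ π₁ π₂ =>
      -- Edge creation is a layer with one edge pattern and the identity on `Q`, which moves no port
      -- because all ports of the graph lie in `Q`; a port redefinition is a layer without patterns.
      refine nonempty_portNetwork_layer N (α := Q.map fun π => (π, π)) (D := [(δ, π₁, π₂)])
        ?_ ?_ ?_ ?_ (fun _ _ => Iff.rfl) ?_ ?_ hj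
      · intro π π' h
        obtain ⟨ρ, hρ, he⟩ := List.mem_map.1 h
        cases he
        exact ⟨rfl, hρ⟩
      · intro π ρ₁ ρ₂ h₁ h₂
        obtain ⟨ρ, hρ, he⟩ := List.mem_map.1 h₁
        obtain ⟨ρ', hρ', he'⟩ := List.mem_map.1 h₂
        cases he
        cases he'
        rfl
      · intro δ' ρ₁ ρ₂ h
        cases List.mem_singleton.1 h
        exact ⟨hb.1, hb.2.1, hb.2.2.2.2⟩
      · intro x π'
        constructor
        · intro h
          exact ⟨π', h, List.mem_map.2 ⟨π', (N.port_spec h).2, rfl⟩⟩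
        · rintro ⟨π, h, hm⟩
          obtain ⟨ρ, hρ, he⟩ := List.mem_map.1 hm
          cases he
          exact h
      · intro x δ' y
        refine or_congr_right ?_
        constructor
        · rintro ⟨h₁, rfl, h₂⟩
          exact ⟨π₁, π₂, List.mem_singleton_self _, h₁, h₂⟩
        · rintro ⟨ρ₁, ρ₂, h, h₁, h₂⟩
          cases List.mem_singleton.1 h
          exact ⟨h₁, rfl, h₂⟩
      · intro e
        rw [mem_layerEdges_addEdge]
        refine or_congr_left ?_
        constructor
        · exact fun h => ⟨δ, π₁, π₂, List.mem_singleton_self _, h⟩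
        · rintro ⟨δ', ρ₁, ρ₂, h, he⟩
          cases List.mem_singleton.1 h
          exact he
    | rename α =>
      refine nonempty_portNetwork_layer N (α := α) (D := []) (fun π π' h =>
        ⟨(hb.1 _ _ h).2, hbQ α rfl _ h⟩) hb.2 (by simp) (fun x π' => mem_rename_port)
        (fun x i => mem_rename_proc) (fun x δ y => ?_) (fun e => ?_) hj
      · simp only [List.not_mem_nil, false_and, exists_false, or_false]
      · simp only [List.not_mem_nil, false_and, exists_false, false_or]
        exact Iff.rfl

/-! ### Networks without ports are systems -/

namespace Network

variable {P : List ProcType} {G H : LGraph}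

/-- Ports do not matter for networks. -/
def rename (N : Network P G H) (α : List (Port × Port)) : Network P G (LGraph.rename α H) where
  half := N.half
  first := N.first
  up := N.up
  sync := N.sync
  half_injective := N.half_injective
  proc_spec := N.proc_spec
  proc_half x i := mem_rename_proc.trans (N.proc_half x i)
  vertex_cases a := (N.vertex_cases a).imp_right fun ⟨t, ht⟩ => ⟨t, isRouter_rename.2 ht⟩
  first_spec h := ⟨(N.first_spec h).1, isRouter_rename.2 (N.first_spec h).2⟩
  up_spec h := ⟨isRouter_rename.2 (N.up_spec h).1, isRouter_rename.2 (N.up_spec h).2.1,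
    (N.up_spec h).2.2⟩
  sync_spec h := ⟨isRouter_rename.2 (N.sync_spec h).1, isRouter_rename.2 (N.sync_spec h).2.1,
    (N.sync_spec h).2.2⟩
  first_unique := N.first_unique
  up_unique := N.up_unique
  edges := N.edges
  complete := N.complete
  sound := N.sound

/-- Loops are excluded by the inequalities in `up_spec` and `sync_spec`, and at the edges to entry
routers because a half process is not a router. -/
theorem isSystem (N : Network P G H) (hH : ∀ a π, Label.port π ∉ H.lab a) :
    IsSystem (expandTypes P) H := by
  have hlen : P.length ≤ (expandTypes P).length := by simp [expandTypes]
  have hlab : ∀ {a k}, (∀ i, Label.proc i ∈ H.lab a ↔ i = k) → H.lab a = {Label.proc k} := by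
    intro a k h
    ext l
    cases l with
    | proc i => simpa using h i
    | port π => simpa using hH a π
  constructor
  · intro a
    rcases N.vertex_cases a with ⟨x, rfl⟩ | ⟨t, ht⟩
    · obtain ⟨i, hi, h⟩ := N.proc_spec x
      exact ⟨i, hi.trans_le hlen, hlab fun k => (N.proc_half x k).trans (h k)⟩
    · exact ⟨_, routerIndex_lt ht.1, hlab ht.2⟩
  · intro a δ b h
    rcases (N.edges a δ b).1 h with ⟨x, t, hx, rfl, hδ⟩ | ⟨t, ht, hδ⟩ | ⟨t, t', ht, rfl⟩
    · obtain ⟨h₁, h₂⟩ := N.first_spec hx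
      refine ⟨fun e => N.not_isRouter_half x t (e ▸ h₂), ?_⟩
      have h₃ := (N.proc_half x _).2 h₁
      have h₄ := (h₂.2 _).2 rfl
      obtain ⟨q, q', hq, hq'⟩ := exists_obsPre_obsPost h₂.1
      rcases hδ with rfl | rfl
      · exact ⟨isObs_of_obsPre ((half_obs_try h₂.1).1.trans hq), h₃,
          isObs_of_obsPre (obs_recvT h₂.1).1, h₄⟩
      · exact ⟨isObs_of_obsPre (half_obs_commit h₂.1).1, h₃,
          isObs_of_obsPre (obs_resetT h₂.1).1, h₄⟩
    · obtain ⟨h₁, h₂, h₃⟩ := N.up_spec ht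
      have h₄ := (h₁.2 _).2 rfl
      have h₅ := (h₂.2 _).2 rfl
      refine ⟨h₃, ?_⟩
      rcases hδ with rfl | rfl
      · exact ⟨isObs_of_obsPre (obs_fwdT h₁.1).1, h₄, isObs_of_obsPre (obs_recvT h₁.1).1, h₅⟩
      · exact ⟨isObs_of_obsPre (obs_ackT h₁.1).1, h₄, isObs_of_obsPre (obs_resetT h₁.1).1, h₅⟩
    · obtain ⟨h₁, h₂, h₃⟩ := N.sync_spec ht
      exact ⟨h₃, isObs_of_obsPre (obs_syncT h₁.1).1, (h₁.2 _).2 rfl,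
        isObs_of_obsPre (obs_syncT h₂.1).1, (h₂.2 _).2 rfl⟩

end Network

/-! ### Properties of grammars -/

theorem Grammar.Step.allOps {A B : Type} {p : A → Prop} {q : B → Prop} {Γ : Grammar A B}
    (hΓ : ∀ r ∈ Γ.rules, r.2.AllOps p q) {s t : Term A B} (h : Γ.Step s t) (hs : s.AllOps p q) :
    t.AllOps p q := by
  induction h with
  | root h => exact hΓ _ h
  | un _ ih => exact ⟨hs.1, ih hs.2⟩
  | left _ ih => exact ⟨ih hs.1, hs.2⟩
  | right _ ih => exact ⟨hs.1, ih hs.2⟩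

theorem portsIn_of_letterPorts {P : List ProcType} {Q : List Port} {t : VRTerm}
    (ht : t.AllOps (IsPort P) (VRUnary.OK P)) (h : ∀ l ∈ t.code, ∀ π ∈ letterPorts l, π ∈ Q) :
    PortsIn P Q t := by
  induction t with
  | var X => trivial
  | const π => exact ⟨ht, h _ (List.mem_singleton_self _) π (List.mem_singleton_self _)⟩
  | un b t ih =>
    refine ⟨⟨ht.1, ?_⟩, ih ht.2 fun l hl => h l (List.mem_cons_of_mem _ hl)⟩
    rintro α rfl r hr
    exact h _ List.mem_cons_self _ (List.mem_map_of_mem hr)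
  | bin t₁ t₂ ih₁ ih₂ =>
    exact ⟨ih₁ ht.1 fun l hl => h l (List.mem_cons_of_mem _ (List.mem_append_left _ hl)),
      ih₂ ht.2 fun l hl => h l (List.mem_cons_of_mem _ (List.mem_append_right _ hl))⟩

theorem VRGrammar.WF.portsIn {P : List ProcType} {Γ : VRGrammar} (hΓ : VRGrammar.WF P Γ) :
    ∀ r ∈ Γ.rules, PortsIn P (rulePorts Γ.code.2) r.2 := by
  intro r hr
  refine portsIn_of_letterPorts (hΓ r hr) fun l hl π hπ => ?_
  exact List.mem_flatMap.2 ⟨_, List.mem_map_of_mem hr, List.mem_flatMap.2 ⟨l, hl, hπ⟩⟩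

theorem VRGrammar.WF.portsIn_derived {P : List ProcType} {Γ : VRGrammar}
    (hΓ : VRGrammar.WF P Γ) {X : ℕ} {θ : VRTerm}
    (h : Relation.ReflTransGen Γ.Step (Term.var X) θ) : PortsIn P (rulePorts Γ.code.2) θ := by
  induction h with
  | refl => trivial
  | tail _ h ih => exact h.allOps hΓ.portsIn ih

/-- A VR redefinition may merge ports, which HR forbids. Only these changes of layer are HR
redefinitions; the merging itself is done by forward edges with a common target. -/
theorem injRenamingOK_layerRenaming {P : List ProcType} (Q : List Port) {b : ℕ} (hb : b < 2) :
    InjRenamingOK (expandTypes P) (layerRenaming P Q b) := by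
  refine ⟨⟨fun p p' h => ?_, fun p p₁ p₂ h h' => ?_⟩, fun p₁ p₂ p h h' => ?_⟩
  · obtain ⟨π, -, t, ht, -, rfl, rfl⟩ := mem_layerRenaming.1 h
    exact ⟨routerIndex_lt ht, rfl⟩
  · obtain ⟨π, -, t, ht, e, rfl, rfl⟩ := mem_layerRenaming.1 h
    obtain ⟨π', -, t', ht', e', he, rfl⟩ := mem_layerRenaming.1 h'
    obtain ⟨-, rfl, rfl⟩ := routerPort_inj zero_lt_two zero_lt_two ht ht' e e' he
    rfl
  · obtain ⟨π, -, t, ht, e, rfl, rfl⟩ := mem_layerRenaming.1 h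
    obtain ⟨π', -, t', ht', e', rfl, he⟩ := mem_layerRenaming.1 h'
    obtain ⟨-, rfl, rfl⟩ := routerPort_inj hb hb ht ht' e e' he
    rfl

theorem edgeOK_attachEdges {P : List ProcType} {π : Port} (hπ : IsPort P π) :
    ∀ e ∈ attachEdges P π, EdgeOK (expandTypes P) e.1 e.2.1 e.2.2 := by
  intro e he
  have hne := attachEdges_ends_ne hπ e he
  have hlen : P.length ≤ (expandTypes P).length := by simp [expandTypes]
  obtain ⟨t, ht, -, he⟩ := mem_attachEdges.1 he
  obtain ⟨q, q', hq, hq'⟩ := exists_obsPre_obsPost ht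
  rcases he with rfl | rfl
  · exact ⟨isObs_of_obsPre ((half_obs_try ht).1.trans hq), isObs_of_obsPre (obs_recvT ht).1,
      lt_of_lt_of_le hπ hlen, routerIndex_lt ht, hne⟩
  · exact ⟨isObs_of_obsPre (half_obs_commit ht).1, isObs_of_obsPre (obs_resetT ht).1,
      lt_of_lt_of_le hπ hlen, routerIndex_lt ht, hne⟩

theorem edgeOK_forwardEdges {P : List ProcType} {α : List (Port × Port)} :
    ∀ e ∈ forwardEdges P α, EdgeOK (expandTypes P) e.1 e.2.1 e.2.2 := by
  intro e he
  have hne := forwardEdges_ends_ne e he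
  obtain ⟨π, π', t, -, ht, -, he⟩ := mem_forwardEdges.1 he
  rcases he with rfl | rfl
  · exact ⟨isObs_of_obsPre (obs_fwdT ht).1, isObs_of_obsPre (obs_recvT ht).1, routerIndex_lt ht,
      routerIndex_lt ht, hne⟩
  · exact ⟨isObs_of_obsPre (obs_ackT ht).1, isObs_of_obsPre (obs_resetT ht).1, routerIndex_lt ht,
      routerIndex_lt ht, hne⟩

theorem edgeOK_layerEdges {P : List ProcType} (Q : List Port) {b : VRUnary} (hb : b.OK P) :
    ∀ e ∈ layerEdges P Q b, EdgeOK (expandTypes P) e.1 e.2.1 e.2.2 := by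
  cases b with
  | addEdge δ π₁ π₂ =>
    intro e he
    rcases mem_layerEdges_addEdge.1 he with he | he
    · have hne := syncEdges_ends_ne hb e he
      obtain ⟨-, -, rfl⟩ := mem_syncEdges.1 he
      exact ⟨isObs_of_obsPre (obs_syncT hb.1).1, isObs_of_obsPre (obs_syncT hb.2.1).1,
        routerIndex_lt hb.1, routerIndex_lt hb.2.1, hne⟩
    · exact edgeOK_forwardEdges e he
  | rename α => exact edgeOK_forwardEdges

theorem allOps_glue {P : List ProcType} {es : List PortEdge} {t : HRTerm}
    (hes : ∀ e ∈ es, EdgeOK P e.1 e.2.1 e.2.2)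
    (ht : t.AllOps (HRConst.OK P) (InjRenamingOK P)) :
    (glue es t).AllOps (HRConst.OK P) (InjRenamingOK P) := by
  induction es with
  | nil => exact ht
  | cons e es ih =>
    exact ⟨hes e List.mem_cons_self, ih fun e' h => hes e' (List.mem_cons_of_mem _ h)⟩

theorem allOps_translateTerm {P : List ProcType} (Q : List Port) {t : VRTerm}
    (ht : t.AllOps (IsPort P) (VRUnary.OK P)) : (translateTerm P Q t).AllOps
      (HRConst.OK (expandTypes P)) (InjRenamingOK (expandTypes P)) := by
  have hlen : P.length ≤ (expandTypes P).length := by simp [expandTypes]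
  induction t with
  | var X => trivial
  | const π =>
    exact ⟨injRenamingOK_layerRenaming Q zero_lt_two, allOps_glue (edgeOK_attachEdges ht)
      (lt_of_lt_of_le ht hlen : π.1 < _)⟩
  | un b t ih =>
    exact ⟨injRenamingOK_layerRenaming Q zero_lt_two, allOps_glue (edgeOK_layerEdges Q ht.1)
      ⟨injRenamingOK_layerRenaming Q one_lt_two, ih ht.2⟩⟩
  | bin t₁ t₂ ih₁ ih₂ => exact ⟨ih₁ ht.1, ih₂ ht.2⟩

theorem VRGrammar.WF.translateGrammar {P : List ProcType} {Γ : VRGrammar}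
    (hΓ : VRGrammar.WF P Γ) : HRGrammar.WF (expandTypes P) (translateGrammar P Γ) := by
  intro r hr
  rcases List.mem_append.1 hr with hr | hr
  · obtain ⟨X, -, rfl⟩ := List.mem_map.1 hr
    exact ⟨⟨⟨by simp, by simp⟩, by simp⟩, trivial⟩
  · obtain ⟨r, hr', rfl⟩ := List.mem_map.1 hr
    exact allOps_translateTerm _ (hΓ r hr')

theorem VRGrammar.WF.nonempty_network {P : List ProcType} {Γ : VRGrammar}
    (hΓ : VRGrammar.WF P Γ) {X : ℕ} {θ : VRTerm}
    (h : Relation.ReflTransGen Γ.Step (Term.var X) θ) (hθ : θ.Ground) :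
    Nonempty (Network P (algVR.val θ)
      (LGraph.rename [] (algHR.val (translateTerm P (rulePorts Γ.code.2) θ)))) := by
  obtain ⟨N⟩ := nonempty_portNetwork_val hθ (hΓ.portsIn_derived h)
  exact ⟨N.toNetwork.rename []⟩

theorem not_port_mem_rename_nil {G : LGraph} (a : G.V) (π : Port) :
    Label.port π ∉ (LGraph.rename [] G).lab a := fun h => by
  obtain ⟨_, -, h⟩ := mem_rename_port.1 h
  cases h

/-! ### The reduction -/

theorem theorem1 :
    Computable expandTypes ∧
    Computable (fun x : List ProcType × List (Place × ℕ) × Place =>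
      expandLabeling x.1 (fun q => x.2.1.lookup q) x.2.2) ∧
    ∃ F : List ProcType → VRGrammar → HRGrammar,
      (∃ f : List ProcType × List ℕ × List (ℕ × List (ℕ ⊕ Port ⊕ VRUnary ⊕ Unit)) →
          List ℕ × List (ℕ × List (ℕ ⊕ HRConst ⊕ List (Port × Port) ⊕ Unit)),
        Computable f ∧ ∀ (P : List ProcType) (Γ : VRGrammar), f (P, Γ.code) = (F P Γ).code) ∧
      ∀ P : List ProcType, (∀ p ∈ P, p.WF) →
        (∀ p ∈ expandTypes P, p.WF) ∧
        ∀ Γ : VRGrammar, IsVRSystem P Γ →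
          IsHRSystem (expandTypes P) (F P Γ) ∧
          ∀ (L : Place → Option ℕ) (α : ArithFormula),
            PRP algVR Γ α L P ↔
              PRP algHR (F P Γ) α (expandLabeling P L) (expandTypes P) := by
  refine ⟨primrec_expandTypes.to_comp, primrec_expandLabeling.to_comp, translateGrammar,
    ⟨translateCode, primrec_translateCode.to_comp, translateCode_code⟩, fun P hP =>
      ⟨expandTypes_wf hP, fun Γ hΓ => ?_⟩⟩
  have hH : ∀ H ∈ algHR.language (translateGrammar P Γ), IsSystem (expandTypes P) H := by
    intro H hH
    obtain ⟨X, -, θ, h, hθ, rfl⟩ := (mem_language_translateGrammar P Γ H).1 hH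
    obtain ⟨N⟩ := hΓ.1.nonempty_network h hθ
    exact N.isSystem fun a π => not_port_mem_rename_nil (G := algHR.val _) a π
  refine ⟨⟨hΓ.1.translateGrammar, hH⟩, fun L α => ?_⟩
  constructor
  · rintro ⟨G, hG, hs⟩
    have hG' := hG
    obtain ⟨X, hX, θ, h, hθ, rfl⟩ := hG'
    obtain ⟨N⟩ := hΓ.1.nonempty_network h hθ
    have hm := (mem_language_translateGrammar P Γ _).2 ⟨X, hX, θ, h, hθ, rfl⟩
    exact ⟨_, hm, (Network.sat_iff_sat hP (hΓ.2 _ hG) (hH _ hm) N L α).1 hs⟩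
  · rintro ⟨H, hm, hs⟩
    obtain ⟨X, hX, θ, h, hθ, rfl⟩ := (mem_language_translateGrammar P Γ H).1 hm
    obtain ⟨N⟩ := hΓ.1.nonempty_network h hθ
    have hG : algVR.val θ ∈ algVR.language Γ := ⟨X, hX, θ, h, hθ, rfl⟩
    exact ⟨_, hG, (Network.sat_iff_sat hP (hΓ.2 _ hG) (hH _ hm) N L α).2 hs⟩
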